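/- Let $n\ge 2$ and let $\Omega\subset\mathbb R^n$ be open and bounded. Let $s,p,K:\mathbb R^n\times\mathbb R^n\to\mathbb R$ be measurable and symmetric ($f(x,y)=f(y,x)$ for all $x,y$), with $$0<s^-:=\inf_{\mathbb R^n\times\mathbb R^n} s\le \sup_{\mathbb R^n\times\mathbb R^n} s=:s^+<1,\qquad 1<p^-:=\inf_{\mathbb R^n\times\mathbb R^n} p\le\sup_{\mathbb R^n\times\mathbb R^n} p=:p^+<\infty,$$ and, for some $\Lambda>1$, $$\frac{\Lambda^{-1}}{|x-y|^{n+s(x,y)p(x,y)}}\le K(x,y)\le\frac{\Lambda}{|x-y|^{n+s(x,y)p(x,y)}}\quad\text{for a.e. }(x,y)\in\mathbb R^n\times\mathbb R^n.$$ For $f\in\{s,p\}$ and $r>0$ put $$\omega_f(r):=\sup_{B_r\subset\Omega}\ \sup_{x_1,x_2,y_1,y_2\in B_r}|f(x_1,y_1)-f(x_2,y_2)|,$$ where $B_r$ ranges over the open balls of radius $r$ contained in $\Omega$ (and $\omega_f(r)=0$ if there are none), and assume that $$\sup_{0<r\le 1/2}\big(\omega_p(r)+\omega_s(r)\big)\ln\frac1r\le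 c_{LH}\quad\text{for some } c_{LH}>0.$$ Let $\mathcal C_\Omega:=(\mathbb R^n\times\mathbb R^n)\setminus((\mathbb R^n\setminus\Omega)\times(\mathbb R^n\setminus\Omega))$ and $p^-_\Omega:=\inf_{\Omega\times\Omega}p$. Let $\mathbb W^{s(\cdot,\cdot),p(\cdot,\cdot)}(\Omega)$ be the set of measurable $v:\mathbb R^n\to\mathbb R$ with $$v|_\Omega\in L^{p^-_\Omega}(\Omega)\quad\text{and}\quad\iint_{\mathcal C_\Omega}\frac{|v(x)-v(y)|^{p(x,y)}}{|x-y|^{n+s(x,y)p(x,y)}}\,dy\,dx<\infty,$$ and let $L^\infty(\Omega;L^{p(\cdot,\cdot)-1}_{s(\cdot,\cdot)p(\cdot,\cdot)}(\mathbb R^n))$ be the set of measurable $v:\mathbb R^n\to\mathbb R$ with $$\operatorname*{ess\,sup}_{x\in\Omega}\int_{\mathbb R^n}\frac{|v(y)|^{p(x,y)-1}}{(1+|y|)^{n+s(x,y)p(x,y)}}\,dy<\infty.$$ Let $u\in\mathbb W^{s(\cdot,\cdot),p(\cdot,\cdot)}(\Omega)\cap L^\infty(\Omega;L^{p(\cdot,\cdot)-1}_{s(\cdot,\cdot)p(\cdot,\cdot)}(\mathbb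 R^n))$ be a weak solution of $$\mathrm{P.V.}\int_{\mathbb R^n}|u(x)-u(y)|^{p(x,y)-2}(u(x)-u(y))K(x,y)\,dy=0\quad\text{in }\Omega,$$ that is, $$\iint_{\mathcal C_\Omega}|u(x)-u(y)|^{p(x,y)-2}(u(x)-u(y))(\phi(x)-\phi(y))K(x,y)\,dy\,dx=0$$ for every $\phi\in\mathbb W^{s(\cdot,\cdot),p(\cdot,\cdot)}(\Omega)$ with $\phi=0$ a.e. in $\mathbb R^n\setminus\Omega$. Then $u\in C^{0,\alpha}_{\mathrm{loc}}(\Omega)$, i.e. $u$ agrees a.e. in $\Omega$ with a function that is $\alpha$-Hölder continuous on every compact subset of $\Omega$, for some $\alpha\in(0,1)$ depending only on $n$, $s^-$, $s^+$, $p^-$, $p^+$, $\Lambda$ and $c_{LH}$. -/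

import Mathlib

open MeasureTheory
open scoped ENNReal NNReal

namespace NonlocalVar

/-- `ℝⁿ` with the Euclidean norm. -/
abbrev Rn (n : ℕ) : Type := EuclideanSpace ℝ (Fin n)

/-- `f(x,y) = f(y,x)` for all `x`, `y`. -/
def IsSymm {n : ℕ} (f : Rn n → Rn n → ℝ) : Prop :=
  ∀ x y, f x y = f y x

/-- The numbers `lo` and `hi` are the infimum and the supremum of `f` over `ℝⁿ × ℝⁿ`. -/
def HasBounds {n : ℕ} (f : Rn n → Rn n → ℝ) (lo hi : ℝ) : Prop :=
  IsGLB (Set.range fun z : Rn n × Rn n => f z.1 z.2) lo ∧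
    IsLUB (Set.range fun z : Rn n × Rn n => f z.1 z.2) hi

/-- The singular factor `|x-y|^{n + s(x,y) p(x,y)}`. -/
noncomputable def sing {n : ℕ} (s p : Rn n → Rn n → ℝ) (x y : Rn n) : ℝ :=
  ‖x - y‖ ^ ((n : ℝ) + s x y * p x y)

/-- The two-sided bound `Λ⁻¹ / |x-y|^{n+sp} ≤ K ≤ Λ / |x-y|^{n+sp}`,
almost everywhere on `ℝⁿ × ℝⁿ`. -/
def KernelBound {n : ℕ} (s p K : Rn n → Rn n → ℝ) (Λ : ℝ) : Prop :=
  ∀ᵐ z : Rn n × Rn n,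
    Λ⁻¹ / sing s p z.1 z.2 ≤ K z.1 z.2 ∧ K z.1 z.2 ≤ Λ / sing s p z.1 z.2

/-- `C_Ω = (ℝⁿ × ℝⁿ) \ ((ℝⁿ \ Ω) × (ℝⁿ \ Ω))`. -/
def crossSet {n : ℕ} (Ω : Set (Rn n)) : Set (Rn n × Rn n) :=
  (Ωᶜ ×ˢ Ωᶜ)ᶜ

/-- The infimum of `p` over `Ω × Ω`. -/
noncomputable def infOn {n : ℕ} (p : Rn n → Rn n → ℝ) (Ω : Set (Rn n)) : ℝ :=
  sInf ((fun z : Rn n × Rn n => p z.1 z.2) '' (Ω ×ˢ Ω))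

/-- Membership in `𝕎^{s(·,·),p(·,·)}(Ω)`: `v : ℝⁿ → ℝ` is Lebesgue measurable, its restriction to
`Ω` is in `L^{q}(Ω)` with `q` the infimum of `p` over `Ω × Ω`, and the modular over `C_Ω`
is finite. -/
def MemW {n : ℕ} (s p : Rn n → Rn n → ℝ) (Ω : Set (Rn n)) (v : Rn n → ℝ) : Prop :=
  AEMeasurable v volume ∧
  MemLp v (ENNReal.ofReal (infOn p Ω)) (volume.restrict Ω) ∧
  ∫⁻ z in crossSet Ω,
    ENNReal.ofReal (|v z.1 - v z.2| ^ p z.1 z.2 / sing s p z.1 z.2) < ∞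

/-- Membership in the tail space `L^∞(Ω; L^{p(·,·)-1}_{s(·,·)p(·,·)}(ℝⁿ))`. -/
def MemTail {n : ℕ} (s p : Rn n → Rn n → ℝ) (Ω : Set (Rn n)) (v : Rn n → ℝ) : Prop :=
  AEMeasurable v volume ∧
  essSup (fun x : Rn n => ∫⁻ y : Rn n,
    ENNReal.ofReal (|v y| ^ (p x y - 1) / (1 + ‖y‖) ^ ((n : ℝ) + s x y * p x y)))
    (volume.restrict Ω) < ∞

/-- `u ∈ 𝕎^{s,p}(Ω)` is a weak solution of `L_K u = 0` in `Ω`. Under the kernel bound the integrand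
is integrable for all `u`, `φ` in `𝕎^{s,p}(Ω)`, by Young's inequality. -/
def IsWeakSolution {n : ℕ} (s p K : Rn n → Rn n → ℝ) (Ω : Set (Rn n)) (u : Rn n → ℝ) : Prop :=
  MemW s p Ω u ∧
  ∀ φ : Rn n → ℝ, MemW s p Ω φ → (∀ᵐ x ∂(volume.restrict Ωᶜ), φ x = 0) →
    ∫ z in crossSet Ω,
      |u z.1 - u z.2| ^ (p z.1 z.2 - 2) * (u z.1 - u z.2) * (φ z.1 - φ z.2) * K z.1 z.2 = 0

/-- The oscillation `ω_f(r)` near the diagonal: the supremum of `|f(x₁,y₁) - f(x₂,y₂)|` over all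
balls `B_r ⊆ Ω` of radius `r` and all `x₁, x₂, y₁, y₂ ∈ B_r` (equal to `0` if there is no such
ball). -/
noncomputable def osc {n : ℕ} (f : Rn n → Rn n → ℝ) (Ω : Set (Rn n)) (r : ℝ) : ℝ :=
  sSup {t : ℝ | ∃ x₀ : Rn n, Metric.ball x₀ r ⊆ Ω ∧
    ∃ x₁ ∈ Metric.ball x₀ r, ∃ x₂ ∈ Metric.ball x₀ r,
    ∃ y₁ ∈ Metric.ball x₀ r, ∃ y₂ ∈ Metric.ball x₀ r,
      t = |f x₁ y₁ - f x₂ y₂|}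

/-- Log-Hölder continuity on the diagonal with constant `c`. -/
def LogHolder {n : ℕ} (s p : Rn n → Rn n → ℝ) (Ω : Set (Rn n)) (c : ℝ) : Prop :=
  ∀ r : ℝ, 0 < r → r ≤ 1 / 2 → (osc p Ω r + osc s Ω r) * Real.log (1 / r) ≤ c

/-- `u ∈ C^{0,α}_loc(Ω)` as a class of functions: `u` agrees almost everywhere in `Ω` with a
function that is `α`-Hölder continuous on every compact subset of `Ω`. -/
def MemHolderLoc {n : ℕ} (α : ℝ≥0) (Ω : Set (Rn n)) (u : Rn n → ℝ) : Prop :=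
  ∃ v : Rn n → ℝ, (∀ᵐ x ∂(volume.restrict Ω), u x = v x) ∧
    ∀ Q : Set (Rn n), IsCompact Q → Q ⊆ Ω → ∃ C : ℝ≥0, HolderOnWith C α v Q

end NonlocalVar

/-! The proof is De Giorgi's method, arranged so that no Sobolev inequality with variable exponents
is needed. Testing the equation with (k-u)₊ η^q gives an energy inequality (`Admissible.energy`,
then `caccioppoli`) whose left side keeps only the pairs with u(x) < k ≤ u(y), weighted by
(u(y)-u(x))^{p-1} (k-u(x)) / |x-y|^{n+sp}. These pairs suffice. If {u < k} fills at most half a ball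
of radius τ, then every x with u(x) ≤ k-d sees, within distance τ, half a ball of points y with u(y)
≥ k, and so contributes at least a constant times d^p τ^{-sp}. This remark
(`measure_mul_le_lintegral`) takes the place of Sobolev's inequality. It gives `level_set_decay`,
which `fast_geometric_decay` iterates by letting τ shrink geometrically along with the radii and
levels.

Local boundedness: write σ = sm·pm. On a small ball p oscillates by at most σ/(4n). The finite
modular alone gives u slightly more integrability than its exponent
(`Solution.lintegral_rpow_lt_top`), enough to start a bootstrap that puts the negative part u₋ in
every L^q. A De Giorgi iteration then bounds u₋, and -u is treated in the same way.

Oscillation: log-Hölder continuity makes d^{p(x,y)} r^{-s(x,y)p(x,y)} comparable, for all x, y in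
B_r, to one number D, as long as r ≤ d ≤ 1/r. If moreover the tail is at most a multiple of D/d, the
usual growth lemma holds. When u ≥ m + ω/2 on half of B_{r/4}, the pairs joining that half to {u < m
+ δω} have a jump of order ω, much larger than d = δω, which forces the second set to have measure
at most C δ^{pm-1} r^n. The De Giorgi iteration then gives u ≥ m + δω/2 on B_{r/8}. Applied to u or
to -u, this reduces the oscillation by θ = 8^{-α} from r to r/8.

The tail at scale r is controlled by the oscillation bounds already known on larger balls
(`exists_growthHyp`). The deficit below m + 2d, measured in units of d, grows at most like a small
power of |y-x₀|/r. Hence the tail constant C₁ depends on neither δ nor α, and the choices C₁, then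
δ, then α are not circular. The decay at all centres finally yields a Hölder representative. -/

namespace NonlocalVar

/-! ### Measures of balls, dyadic shells, and a substitute for Sobolev's inequality -/

section Geometry

variable {n : ℕ}

lemma volume_ball_eq (hn : 0 < n) (x : Rn n) {r : ℝ} (hr : 0 ≤ r) :
    volume (Metric.ball x r) = ENNReal.ofReal (r ^ n) * volume (Metric.ball (0 : Rn n) 1) := by
  have : Nonempty (Fin n) := ⟨⟨0, hn⟩⟩
  have := Measure.addHaar_ball (volume : Measure (Rn n)) x hr
  simpa using this

/-- The volume of the unit ball. -/
noncomputable def ballVol (n : ℕ) : ℝ := (volume (Metric.ball (0 : Rn n) 1)).toReal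

lemma ballVol_pos : 0 < ballVol n := by
  unfold ballVol
  exact ENNReal.toReal_pos (Metric.measure_ball_pos _ _ one_pos).ne' measure_ball_lt_top.ne

lemma volume_ball_ofReal (hn : 0 < n) (x : Rn n) {r : ℝ} (hr : 0 ≤ r) :
    volume (Metric.ball x r) = ENNReal.ofReal (ballVol n * r ^ n) := by
  rw [volume_ball_eq hn x hr, mul_comm (ballVol n), ENNReal.ofReal_mul (by positivity), ballVol,
    ENNReal.ofReal_toReal measure_ball_lt_top.ne]

/-- Dyadic shells `2⁻⁽ⁱ⁺¹⁾ r ≤ |x - y| < 2⁻ⁱ r` and their sum. -/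
lemma lintegral_near (hn : 0 < n) {κ : ℝ} (hκ : 0 < κ) :
    ∃ C : ℝ, 0 < C ∧ ∀ (x : Rn n) (r : ℝ), 0 < r →
      ∫⁻ y in Metric.ball x r, ENNReal.ofReal (‖x - y‖ ^ (κ - n)) ≤ ENNReal.ofReal (C * r ^ κ) := by
  set θ : ℝ := (2 : ℝ)⁻¹ ^ κ with hθ
  have hθ0 : 0 < θ := by positivity
  have hθ1 : θ < 1 := Real.rpow_lt_one (by norm_num) (by norm_num) hκ
  refine ⟨ballVol n * 2 ^ (n + κ) * (1 - θ)⁻¹, by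
    have := @ballVol_pos n; have : 0 < (1 - θ)⁻¹ := inv_pos.2 (by linarith)
    positivity, fun x r hr => ?_⟩
  set S : ℕ → Set (Rn n) := fun i =>
    {y | r * 2⁻¹ ^ (i + 1) ≤ ‖x - y‖ ∧ ‖x - y‖ < r * 2⁻¹ ^ i} with hS
  have hSm : ∀ i, MeasurableSet (S i) := fun i => by
    have hf : Measurable fun y : Rn n => ‖x - y‖ := by fun_prop
    exact (measurableSet_le measurable_const hf).inter (measurableSet_lt hf measurable_const)
  have hcov : Metric.ball x r ⊆ {x} ∪ ⋃ i, S i := by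
    intro y hy
    by_cases hxy : y = x
    · left; exact hxy
    right
    have h0 : 0 < ‖x - y‖ := norm_pos_iff.2 (sub_ne_zero.2 (Ne.symm hxy))
    have h1 : ‖x - y‖ / r ≤ 1 := by
      rw [div_le_one hr]
      rw [Metric.mem_ball, dist_comm, dist_eq_norm] at hy; exact hy.le
    obtain ⟨i, hi1, hi2⟩ := exists_nat_pow_near_of_lt_one (show 0 < ‖x - y‖ / r by positivity) h1
      (show (0 : ℝ) < 2⁻¹ by norm_num) (by norm_num)
    rw [Metric.mem_ball, dist_comm, dist_eq_norm] at hy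
    rcases hi2.lt_or_eq with hlt | heq
    · refine Set.mem_iUnion.2 ⟨i, ?_, ?_⟩
      · rw [lt_div_iff₀ hr] at hi1; linarith
      · rw [div_lt_iff₀ hr] at hlt; linarith
    · cases i with
      | zero => simp at heq; rw [div_eq_one_iff_eq hr.ne'] at heq; linarith
      | succ i =>
        rw [div_eq_iff hr.ne'] at heq
        refine Set.mem_iUnion.2 ⟨i, by rw [heq]; linarith, ?_⟩
        rw [heq, mul_comm]
        have : (2 : ℝ)⁻¹ ^ (i + 1) < 2⁻¹ ^ i := pow_lt_pow_right_of_lt_one₀ (by norm_num)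
          (by norm_num) (by omega)
        gcongr
  have hsing : volume ({x} : Set (Rn n)) = 0 := by
    have : Nonempty (Fin n) := ⟨⟨0, hn⟩⟩
    exact measure_singleton x
  have hshell : ∀ i, ∫⁻ y in S i, ENNReal.ofReal (‖x - y‖ ^ (κ - n)) ≤
      ENNReal.ofReal (ballVol n * 2 ^ (n + κ) * r ^ κ * θ ^ i) := by
    intro i
    set t : ℝ := r * 2⁻¹ ^ i with ht
    have ht0 : 0 < t := by positivity
    have hpt : ∀ y ∈ S i, ENNReal.ofReal (‖x - y‖ ^ (κ - n)) ≤
        ENNReal.ofReal (t ^ κ * (t * 2⁻¹) ^ (-(n : ℝ))) := by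
      rintro y ⟨h1, h2⟩
      have h1' : t * 2⁻¹ ≤ ‖x - y‖ := by rw [ht]; rw [pow_succ] at h1; linarith
      have h0 : 0 < ‖x - y‖ := lt_of_lt_of_le (by positivity) h1'
      apply ENNReal.ofReal_le_ofReal
      rw [sub_eq_add_neg κ, Real.rpow_add h0]
      apply mul_le_mul (Real.rpow_le_rpow h0.le h2.le hκ.le) _ (by positivity) (by positivity)
      exact Real.rpow_le_rpow_of_nonpos (by positivity) h1' (by simp)
    calc _ ≤ ∫⁻ y in S i, ENNReal.ofReal (t ^ κ * (t * 2⁻¹) ^ (-(n : ℝ))) :=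
          setLIntegral_mono' (hSm i) hpt
      _ = ENNReal.ofReal (t ^ κ * (t * 2⁻¹) ^ (-(n : ℝ))) * volume (S i) := by simp
      _ ≤ ENNReal.ofReal (t ^ κ * (t * 2⁻¹) ^ (-(n : ℝ))) * volume (Metric.ball x t) := by
          gcongr
          intro y hy
          rw [Metric.mem_ball, dist_comm, dist_eq_norm]; exact hy.2
      _ = ENNReal.ofReal (t ^ κ * (t * 2⁻¹) ^ (-(n : ℝ)) * (ballVol n * t ^ n)) := by
          rw [volume_ball_ofReal hn x ht0.le, ← ENNReal.ofReal_mul (by positivity)]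
      _ ≤ _ := by
          apply ENNReal.ofReal_le_ofReal
          have e1 : t ^ κ = r ^ κ * θ ^ i := by
            rw [ht, Real.mul_rpow hr.le (by positivity), hθ, ← Real.rpow_natCast, ← Real.rpow_natCast,
              ← Real.rpow_mul (by norm_num), ← Real.rpow_mul (by norm_num), mul_comm (i : ℝ)]
          have e2 : (t * 2⁻¹) ^ (-(n : ℝ)) = (t ^ n)⁻¹ * 2 ^ (n : ℝ) := by
            rw [Real.rpow_neg (by positivity), Real.rpow_natCast, mul_pow, mul_inv, inv_pow, inv_inv,
              Real.rpow_natCast]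
          rw [e1, e2]
          have h3 : (2 : ℝ) ^ (n : ℝ) ≤ 2 ^ ((n : ℝ) + κ) :=
            Real.rpow_le_rpow_of_exponent_le (by norm_num) (by linarith)
          have := @ballVol_pos n
          calc _ = ballVol n * 2 ^ (n : ℝ) * r ^ κ * θ ^ i := by field_simp
            _ ≤ _ := by gcongr
  calc ∫⁻ y in Metric.ball x r, ENNReal.ofReal (‖x - y‖ ^ (κ - n))
      ≤ ∫⁻ y in {x} ∪ ⋃ i, S i, ENNReal.ofReal (‖x - y‖ ^ (κ - n)) := lintegral_mono_set hcov
    _ ≤ (∫⁻ y in {x}, ENNReal.ofReal (‖x - y‖ ^ (κ - n))) +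
        ∫⁻ y in ⋃ i, S i, ENNReal.ofReal (‖x - y‖ ^ (κ - n)) := lintegral_union_le _ _ _
    _ ≤ 0 + ∑' i, ∫⁻ y in S i, ENNReal.ofReal (‖x - y‖ ^ (κ - n)) := by
        gcongr
        · rw [setLIntegral_measure_zero _ _ hsing]
        · exact lintegral_iUnion_le _ _
    _ ≤ ∑' i, ENNReal.ofReal (ballVol n * 2 ^ (n + κ) * r ^ κ * θ ^ i) := by
        rw [zero_add]; exact ENNReal.tsum_le_tsum hshell
    _ = _ := by
        have := @ballVol_pos n
        rw [← ENNReal.ofReal_tsum_of_nonneg (fun i => by positivity)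
          ((summable_geometric_of_lt_one hθ0.le hθ1).mul_left _), tsum_mul_left,
          tsum_geometric_of_lt_one hθ0.le hθ1]
        congr 1; ring

lemma lintegral_far (hn : 0 < n) {σ : ℝ} (hσ : 0 < σ) :
    ∃ C : ℝ, 0 < C ∧ ∀ (x : Rn n) (r : ℝ), 0 < r →
      ∫⁻ y in {y | r ≤ ‖x - y‖}, ENNReal.ofReal (‖x - y‖ ^ (-(n + σ))) ≤
        ENNReal.ofReal (C * r ^ (-σ)) := by
  set θ : ℝ := (2 : ℝ) ^ (-σ) with hθ
  have hθ0 : 0 < θ := by positivity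
  have hθ1 : θ < 1 := Real.rpow_lt_one_of_one_lt_of_neg (by norm_num) (by linarith)
  refine ⟨ballVol n * 2 ^ n * (1 - θ)⁻¹, by
    have := @ballVol_pos n; have : 0 < (1 - θ)⁻¹ := inv_pos.2 (by linarith)
    positivity, fun x r hr => ?_⟩
  set S : ℕ → Set (Rn n) := fun i =>
    {y | r * 2 ^ i ≤ ‖x - y‖ ∧ ‖x - y‖ < r * 2 ^ (i + 1)} with hS
  have hSm : ∀ i, MeasurableSet (S i) := fun i => by
    have hf : Measurable fun y : Rn n => ‖x - y‖ := by fun_prop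
    exact (measurableSet_le measurable_const hf).inter (measurableSet_lt hf measurable_const)
  have hcov : {y | r ≤ ‖x - y‖} ⊆ ⋃ i, S i := by
    intro y hy
    have hy' : r ≤ ‖x - y‖ := hy
    obtain ⟨i, hi1, hi2⟩ := exists_nat_pow_near ((one_le_div hr).2 hy') (one_lt_two)
    refine Set.mem_iUnion.2 ⟨i, ?_, ?_⟩
    · rw [le_div_iff₀ hr] at hi1; linarith
    · rw [div_lt_iff₀ hr] at hi2; linarith
  have hshell : ∀ i, ∫⁻ y in S i, ENNReal.ofReal (‖x - y‖ ^ (-(n + σ))) ≤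
      ENNReal.ofReal (ballVol n * 2 ^ n * r ^ (-σ) * θ ^ i) := by
    intro i
    set t : ℝ := r * 2 ^ i with ht
    have ht0 : 0 < t := by positivity
    have hpt : ∀ y ∈ S i, ENNReal.ofReal (‖x - y‖ ^ (-(n + σ))) ≤
        ENNReal.ofReal (t ^ (-(n + σ))) := by
      rintro y ⟨h1, h2⟩
      apply ENNReal.ofReal_le_ofReal
      exact Real.rpow_le_rpow_of_nonpos ht0 h1 (by have : (0:ℝ) ≤ n := by positivity
                                                   linarith)
    calc _ ≤ ∫⁻ y in S i, ENNReal.ofReal (t ^ (-(n + σ))) :=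
          setLIntegral_mono' (hSm i) hpt
      _ = ENNReal.ofReal (t ^ (-(n + σ))) * volume (S i) := by simp
      _ ≤ ENNReal.ofReal (t ^ (-(n + σ))) * volume (Metric.ball x (2 * t)) := by
          gcongr
          intro y hy
          rw [Metric.mem_ball, dist_comm, dist_eq_norm, ht]
          have := hy.2; rw [pow_succ] at this; linarith
      _ = ENNReal.ofReal (t ^ (-(n + σ)) * (ballVol n * (2 * t) ^ n)) := by
          rw [volume_ball_ofReal hn x (by positivity), ← ENNReal.ofReal_mul (by positivity)]
      _ ≤ _ := by
          apply ENNReal.ofReal_le_ofReal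
          apply le_of_eq
          have e1 : t ^ (-σ) = r ^ (-σ) * θ ^ i := by
            rw [ht, Real.mul_rpow hr.le (by positivity), hθ, ← Real.rpow_natCast, ← Real.rpow_natCast,
              ← Real.rpow_mul (by norm_num), ← Real.rpow_mul (by norm_num), mul_comm (i : ℝ)]
          have e2 : t ^ (-(n + σ)) = (t ^ n)⁻¹ * t ^ (-σ) := by
            rw [neg_add, Real.rpow_add ht0, Real.rpow_neg ht0.le, Real.rpow_natCast]
          rw [e2, e1, mul_pow 2 t]
          field_simp
  calc ∫⁻ y in {y | r ≤ ‖x - y‖}, ENNReal.ofReal (‖x - y‖ ^ (-(n + σ)))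
      ≤ ∫⁻ y in ⋃ i, S i, ENNReal.ofReal (‖x - y‖ ^ (-(n + σ))) := lintegral_mono_set hcov
    _ ≤ ∑' i, ∫⁻ y in S i, ENNReal.ofReal (‖x - y‖ ^ (-(n + σ))) := lintegral_iUnion_le _ _
    _ ≤ ∑' i, ENNReal.ofReal (ballVol n * 2 ^ n * r ^ (-σ) * θ ^ i) :=
        ENNReal.tsum_le_tsum hshell
    _ = _ := by
        have := @ballVol_pos n
        rw [← ENNReal.ofReal_tsum_of_nonneg (fun i => by positivity)
          ((summable_geometric_of_lt_one hθ0.le hθ1).mul_left _), tsum_mul_left,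
          tsum_geometric_of_lt_one hθ0.le hθ1]
        congr 1; ring

/-- If `A` occupies at most half of a ball of radius `τ ≤ ρ - ρ'`, a lower bound `V` for `H` on
`X × (B_ρ \ A)` near the diagonal bounds the double integral of `H` from below. -/
lemma measure_mul_le_lintegral (x₀ : Rn n) {ρ' ρ τ : ℝ} (hτ : τ ≤ ρ - ρ')
    {X A : Set (Rn n)} (hX : MeasurableSet X) (hA : MeasurableSet A) (hXB : X ⊆ Metric.ball x₀ ρ')
    (hvol : volume A ≤ 2⁻¹ * volume (Metric.ball (0 : Rn n) τ)) {V : ℝ≥0∞}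
    {H : Rn n → Rn n → ℝ≥0∞}
    (hV : ∀ x ∈ X, ∀ y ∈ Metric.ball x₀ ρ, y ∉ A → ‖x - y‖ < τ → V ≤ H x y) :
    volume X * (V * (2⁻¹ * volume (Metric.ball (0 : Rn n) τ))) ≤
      ∫⁻ x in Metric.ball x₀ ρ', ∫⁻ y in Metric.ball x₀ ρ, H x y := by
  have key : ∀ x ∈ X, V * (2⁻¹ * volume (Metric.ball (0 : Rn n) τ)) ≤
      ∫⁻ y in Metric.ball x₀ ρ, H x y := by
    intro x hx
    have hsub : Metric.ball x τ \ A ⊆ Metric.ball x₀ ρ := by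
      intro y hy
      have h1 := hXB hx
      have h2 := hy.1
      rw [Metric.mem_ball] at h1 h2 ⊢
      linarith [dist_triangle y x x₀]
    have hb : volume (Metric.ball x τ) = volume (Metric.ball (0 : Rn n) τ) :=
      Measure.addHaar_ball_center _ _ _
    have hm : 2⁻¹ * volume (Metric.ball (0 : Rn n) τ) ≤ volume (Metric.ball x τ \ A) := by
      have h1 : volume (Metric.ball x τ) - volume A ≤ volume (Metric.ball x τ \ A) :=
        le_measure_sdiff
      refine le_trans ?_ h1
      have hfin : 2⁻¹ * volume (Metric.ball (0 : Rn n) τ) ≠ ∞ :=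
        ENNReal.mul_ne_top (by simp) measure_ball_lt_top.ne
      have h2 : volume (Metric.ball x τ) = 2⁻¹ * volume (Metric.ball (0 : Rn n) τ) +
          2⁻¹ * volume (Metric.ball (0 : Rn n) τ) := by
        rw [hb, ← add_mul, ENNReal.inv_two_add_inv_two, one_mul]
      refine le_trans ?_ (tsub_le_tsub_left hvol _)
      rw [h2, ENNReal.add_sub_cancel_right hfin]
    calc _ ≤ V * volume (Metric.ball x τ \ A) := by gcongr
      _ = ∫⁻ y in Metric.ball x τ \ A, V := by simp
      _ ≤ ∫⁻ y in Metric.ball x τ \ A, H x y := by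
          apply setLIntegral_mono' (Metric.isOpen_ball.measurableSet.diff hA)
          intro y hy
          refine hV x hx y (hsub hy) hy.2 ?_
          have := hy.1
          rwa [Metric.mem_ball, dist_comm, dist_eq_norm] at this
      _ ≤ _ := lintegral_mono_set hsub
  calc _ = ∫⁻ x in X, V * (2⁻¹ * volume (Metric.ball (0 : Rn n) τ)) := by simp [mul_comm]
    _ ≤ ∫⁻ x in X, ∫⁻ y in Metric.ball x₀ ρ, H x y := setLIntegral_mono' hX key
    _ ≤ _ := lintegral_mono_set hXB

end Geometry

/-! ### Pointwise inequalities for the flux against a test function -/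

section Pointwise

lemma abs_rpow_mul_of_pos {p t : ℝ} (ht : 0 < t) : |t| ^ (p - 2) * t = t ^ (p - 1) := by
  rw [abs_of_pos ht]
  nth_rewrite 2 [← Real.rpow_one t]
  rw [← Real.rpow_add ht]; congr 1; ring

lemma abs_abs_rpow_mul {p t : ℝ} (hp : 1 < p) : |(|t| ^ (p - 2) * t)| = |t| ^ (p - 1) := by
  rcases eq_or_ne t 0 with rfl | ht
  · simp [Real.zero_rpow (show p - 1 ≠ 0 by linarith)]
  · rw [abs_mul, abs_of_nonneg (by positivity : 0 ≤ |t| ^ (p - 2))]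
    have := abs_rpow_mul_of_pos (p := p) (abs_pos.2 ht)
    rwa [abs_abs] at this

lemma rpow_sub_one_mul_self {p t : ℝ} (hp : 1 < p) (ht : 0 ≤ t) : t ^ (p - 1) * t = t ^ p := by
  rcases ht.eq_or_lt with rfl | ht
  · simp [Real.zero_rpow (show p ≠ 0 by linarith)]
  · nth_rewrite 2 [← Real.rpow_one t]
    rw [← Real.rpow_add ht]; congr 1; ring

lemma rpow_sub_one_mul_le {p X Y : ℝ} (hp : 1 < p) (hX : 0 ≤ X) (hY : 0 ≤ Y) :
    X ^ (p - 1) * Y ≤ X ^ p + Y ^ p := by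
  rcases le_total X Y with h | h
  · calc X ^ (p - 1) * Y ≤ Y ^ (p - 1) * Y := by gcongr
      _ = Y ^ p := rpow_sub_one_mul_self hp hY
      _ ≤ _ := by have : 0 ≤ X ^ p := by positivity
                  linarith
  · calc X ^ (p - 1) * Y ≤ X ^ (p - 1) * X := by gcongr
      _ = X ^ p := rpow_sub_one_mul_self hp hX
      _ ≤ _ := by have : 0 ≤ Y ^ p := by positivity
                  linarith

lemma pow_sub_pow_le {e f : ℝ} (he : 0 ≤ e) (hef : e ≤ f) (q : ℕ) :
    f ^ q - e ^ q ≤ q * f ^ (q - 1) * (f - e) := by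
  have hf : 0 ≤ f := he.trans hef
  rw [← Commute.geom_sum₂_mul (Commute.all f e) q]
  refine mul_le_mul_of_nonneg_right ?_ (by linarith)
  calc _ ≤ ∑ i ∈ Finset.range q, f ^ (q - 1) := by
        refine Finset.sum_le_sum fun i hi => ?_
        have hi' := Finset.mem_range.1 hi
        calc f ^ i * e ^ (q - 1 - i) ≤ f ^ i * f ^ (q - 1 - i) := by gcongr
          _ = f ^ (q - 1) := by rw [← pow_add]; congr 1; omega
    _ = _ := by simp

lemma abs_pow_sub_pow_le {e f : ℝ} (he : 0 ≤ e) (he1 : e ≤ 1) (hf : 0 ≤ f) (hf1 : f ≤ 1) (q : ℕ) :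
    |e ^ q - f ^ q| ≤ q * |e - f| := by
  wlog h : e ≤ f generalizing e f
  · rw [abs_sub_comm, abs_sub_comm e]; exact this hf hf1 he he1 (le_of_not_ge h)
  rw [abs_sub_comm, abs_sub_comm e, abs_of_nonneg (sub_nonneg.2 (pow_le_pow_left₀ he h q)),
    abs_of_nonneg (sub_nonneg.2 h)]
  refine (pow_sub_pow_le he h q).trans ?_
  have : f ^ (q - 1) ≤ 1 := pow_le_one₀ hf hf1
  have h2 : (0 : ℝ) ≤ q := by positivity
  have h3 : 0 ≤ f - e := by linarith
  calc (q : ℝ) * f ^ (q - 1) * (f - e) ≤ q * 1 * (f - e) := by gcongr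
    _ = _ := by ring

/-- The sign can fail only when f > e. There f^q - e^q ≤ q f^{q-1}(f-e) gives a e^q - b f^q ≥
f^{q-1}((a-b)f - Y) with Y = q a |e-f|. The bracket is negative only if (a-b)f < Y. In that case q ≥
p and f ≤ 1 give (a-b)^{p-1} f^{q-1} ≤ ((a-b)f)^{p-1} ≤ Y^{p-1}, and the error is at most Y^p. -/
lemma cutoff_error_bound {p a b e f : ℝ} {q : ℕ} (hp : 1 < p) (hpq : p ≤ q)
    (he : 0 ≤ e) (hf : 0 ≤ f) (hf1 : f ≤ 1) (hb : 0 < b) (hab : b < a) :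
    0 ≤ (a - b) ^ (p - 1) * (a * e ^ q - b * f ^ q) + (q * a * |e - f|) ^ p := by
  have ha : 0 < a := hb.trans hab
  have hd : 0 < a - b := by linarith
  have hq : (0 : ℝ) ≤ q := by positivity
  have hbad : 0 ≤ (q * a * |e - f|) ^ p := by positivity
  rcases le_or_gt f e with h | h
  · have : b * f ^ q ≤ a * e ^ q := by gcongr
    have h2 : 0 ≤ (a - b) ^ (p - 1) * (a * e ^ q - b * f ^ q) := by
      apply mul_nonneg (by positivity); linarith
    linarith
  have hf0 : 0 < f := lt_of_le_of_lt he h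
  have hq1 : 1 ≤ q := by
    have : (1 : ℝ) < q := by linarith
    exact_mod_cast this.le
  have habs : |e - f| = f - e := by rw [abs_sub_comm, abs_of_pos]; linarith
  have h1 : f ^ (q - 1) * ((a - b) * f - q * a * |e - f|) ≤ a * e ^ q - b * f ^ q := by
    have h2 := pow_sub_pow_le he h.le q
    have h3 : f ^ q = f ^ (q - 1) * f := by rw [← pow_succ]; congr 1; omega
    rw [habs]
    calc f ^ (q - 1) * ((a - b) * f - q * a * (f - e))
        = (a - b) * (f ^ (q - 1) * f) - a * (q * f ^ (q - 1) * (f - e)) := by ring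
      _ = (a - b) * f ^ q - a * (q * f ^ (q - 1) * (f - e)) := by rw [h3]
      _ ≤ (a - b) * f ^ q - a * (f ^ q - e ^ q) := by gcongr
      _ = _ := by ring
  set Y := q * a * |e - f| with hY
  have hY0 : 0 ≤ Y := by positivity
  have hpow : (0:ℝ) ≤ f ^ (q - 1) := by positivity
  have hdp : 0 ≤ (a - b) ^ (p - 1) := by positivity
  rcases le_or_gt Y ((a - b) * f) with hc | hc
  · have : 0 ≤ f ^ (q - 1) * ((a - b) * f - Y) := mul_nonneg hpow (by linarith)
    have := mul_nonneg hdp (this.trans h1)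
    linarith
  · have h4 : -(f ^ (q - 1) * Y) ≤ a * e ^ q - b * f ^ q := by
      refine le_trans ?_ h1
      have : 0 ≤ f ^ (q - 1) * ((a - b) * f) := by positivity
      linarith
    have h5 : (a - b) ^ (p - 1) * (f ^ (q - 1) * Y) ≤ Y ^ p := by
      have h6 : f ^ (q - 1) ≤ f ^ (p - 1) := by
        rw [← Real.rpow_natCast]
        apply Real.rpow_le_rpow_of_exponent_ge hf0 hf1
        push_cast [Nat.cast_sub hq1]; linarith
      calc (a - b) ^ (p - 1) * (f ^ (q - 1) * Y) ≤ (a - b) ^ (p - 1) * (f ^ (p - 1) * Y) := by gcongr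
        _ = ((a - b) * f) ^ (p - 1) * Y := by rw [Real.mul_rpow hd.le hf]; ring
        _ ≤ Y ^ (p - 1) * Y := by gcongr
        _ = Y ^ p := rpow_sub_one_mul_self hp hY0
    have h7 := mul_le_mul_of_nonneg_left h4 hdp
    linarith

/-- The good term `(a - b)^{p-1} a e^q` for `b ≤ 0 < a`. -/
noncomputable def good (p a b e : ℝ) (q : ℕ) : ℝ :=
  if 0 < a ∧ b ≤ 0 then (a - b) ^ (p - 1) * a * e ^ q else 0

/-- The error term created by the cutoff. -/
noncomputable def bad (p a b e f : ℝ) (q : ℕ) : ℝ :=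
  (q * max (max a 0) (max b 0) * |e - f|) ^ p

lemma good_nonneg {p a b e : ℝ} {q : ℕ} (he : 0 ≤ e) : 0 ≤ good p a b e q := by
  unfold good; split_ifs with h
  · have h1 := h.1; have : 0 ≤ a - b := by linarith [h.2]
    positivity
  · exact le_rfl

lemma bad_nonneg {p a b e f : ℝ} {q : ℕ} : 0 ≤ bad p a b e f q := by
  unfold bad
  have : 0 ≤ max (max a 0) (max b 0) := le_max_of_le_left (le_max_right _ _)
  positivity

lemma bad_comm (p a b e f : ℝ) (q : ℕ) : bad p a b e f q = bad p b a f e q := by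
  unfold bad; rw [max_comm, abs_sub_comm]

/-- For b ≤ 0 < a the good term is the flux itself. For a ≤ 0 the test function vanishes at both
points, and for 0 < b < a nothing is gained and only the cutoff error is paid. -/
lemma good_le_aux {p a b e f : ℝ} {q : ℕ} (hp : 1 < p) (hpq : p ≤ q)
    (he : 0 ≤ e) (hf : 0 ≤ f) (hf1 : f ≤ 1) (hab : b < a) :
    good p a b e q ≤ |a - b| ^ (p - 2) * (a - b) * (max a 0 * e ^ q - max b 0 * f ^ q) +
      bad p a b e f q := by
  rw [abs_rpow_mul_of_pos (by linarith : 0 < a - b)]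
  have hbad := @bad_nonneg p a b e f q
  rcases le_or_gt a 0 with ha | ha
  · have hg : good p a b e q = 0 := by unfold good; rw [if_neg]; intro h; linarith [h.1]
    rw [hg, max_eq_right ha, max_eq_right (by linarith)]; simpa using hbad
  rcases le_or_gt b 0 with hb | hb
  · have hg : good p a b e q = (a - b) ^ (p - 1) * a * e ^ q := by
      unfold good; rw [if_pos ⟨ha, hb⟩]
    rw [hg, max_eq_left ha.le, max_eq_right hb]
    simp only [zero_mul, sub_zero]; rw [← mul_assoc]; linarith
  · have hg : good p a b e q = 0 := by unfold good; rw [if_neg]; intro h; linarith [h.2]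
    have := cutoff_error_bound hp hpq he hf hf1 hb hab
    rw [hg]; unfold bad
    rw [max_eq_left ha.le, max_eq_left hb.le, max_eq_left hab.le]
    exact this

/-- The flux is invariant under exchanging (a, e) with (b, f). This settles a < b, where the left
side is zero and the good term of the exchanged pair is dropped. -/
lemma good_le {p a b e f : ℝ} {q : ℕ} (hp : 1 < p) (hpq : p ≤ q)
    (he : 0 ≤ e) (he1 : e ≤ 1) (hf : 0 ≤ f) (hf1 : f ≤ 1) :
    good p a b e q ≤ |a - b| ^ (p - 2) * (a - b) * (max a 0 * e ^ q - max b 0 * f ^ q) +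
      bad p a b e f q := by
  rcases lt_trichotomy a b with h | h | h
  · have hg : good p a b e q = 0 := by
      unfold good; rw [if_neg]; rintro ⟨h1, h2⟩; linarith
    have h1 := good_le_aux hp hpq hf he he1 h
    have h2 := @good_nonneg p b a f q hf
    rw [hg]
    rw [bad_comm, abs_sub_comm]
    calc (0 : ℝ) ≤ _ := h2.trans h1
      _ = _ := by ring
  · subst h
    have hg : good p a a e q = 0 := by
      unfold good; rw [if_neg]; rintro ⟨h1, h2⟩; linarith
    rw [hg]; simpa using bad_nonneg
  · exact good_le_aux hp hpq he hf hf1 h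

lemma abs_min_max_sub_le (a b M : ℝ) : |min (max a 0) M - min (max b 0) M| ≤ |a - b| := by
  refine (abs_min_sub_min_le_max _ _ _ _).trans ?_
  refine max_le ((abs_max_sub_max_le_max _ _ _ _).trans ?_) (by simp)
  simp

lemma truncated_diff_le {a b e f M : ℝ} {q : ℕ} (hM : 0 ≤ M)
    (he : 0 ≤ e) (he1 : e ≤ 1) (hf : 0 ≤ f) (hf1 : f ≤ 1) :
    |min (max a 0) M * e ^ q - min (max b 0) M * f ^ q| ≤
      |a - b| + min (max b 0) M * (q * |e - f|) := by
  have h1 := abs_min_max_sub_le a b M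
  have hq := abs_pow_sub_pow_le he he1 hf hf1 q
  have hb0 : 0 ≤ min (max b 0) M := le_min (le_max_right _ _) hM
  have he0 : 0 ≤ e ^ q := by positivity
  have heq : e ^ q ≤ 1 := pow_le_one₀ he he1
  calc _ = |(min (max a 0) M - min (max b 0) M) * e ^ q + min (max b 0) M * (e ^ q - f ^ q)| := by
        congr 1; ring
    _ ≤ |(min (max a 0) M - min (max b 0) M) * e ^ q| + |min (max b 0) M * (e ^ q - f ^ q)| :=
        abs_add_le _ _
    _ = |min (max a 0) M - min (max b 0) M| * e ^ q + min (max b 0) M * |e ^ q - f ^ q| := by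
        rw [abs_mul, abs_mul, abs_of_nonneg he0, abs_of_nonneg hb0]
    _ ≤ |a - b| * 1 + min (max b 0) M * (q * |e - f|) := by gcongr
    _ = _ := by ring

/-- For pairs on which the truncation at M may act, no sign is kept and Young's inequality is
applied crudely. The price 3|a-b|^p is harmless: it will be integrated only over max(a,b) > M, and M
tends to infinity. -/
lemma good_le_truncated_large {p a b e f M : ℝ} {q : ℕ} (hp : 1 < p) (hM : 0 ≤ M)
    (he : 0 ≤ e) (he1 : e ≤ 1) (hf : 0 ≤ f) (hf1 : f ≤ 1) :
    good p a b e q ≤ |a - b| ^ (p - 2) * (a - b) *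
      (min (max a 0) M * e ^ q - min (max b 0) M * f ^ q) +
      (3 * |a - b| ^ p + bad p a b e f q) := by
  have hg : good p a b e q ≤ |a - b| ^ p := by
    unfold good
    split_ifs with h
    · have h0 : 0 < a - b := by linarith [h.1, h.2]
      rw [abs_of_pos h0, ← rpow_sub_one_mul_self hp h0.le]
      have h1 : e ^ q ≤ 1 := pow_le_one₀ he he1
      have h2 : 0 < a := h.1
      calc (a - b) ^ (p - 1) * a * e ^ q ≤ (a - b) ^ (p - 1) * (a - b) * 1 := by
            gcongr; linarith [h.2]
        _ = _ := by ring
    · positivity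
  set m := max (max a 0) (max b 0)
  have hm : 0 ≤ m := le_max_of_le_left (le_max_right _ _)
  have hb0 : 0 ≤ min (max b 0) M := le_min (le_max_right _ _) hM
  have hbm : min (max b 0) M ≤ m := (min_le_left _ _).trans (le_max_right _ _)
  have h1 : |min (max a 0) M * e ^ q - min (max b 0) M * f ^ q| ≤ |a - b| + q * m * |e - f| := by
    refine (truncated_diff_le hM he he1 hf hf1).trans ?_
    have : min (max b 0) M * (q * |e - f|) ≤ m * (q * |e - f|) := by gcongr
    linarith
  have h2 : |(|a - b| ^ (p - 2) * (a - b) *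
      (min (max a 0) M * e ^ q - min (max b 0) M * f ^ q))| ≤ 2 * |a - b| ^ p + bad p a b e f q := by
    rw [abs_mul, abs_abs_rpow_mul hp]
    calc _ ≤ |a - b| ^ (p - 1) * (|a - b| + q * m * |e - f|) := by gcongr
      _ = |a - b| ^ (p - 1) * |a - b| + |a - b| ^ (p - 1) * (q * m * |e - f|) := by ring
      _ ≤ |a - b| ^ p + (|a - b| ^ p + (q * m * |e - f|) ^ p) := by
          rw [rpow_sub_one_mul_self hp (abs_nonneg _)]
          gcongr
          exact rpow_sub_one_mul_le hp (abs_nonneg _) (by positivity)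
      _ = _ := by unfold bad; ring
  have h3 := neg_le_of_abs_le h2
  linarith

/-- When the second point lies outside the support of η, the flux is negative only for b > a > 0,
and then (b-a)^{p-1} ≤ b^{p-1}. This is where the nonlocal tail comes from. -/
lemma truncated_tail_nonneg {p a b e M : ℝ} {q : ℕ} (hp : 1 < p) (hM : 0 ≤ M) (he : 0 ≤ e) :
    0 ≤ |a - b| ^ (p - 2) * (a - b) * (min (max a 0) M * e ^ q) +
      max a 0 * e ^ q * max b 0 ^ (p - 1) := by
  have ha0 : 0 ≤ min (max a 0) M := le_min (le_max_right _ _) hM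
  have ht : 0 ≤ max a 0 * e ^ q * max b 0 ^ (p - 1) := by
    have : 0 ≤ max a 0 := le_max_right _ _
    have : 0 ≤ max b 0 := le_max_right _ _
    positivity
  rcases le_or_gt b a with h | h
  · have : 0 ≤ a - b := by linarith
    have : 0 ≤ |a - b| ^ (p - 2) * (a - b) * (min (max a 0) M * e ^ q) := by positivity
    linarith
  rcases le_or_gt a 0 with ha | ha
  · rw [max_eq_right ha, min_eq_left hM]; simp
  · have h1 : |a - b| ^ (p - 2) * (a - b) = -(b - a) ^ (p - 1) := by
      rw [← abs_rpow_mul_of_pos (by linarith : 0 < b - a), abs_sub_comm]; ring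
    rw [h1, max_eq_left ha.le, max_eq_left (ha.le.trans h.le)]
    have h2 : (b - a) ^ (p - 1) ≤ b ^ (p - 1) := by
      apply Real.rpow_le_rpow <;> linarith
    have h3 : min a M * e ^ q ≤ a * e ^ q := by gcongr; exact min_le_left _ _
    have h4 : 0 ≤ min a M * e ^ q := by rw [max_eq_left ha.le] at ha0; positivity
    have : (b - a) ^ (p - 1) * (min a M * e ^ q) ≤ b ^ (p - 1) * (a * e ^ q) := by
      have : 0 < b := ha.trans h
      exact mul_le_mul h2 h3 h4 (by positivity)
    linarith

end Pointwise

/-- The structural hypotheses on the exponents and on the kernel. -/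
structure Admissible {n : ℕ} (sm sM pm pM Λ : ℝ) (s p K : Rn n → Rn n → ℝ) : Prop where
  sm_pos : 0 < sm
  sM_lt : sM < 1
  pm_gt : 1 < pm
  Λ_gt : 1 < Λ
  s_ge : ∀ x y, sm ≤ s x y
  s_le : ∀ x y, s x y ≤ sM
  p_ge : ∀ x y, pm ≤ p x y
  p_le : ∀ x y, p x y ≤ pM
  aem_s : AEMeasurable (Function.uncurry s) volume
  aem_p : AEMeasurable (Function.uncurry p) volume
  aem_K : AEMeasurable (Function.uncurry K) volume
  symm_s : IsSymm s
  symm_p : IsSymm p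
  symm_K : IsSymm K
  kernel : KernelBound s p K Λ

/-! ### Consequences of the structural hypotheses; admissible test functions -/

section Basic

variable {n : ℕ} {s p K : Rn n → Rn n → ℝ} {sm sM pm pM Λ : ℝ}

lemma sing_nonneg (x y : Rn n) : 0 ≤ sing s p x y := by unfold sing; positivity

lemma sing_pos {x y : Rn n} (h : x ≠ y) : 0 < sing s p x y := by
  unfold sing
  have : 0 < ‖x - y‖ := norm_pos_iff.2 (sub_ne_zero.2 h)
  positivity

namespace Admissible

lemma p_gt (A : Admissible sm sM pm pM Λ s p K) (x y : Rn n) :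
    1 < p x y := A.pm_gt.trans_le (A.p_ge x y)

lemma pm_le_pM (A : Admissible sm sM pm pM Λ s p K) : pm ≤ pM := (A.p_ge 0 0).trans (A.p_le 0 0)

lemma pM_gt (A : Admissible sm sM pm pM Λ s p K) : 1 < pM := A.pm_gt.trans_le A.pm_le_pM

lemma sigma_pos (A : Admissible sm sM pm pM Λ s p K) :
    0 < sm * pm := mul_pos A.sm_pos (by linarith [A.pm_gt])

lemma sigma_le (A : Admissible sm sM pm pM Λ s p K) (x y : Rn n) : sm * pm ≤ s x y * p x y :=
  mul_le_mul (A.s_ge x y) (A.p_ge x y) (by linarith [A.pm_gt]) (A.sm_pos.le.trans (A.s_ge x y))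

lemma sp_pos (A : Admissible sm sM pm pM Λ s p K) (x y : Rn n) :
    0 < s x y * p x y := A.sigma_pos.trans_le (A.sigma_le x y)

lemma sp_le (A : Admissible sm sM pm pM Λ s p K) (x y : Rn n) : s x y * p x y ≤ pM := by
  have h1 := A.s_le x y
  have h2 := A.p_gt x y
  have h3 := A.p_le x y
  have h4 := A.sM_lt
  have : s x y * p x y ≤ 1 * p x y := by gcongr; linarith
  linarith

lemma kappa_pos (A : Admissible sm sM pm pM Λ s p K) :
    0 < pm * (1 - sM) := mul_pos (by linarith [A.pm_gt]) (by linarith [A.sM_lt])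

lemma kappa_le (A : Admissible sm sM pm pM Λ s p K) (x y : Rn n) :
    pm * (1 - sM) ≤ p x y - s x y * p x y := by
  have h1 := A.s_le x y
  have h2 := A.p_ge x y
  have h3 := A.pm_gt
  have h4 := A.sM_lt
  calc pm * (1 - sM) ≤ p x y * (1 - s x y) := by
        apply mul_le_mul h2 (by linarith) (by linarith) (by linarith)
    _ = _ := by ring

lemma sing_symm (A : Admissible sm sM pm pM Λ s p K) (x y : Rn n) :
    sing s p x y = sing s p y x := by
  unfold sing; rw [norm_sub_rev, A.symm_s x y, A.symm_p x y]

lemma aem_sing (A : Admissible sm sM pm pM Λ s p K) :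
    AEMeasurable (fun z : Rn n × Rn n => sing s p z.1 z.2) volume := by
  have h1 : Measurable fun z : Rn n × Rn n => ‖z.1 - z.2‖ := by fun_prop
  exact h1.aemeasurable.pow ((A.aem_s.mul A.aem_p).const_add _)

lemma kernel_abs (A : Admissible sm sM pm pM Λ s p K) : ∀ᵐ z : Rn n × Rn n, 0 ≤ K z.1 z.2 ∧
    Λ⁻¹ / sing s p z.1 z.2 ≤ K z.1 z.2 ∧ K z.1 z.2 ≤ Λ / sing s p z.1 z.2 := by
  filter_upwards [A.kernel] with z hz
  refine ⟨le_trans ?_ hz.1, hz⟩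
  have := A.Λ_gt
  have := @sing_nonneg n s p z.1 z.2
  positivity

end Admissible

lemma mem_crossSet {Ω : Set (Rn n)} {z : Rn n × Rn n} :
    z ∈ crossSet Ω ↔ z.1 ∈ Ω ∨ z.2 ∈ Ω := by
  unfold crossSet; simp [Set.mem_prod]; tauto

/-- A model kernel that dominates `min (M, L|x-y|)^p / |x-y|^{n+sp}` up to constants. -/
noncomputable def modelKernel (n : ℕ) (κ σ : ℝ) (x y : Rn n) : ℝ :=
  if ‖x - y‖ < 1 then ‖x - y‖ ^ (κ - n) else ‖x - y‖ ^ (-(n + σ))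

lemma measurable_modelKernel (κ σ : ℝ) :
    Measurable fun z : Rn n × Rn n => modelKernel n κ σ z.1 z.2 := by
  unfold modelKernel
  refine Measurable.ite (measurableSet_lt (by fun_prop) measurable_const) ?_ ?_
  · exact Measurable.pow (by fun_prop) measurable_const
  · exact Measurable.pow (by fun_prop) measurable_const

lemma modelKernel_comm (κ σ : ℝ) (x y : Rn n) : modelKernel n κ σ x y = modelKernel n κ σ y x := by
  unfold modelKernel; rw [norm_sub_rev]

lemma lintegral_modelKernel (hn : 0 < n) {κ σ : ℝ} (hκ : 0 < κ) (hσ : 0 < σ) :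
    ∃ C : ℝ, 0 < C ∧ ∀ x : Rn n,
      ∫⁻ y, ENNReal.ofReal (modelKernel n κ σ x y) ≤ ENNReal.ofReal C := by
  obtain ⟨C₁, hC₁, h₁⟩ := lintegral_near (n := n) hn hκ
  obtain ⟨C₂, hC₂, h₂⟩ := lintegral_far (n := n) hn hσ
  refine ⟨C₁ + C₂, by positivity, fun x => ?_⟩
  have hf : Measurable fun y : Rn n => ‖x - y‖ := by fun_prop
  have hm : MeasurableSet {y : Rn n | 1 ≤ ‖x - y‖} := measurableSet_le measurable_const hf
  rw [← lintegral_add_compl _ hm, ENNReal.ofReal_add hC₁.le hC₂.le, add_comm (ENNReal.ofReal C₁)]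
  refine add_le_add ?_ ?_
  · have := h₂ x 1 one_pos
    rw [Real.one_rpow, mul_one] at this
    refine le_trans (setLIntegral_mono' hm fun y hy => ?_) this
    have hy' : 1 ≤ ‖x - y‖ := hy
    unfold modelKernel; rw [if_neg (not_lt.2 hy')]
  · have := h₁ x 1 one_pos
    rw [Real.one_rpow, mul_one] at this
    have hb : {y : Rn n | 1 ≤ ‖x - y‖}ᶜ = Metric.ball x 1 := by
      ext y; simp [dist_comm, dist_eq_norm]
    rw [hb]
    refine le_trans (setLIntegral_mono' Metric.isOpen_ball.measurableSet fun y hy => ?_) this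
    rw [Metric.mem_ball, dist_comm, dist_eq_norm] at hy
    unfold modelKernel; rw [if_pos hy]

lemma lintegral_crossSet_modelKernel_lt_top (hn : 0 < n) {κ σ : ℝ} (hκ : 0 < κ) (hσ : 0 < σ)
    {Ω : Set (Rn n)} (hb : Bornology.IsBounded Ω) :
    ∫⁻ z in crossSet Ω, ENNReal.ofReal (modelKernel n κ σ z.1 z.2) < ∞ := by
  obtain ⟨C, hC, h⟩ := lintegral_modelKernel (n := n) hn hκ hσ
  have hmeas := (measurable_modelKernel (n := n) κ σ).ennreal_ofReal
  have hsub : crossSet Ω ⊆ Ω ×ˢ Set.univ ∪ Set.univ ×ˢ Ω := by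
    intro z hz; rw [mem_crossSet] at hz; simpa using hz
  have hvol : volume Ω < ∞ := hb.measure_lt_top
  have h1 : ∫⁻ z in Ω ×ˢ (Set.univ : Set (Rn n)), ENNReal.ofReal (modelKernel n κ σ z.1 z.2) < ∞ := by
    rw [Measure.volume_eq_prod, ← Measure.prod_restrict, lintegral_prod _ hmeas.aemeasurable,
      Measure.restrict_univ]
    calc _ ≤ ∫⁻ x in Ω, ENNReal.ofReal C := lintegral_mono fun x => h x
      _ = ENNReal.ofReal C * volume Ω := by simp
      _ < ∞ := ENNReal.mul_lt_top ENNReal.ofReal_lt_top hvol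
  have h2 : ∫⁻ z in (Set.univ : Set (Rn n)) ×ˢ Ω, ENNReal.ofReal (modelKernel n κ σ z.1 z.2) < ∞ := by
    rw [Measure.volume_eq_prod, ← Measure.prod_restrict, lintegral_prod_symm _ hmeas.aemeasurable,
      Measure.restrict_univ]
    calc _ ≤ ∫⁻ x in Ω, ENNReal.ofReal C := lintegral_mono fun x => by
          refine le_trans (le_of_eq ?_) (h x)
          refine lintegral_congr fun y => ?_
          simp only [modelKernel_comm κ σ y x]
      _ = ENNReal.ofReal C * volume Ω := by simp
      _ < ∞ := ENNReal.mul_lt_top ENNReal.ofReal_lt_top hvol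
  calc _ ≤ _ := lintegral_mono_set hsub
    _ ≤ _ := lintegral_union_le _ _ _
    _ < ∞ := ENNReal.add_lt_top.2 ⟨h1, h2⟩

lemma rpow_add_le_mul {a b p P : ℝ} (ha : 0 ≤ a) (hb : 0 ≤ b) (hp : 0 ≤ p) (hpP : p ≤ P) :
    (a + b) ^ p ≤ 2 ^ P * (a ^ p + b ^ p) := by
  have h1 : (a + b) ^ p ≤ (2 * max a b) ^ p := by
    apply Real.rpow_le_rpow (by positivity) _ hp
    linarith [le_max_left a b, le_max_right a b]
  have h2 : (max a b) ^ p ≤ a ^ p + b ^ p := by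
    have := Real.rpow_nonneg ha p
    have := Real.rpow_nonneg hb p
    rcases max_cases a b with h | h <;> rw [h.1] <;> linarith
  have h3 : (2 : ℝ) ^ p ≤ 2 ^ P := Real.rpow_le_rpow_of_exponent_le (by norm_num) hpP
  have h4 : 0 ≤ max a b := le_max_of_le_left ha
  rw [Real.mul_rpow (by norm_num) h4] at h1
  refine h1.trans ?_
  gcongr

/-- Near the diagonal the Lipschitz bound is used, and p - sp ≥ pm(1-sM) leaves an integrable
singularity. Far from it the bound M is used, and sp ≥ sm·pm gives integrable decay. The base 1+M+L
is at least 1, so its exponent may be raised to pM. -/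
lemma Admissible.model_bound (A : Admissible sm sM pm pM Λ s p K) {M L : ℝ} (hM : 0 ≤ M)
    (hL : 0 ≤ L) (x y : Rn n) :
    (min M (L * ‖x - y‖)) ^ p x y / sing s p x y ≤
      (1 + M + L) ^ pM * modelKernel n (pm * (1 - sM)) (sm * pm) x y := by
  -- On the diagonal `sing` is 0 and the quotient is 0 by the convention for division by zero.
  rcases eq_or_ne x y with rfl | hxy
  · have : 0 ≤ (1 + M + L) ^ pM * modelKernel n (pm * (1 - sM)) (sm * pm) x x := by
      have : 0 ≤ modelKernel n (pm * (1 - sM)) (sm * pm) x x := by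
        unfold modelKernel; split_ifs <;> positivity
      positivity
    have hp := A.p_gt x x
    have hs : sing s p x x = 0 := by
      unfold sing
      rw [sub_self, norm_zero, Real.zero_rpow]
      have := A.sp_pos x x; positivity
    rw [hs, div_zero]; exact this
  have ht : 0 < ‖x - y‖ := norm_pos_iff.2 (sub_ne_zero.2 hxy)
  set t := ‖x - y‖ with ht'
  have hp0 : 0 < p x y := by linarith [A.p_gt x y]
  have hbig : ∀ c : ℝ, 0 ≤ c → c ≤ 1 + M + L → c ^ p x y ≤ (1 + M + L) ^ pM := fun c hc hc2 =>
    (Real.rpow_le_rpow hc hc2 hp0.le).trans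
      (Real.rpow_le_rpow_of_exponent_le (by linarith) (A.p_le x y))
  unfold modelKernel sing
  rw [div_eq_mul_inv, ← Real.rpow_neg ht.le, ← ht']
  split_ifs with h
  · calc (min M (L * t)) ^ p x y * t ^ (-((n : ℝ) + s x y * p x y))
        ≤ (L * t) ^ p x y * t ^ (-((n : ℝ) + s x y * p x y)) := by
          gcongr; exact min_le_right _ _
      _ = L ^ p x y * t ^ (p x y - s x y * p x y - n) := by
          rw [Real.mul_rpow hL ht.le, mul_assoc, ← Real.rpow_add ht]; congr 2; ring
      _ ≤ (1 + M + L) ^ pM * t ^ (pm * (1 - sM) - n) := by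
          apply mul_le_mul (hbig L hL (by linarith)) _ (by positivity) (by positivity)
          apply Real.rpow_le_rpow_of_exponent_ge ht h.le
          linarith [A.kappa_le x y]
  · calc (min M (L * t)) ^ p x y * t ^ (-((n : ℝ) + s x y * p x y))
        ≤ M ^ p x y * t ^ (-((n : ℝ) + s x y * p x y)) := by
          gcongr; exact min_le_left _ _
      _ ≤ (1 + M + L) ^ pM * t ^ (-((n : ℝ) + sm * pm)) := by
          apply mul_le_mul (hbig M hM (by linarith)) _ (by positivity) (by positivity)
          apply Real.rpow_le_rpow_of_exponent_le (not_lt.1 h)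
          linarith [A.sigma_le x y]

lemma Admissible.aem_modular (A : Admissible sm sM pm pM Λ s p K) {v : Rn n → ℝ}
    (hv : AEMeasurable v volume) :
    AEMeasurable (fun z : Rn n × Rn n => |v z.1 - v z.2| ^ p z.1 z.2 / sing s p z.1 z.2) volume := by
  have h1 : AEMeasurable (fun z : Rn n × Rn n => v z.1) volume := by
    rw [Measure.volume_eq_prod]; exact hv.comp_fst
  have h2 : AEMeasurable (fun z : Rn n × Rn n => v z.2) volume := by
    rw [Measure.volume_eq_prod]; exact hv.comp_snd
  exact ((continuous_abs.measurable.comp_aemeasurable (h1.sub h2)).pow A.aem_p).div A.aem_sing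

/-- Bounded functions whose increments are controlled by those of `u ∈ 𝕎` and a Lipschitz
modulus belong to `𝕎`. -/
lemma Admissible.memW_of_le (A : Admissible sm sM pm pM Λ s p K) (hn : 0 < n)
    {Ω : Set (Rn n)} (hb : Bornology.IsBounded Ω) {u φ : Rn n → ℝ}
    (hu : MemW s p Ω u) (hφ : AEMeasurable φ volume) {M L : ℝ} (hM : 0 ≤ M) (hL : 0 ≤ L)
    (hφM : ∀ x, |φ x| ≤ M)
    (hφu : ∀ x y, |φ x - φ y| ≤ |u x - u y| + min M (L * ‖x - y‖)) : MemW s p Ω φ := by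
  refine ⟨hφ, ?_, ?_⟩
  · have : IsFiniteMeasure (volume.restrict Ω) := ⟨by simpa using hb.measure_lt_top⟩
    exact MemLp.of_bound hφ.restrict.aestronglyMeasurable M
      (Filter.Eventually.of_forall fun x => by simpa using hφM x)
  · have hmod := (A.aem_modular hu.1).ennreal_ofReal
    have hmodel := (measurable_modelKernel (n := n) (pm * (1 - sM)) (sm * pm)).ennreal_ofReal
    have hpt : ∀ z : Rn n × Rn n,
        ENNReal.ofReal (|φ z.1 - φ z.2| ^ p z.1 z.2 / sing s p z.1 z.2) ≤
        ENNReal.ofReal (2 ^ pM) *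
          ENNReal.ofReal (|u z.1 - u z.2| ^ p z.1 z.2 / sing s p z.1 z.2) +
        ENNReal.ofReal (2 ^ pM * (1 + M + L) ^ pM) *
          ENNReal.ofReal (modelKernel n (pm * (1 - sM)) (sm * pm) z.1 z.2) := by
      intro z
      have hs := @sing_nonneg n s p z.1 z.2
      have hp := A.p_gt z.1 z.2
      have hk : 0 ≤ modelKernel n (pm * (1 - sM)) (sm * pm) z.1 z.2 := by
        unfold modelKernel; split_ifs <;> positivity
      rw [← ENNReal.ofReal_mul (by positivity), ← ENNReal.ofReal_mul (by positivity),
        ← ENNReal.ofReal_add (by positivity) (by positivity)]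
      apply ENNReal.ofReal_le_ofReal
      have hm : 0 ≤ min M (L * ‖z.1 - z.2‖) := le_min hM (by positivity)
      have h1 : |φ z.1 - φ z.2| ^ p z.1 z.2 ≤ 2 ^ pM * (|u z.1 - u z.2| ^ p z.1 z.2 +
          (min M (L * ‖z.1 - z.2‖)) ^ p z.1 z.2) :=
        (Real.rpow_le_rpow (abs_nonneg _) (hφu _ _) (by linarith)).trans
          (rpow_add_le_mul (abs_nonneg _) hm (by linarith) (A.p_le _ _))
      calc _ ≤ 2 ^ pM * (|u z.1 - u z.2| ^ p z.1 z.2 +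
          (min M (L * ‖z.1 - z.2‖)) ^ p z.1 z.2) / sing s p z.1 z.2 := by gcongr
        _ = 2 ^ pM * (|u z.1 - u z.2| ^ p z.1 z.2 / sing s p z.1 z.2) +
          2 ^ pM * ((min M (L * ‖z.1 - z.2‖)) ^ p z.1 z.2 / sing s p z.1 z.2) := by ring
        _ ≤ _ := by
          rw [mul_assoc ((2 : ℝ) ^ pM)]
          gcongr
          exact A.model_bound hM hL _ _
    calc _ ≤ _ := lintegral_mono hpt
      _ = _ := lintegral_add_left' (hmod.restrict.const_mul _) _
      _ < ∞ := by
        rw [lintegral_const_mul'' _ hmod.restrict, lintegral_const_mul _ hmodel]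
        exact ENNReal.add_lt_top.2 ⟨ENNReal.mul_lt_top ENNReal.ofReal_lt_top hu.2.2,
          ENNReal.mul_lt_top ENNReal.ofReal_lt_top
            (lintegral_crossSet_modelKernel_lt_top hn A.kappa_pos A.sigma_pos hb)⟩

lemma Admissible.integrable_weak (A : Admissible sm sM pm pM Λ s p K)
    {Ω : Set (Rn n)} {u φ : Rn n → ℝ} (hu : MemW s p Ω u) (hφ : MemW s p Ω φ) :
    IntegrableOn (fun z : Rn n × Rn n => |u z.1 - u z.2| ^ (p z.1 z.2 - 2) * (u z.1 - u z.2) *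
      (φ z.1 - φ z.2) * K z.1 z.2) (crossSet Ω) := by
  have hu1 : AEMeasurable (fun z : Rn n × Rn n => u z.1) volume := by
    rw [Measure.volume_eq_prod]; exact hu.1.comp_fst
  have hu2 : AEMeasurable (fun z : Rn n × Rn n => u z.2) volume := by
    rw [Measure.volume_eq_prod]; exact hu.1.comp_snd
  have hφ1 : AEMeasurable (fun z : Rn n × Rn n => φ z.1) volume := by
    rw [Measure.volume_eq_prod]; exact hφ.1.comp_fst
  have hφ2 : AEMeasurable (fun z : Rn n × Rn n => φ z.2) volume := by
    rw [Measure.volume_eq_prod]; exact hφ.1.comp_snd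
  have hdom : IntegrableOn (fun z : Rn n × Rn n =>
      Λ * (|u z.1 - u z.2| ^ p z.1 z.2 / sing s p z.1 z.2) +
      Λ * (|φ z.1 - φ z.2| ^ p z.1 z.2 / sing s p z.1 z.2)) (crossSet Ω) := by
    have key : ∀ v, MemW s p Ω v → IntegrableOn (fun z : Rn n × Rn n =>
        |v z.1 - v z.2| ^ p z.1 z.2 / sing s p z.1 z.2) (crossSet Ω) := by
      intro v hv
      refine ⟨(A.aem_modular hv.1).restrict.aestronglyMeasurable, ?_⟩
      rw [hasFiniteIntegral_iff_ofReal]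
      · exact hv.2.2
      · refine Filter.Eventually.of_forall fun z => ?_
        have := @sing_nonneg n s p z.1 z.2
        simp only [Pi.zero_apply]; positivity
    exact ((key u hu).const_mul Λ).add ((key φ hφ).const_mul Λ)
  refine Integrable.mono' hdom ?_ ?_
  · refine AEMeasurable.aestronglyMeasurable (AEMeasurable.restrict ?_)
    refine AEMeasurable.mul (AEMeasurable.mul (AEMeasurable.mul ?_ (hu1.sub hu2)) (hφ1.sub hφ2)) A.aem_K
    exact (continuous_abs.measurable.comp_aemeasurable (hu1.sub hu2)).pow (A.aem_p.sub_const 2)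
  · filter_upwards [ae_restrict_of_ae A.kernel_abs] with z hz
    have hp := A.p_gt z.1 z.2
    have hΛ := A.Λ_gt
    have hs := @sing_nonneg n s p z.1 z.2
    rw [Real.norm_eq_abs, abs_mul, abs_mul, abs_abs_rpow_mul hp, abs_of_nonneg hz.1]
    calc _ ≤ (|u z.1 - u z.2| ^ p z.1 z.2 + |φ z.1 - φ z.2| ^ p z.1 z.2) * (Λ / sing s p z.1 z.2) := by
          gcongr
          · exact hz.1
          · exact rpow_sub_one_mul_le hp (abs_nonneg _) (abs_nonneg _)
          · exact hz.2.2
      _ = _ := by ring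

/-- If `g ≤ F + b` and `F` has integral zero then `∫ g ≤ ∫ b`. -/
lemma lintegral_le_of_integral_eq_zero {α : Type*} [MeasurableSpace α] {μ : Measure α} {F : α → ℝ}
    (hF : Integrable F μ) (h0 : ∫ z, F z ∂μ = 0) {g b : α → ℝ≥0∞}
    (h : ∀ᵐ z ∂μ, g z + ENNReal.ofReal (-F z) ≤ ENNReal.ofReal (F z) + b z) :
    ∫⁻ z, g z ∂μ ≤ ∫⁻ z, b z ∂μ := by
  have hm1 : AEMeasurable (fun z => ENNReal.ofReal (F z)) μ := hF.1.aemeasurable.ennreal_ofReal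
  have hm2 : AEMeasurable (fun z => ENNReal.ofReal (-F z)) μ :=
    hF.1.aemeasurable.neg.ennreal_ofReal
  have h1 := lintegral_mono_ae h
  rw [lintegral_add_right' _ hm2, lintegral_add_left' hm1] at h1
  have hfin1 : ∫⁻ z, ENNReal.ofReal (F z) ∂μ ≠ ∞ := hF.lintegral_lt_top.ne
  have hfin2 : ∫⁻ z, ENNReal.ofReal (-F z) ∂μ ≠ ∞ := hF.neg.lintegral_lt_top.ne
  have heq : ∫⁻ z, ENNReal.ofReal (F z) ∂μ = ∫⁻ z, ENNReal.ofReal (-F z) ∂μ := by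
    have := integral_eq_lintegral_pos_part_sub_lintegral_neg_part hF
    rw [h0] at this
    rw [← ENNReal.toReal_eq_toReal_iff' hfin1 hfin2]; linarith
  rw [heq, add_comm] at h1
  exact (ENNReal.add_le_add_iff_left hfin2).1 h1

/-- G ≤ F + β is rearranged so that F⁻ stands on the left and F⁺ on the right. All terms are then
nonnegative and can be integrated in [0,∞]; the integrals of F⁺ and F⁻ cancel because F has integral
zero. -/
lemma ofReal_add_ofReal_neg_le {G F β : ℝ} (hG : 0 ≤ G) (hβ : 0 ≤ β) (h : G ≤ F + β) :
    ENNReal.ofReal G + ENNReal.ofReal (-F) ≤ ENNReal.ofReal F + ENNReal.ofReal β := by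
  rcases le_total 0 F with hF | hF
  · rw [ENNReal.ofReal_of_nonpos (by linarith : -F ≤ 0), add_zero, ← ENNReal.ofReal_add hF hβ]
    exact ENNReal.ofReal_le_ofReal h
  · rw [ENNReal.ofReal_of_nonpos hF, zero_add, ← ENNReal.ofReal_add hG (by linarith)]
    exact ENNReal.ofReal_le_ofReal (by linarith)

end Basic

/-! ### The energy inequality -/

section Energy

variable {n : ℕ} {s p K : Rn n → Rn n → ℝ} {sm sM pm pM Λ : ℝ}

lemma kernel_sandwich {G Q β k t Λ : ℝ} (hG : 0 ≤ G) (hβ : 0 ≤ β) (h : G ≤ Q + β)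
    (hk : 0 ≤ k) (h1 : Λ⁻¹ / t ≤ k) (h2 : k ≤ Λ / t) :
    Λ⁻¹ * (G / t) ≤ Q * k + Λ * (β / t) :=
  calc Λ⁻¹ * (G / t) = G * (Λ⁻¹ / t) := by ring
    _ ≤ G * k := by gcongr
    _ ≤ (Q + β) * k := by gcongr
    _ = Q * k + β * k := by ring
    _ ≤ Q * k + β * (Λ / t) := by gcongr
    _ = _ := by ring

/-- The tail integrand of the energy inequality. -/
noncomputable def tailTerm (p a b e : ℝ) (q : ℕ) : ℝ := max a 0 * e ^ q * max b 0 ^ (p - 1)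

lemma tailTerm_nonneg {p a b e : ℝ} {q : ℕ} (he : 0 ≤ e) : 0 ≤ tailTerm p a b e q := by
  unfold tailTerm
  have : 0 ≤ max a 0 := le_max_right _ _
  have : 0 ≤ max b 0 := le_max_right _ _
  positivity

/-- Energy inequality for truncated test functions `min((k-u)₊, M) η^q`. -/
lemma Admissible.energy_truncated (A : Admissible sm sM pm pM Λ s p K) (hn : 0 < n)
    {Ω : Set (Rn n)} (hΩ : MeasurableSet Ω) (hb : Bornology.IsBounded Ω)
    {u : Rn n → ℝ} (hum : Measurable u) (hu : IsWeakSolution s p K Ω u)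
    {B : Set (Rn n)} (hB : MeasurableSet B) (hBΩ : B ⊆ Ω)
    {η : Rn n → ℝ} (hηm : Measurable η) (hη : ∀ x, 0 ≤ η x) (hη1 : ∀ x, η x ≤ 1)
    {L : ℝ} (hL : 0 ≤ L) (hηL : ∀ x y, |η x - η y| ≤ L * ‖x - y‖) (hηB : ∀ x, x ∉ B → η x = 0)
    {q : ℕ} (hq : pM ≤ q) (k : ℝ) {M : ℝ} (hM : 0 ≤ M) :
    ENNReal.ofReal Λ⁻¹ * ∫⁻ z in B ×ˢ B, ENNReal.ofReal
        (good (p z.1 z.2) (k - u z.1) (k - u z.2) (η z.1) q / sing s p z.1 z.2) ≤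
      ENNReal.ofReal Λ * (∫⁻ z in B ×ˢ B, ENNReal.ofReal
          (bad (p z.1 z.2) (k - u z.1) (k - u z.2) (η z.1) (η z.2) q / sing s p z.1 z.2)) +
      2 * (ENNReal.ofReal Λ * ∫⁻ z in B ×ˢ Bᶜ, ENNReal.ofReal
          (tailTerm (p z.1 z.2) (k - u z.1) (k - u z.2) (η z.1) q / sing s p z.1 z.2)) +
      ENNReal.ofReal Λ * ∫⁻ z in (B ×ˢ B) ∩ {z | M < max (k - u z.1) (k - u z.2)}, ENNReal.ofReal
          ((3 * |u z.1 - u z.2| ^ p z.1 z.2 +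
            bad (p z.1 z.2) (k - u z.1) (k - u z.2) (η z.1) (η z.2) q) / sing s p z.1 z.2) := by
  have hΛ := A.Λ_gt
  have hq0 : (q : ℝ) ≠ 0 := by linarith [A.pM_gt]
  have hq0' : q ≠ 0 := by exact_mod_cast hq0
  -- Truncating at M makes φ bounded, with increments controlled by those of u and of η. So φ lies
  -- in 𝕎 without any prior bound on u.
  set φ : Rn n → ℝ := fun x => min (max (k - u x) 0) M * η x ^ q with hφ
  have hφm : Measurable φ := by
    exact (((measurable_const.sub hum).max measurable_const).min measurable_const).mul (hηm.pow_const q)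
  have hw0 : ∀ x, 0 ≤ min (max (k - u x) 0) M := fun x => le_min (le_max_right _ _) hM
  have hηq : ∀ x, η x ^ q ≤ 1 := fun x => pow_le_one₀ (hη x) (hη1 x)
  have hφ0 : ∀ x, x ∉ B → φ x = 0 := fun x hx => by simp [hφ, hηB x hx, hq0']
  have hφW : MemW s p Ω φ := by
    refine A.memW_of_le hn hb hu.1 hφm.aemeasurable hM (L := M * (q * L)) (by positivity) ?_ ?_
    · intro x
      have h1 : 0 ≤ η x ^ q := pow_nonneg (hη x) q
      rw [abs_of_nonneg (mul_nonneg (hw0 x) h1)]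
      calc φ x ≤ M * 1 := mul_le_mul (min_le_right _ _) (hηq x) h1 hM
        _ = M := mul_one M
    · intro x y
      have h1 := abs_min_max_sub_le (k - u x) (k - u y) M
      have h1' : |k - u x - (k - u y)| = |u x - u y| := by
        rw [abs_sub_comm]; congr 1; ring
      rw [h1'] at h1
      have h2 : |η x ^ q - η y ^ q| ≤ min 1 (q * L * ‖x - y‖) := by
        apply le_min
        · rw [abs_le]; constructor <;>
            linarith [hηq x, hηq y, pow_nonneg (hη x) q, pow_nonneg (hη y) q]
        · refine (abs_pow_sub_pow_le (hη x) (hη1 x) (hη y) (hη1 y) q).trans ?_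
          rw [mul_assoc]; gcongr; exact hηL x y
      have he0 : 0 ≤ η x ^ q := pow_nonneg (hη x) q
      have hmin : M * min 1 (q * L * ‖x - y‖) = min M (M * (q * L) * ‖x - y‖) := by
        rw [mul_min_of_nonneg _ _ hM, mul_one]; congr 1; ring
      calc |φ x - φ y| = |(min (max (k - u x) 0) M - min (max (k - u y) 0) M) * η x ^ q +
            min (max (k - u y) 0) M * (η x ^ q - η y ^ q)| := by
              simp only [hφ]; congr 1; ring
        _ ≤ |(min (max (k - u x) 0) M - min (max (k - u y) 0) M) * η x ^ q| +
            |min (max (k - u y) 0) M * (η x ^ q - η y ^ q)| := abs_add_le _ _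
        _ = |min (max (k - u x) 0) M - min (max (k - u y) 0) M| * η x ^ q +
            min (max (k - u y) 0) M * |η x ^ q - η y ^ q| := by
              rw [abs_mul, abs_mul, abs_of_nonneg he0, abs_of_nonneg (hw0 y)]
        _ ≤ |u x - u y| * 1 + M * min 1 (q * L * ‖x - y‖) := by
              gcongr
              · exact hηq x
              · exact min_le_right _ _
        _ = _ := by rw [hmin, mul_one]
  have hsol := hu.2 φ hφW (by
    refine ae_restrict_of_forall_mem hΩ.compl fun x hx => hφ0 x fun h => hx (hBΩ h))
  have hF_int := (A.integrable_weak hu.1 hφW).neg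
  -- The sign turns the differences of u into differences of k - u, the variable a of the pointwise
  -- inequalities.
  set F : Rn n × Rn n → ℝ := fun z => -(|u z.1 - u z.2| ^ (p z.1 z.2 - 2) * (u z.1 - u z.2) *
      (φ z.1 - φ z.2) * K z.1 z.2) with hF
  have hF0 : ∫ z in crossSet Ω, F z = 0 := by
    simp only [hF]; rw [integral_neg, hsol, neg_zero]
  set S : Set (Rn n × Rn n) := {z | M < max (k - u z.1) (k - u z.2)} with hS
  have hSm : MeasurableSet S := by
    refine measurableSet_lt measurable_const (Measurable.max ?_ ?_)
    · exact measurable_const.sub (hum.comp measurable_fst)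
    · exact measurable_const.sub (hum.comp measurable_snd)
  set g : Rn n × Rn n → ℝ := fun z =>
    good (p z.1 z.2) (k - u z.1) (k - u z.2) (η z.1) q / sing s p z.1 z.2 with hg
  set bd : Rn n × Rn n → ℝ := fun z =>
    bad (p z.1 z.2) (k - u z.1) (k - u z.2) (η z.1) (η z.2) q / sing s p z.1 z.2 with hbd
  set tl : Rn n × Rn n → ℝ := fun z =>
    tailTerm (p z.1 z.2) (k - u z.1) (k - u z.2) (η z.1) q / sing s p z.1 z.2 with htl
  set E : Rn n × Rn n → ℝ := fun z => (3 * |u z.1 - u z.2| ^ p z.1 z.2 +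
    bad (p z.1 z.2) (k - u z.1) (k - u z.2) (η z.1) (η z.2) q) / sing s p z.1 z.2 with hE
  have hu1 : Measurable fun z : Rn n × Rn n => u z.1 := hum.comp measurable_fst
  have hu2 : Measurable fun z : Rn n × Rn n => u z.2 := hum.comp measurable_snd
  have hη1m : Measurable fun z : Rn n × Rn n => η z.1 := hηm.comp measurable_fst
  have hη2m : Measurable fun z : Rn n × Rn n => η z.2 := hηm.comp measurable_snd
  have hbdm : AEMeasurable bd volume := by
    refine AEMeasurable.div (AEMeasurable.pow (Measurable.aemeasurable ?_) A.aem_p) A.aem_sing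
    fun_prop
  have htlm : AEMeasurable tl volume := by
    refine AEMeasurable.div (AEMeasurable.mul (Measurable.aemeasurable ?_)
      (AEMeasurable.pow (Measurable.aemeasurable ?_) (A.aem_p.sub_const 1))) A.aem_sing
    · fun_prop
    · fun_prop
  have hswap : MeasurePreserving (Prod.swap : Rn n × Rn n → Rn n × Rn n) volume volume := by
    rw [Measure.volume_eq_prod]; exact Measure.measurePreserving_swap
  have htlm' : AEMeasurable (fun z : Rn n × Rn n => tl z.swap) volume :=
    htlm.comp_quasiMeasurePreserving hswap.quasiMeasurePreserving
  have hBB : MeasurableSet (B ×ˢ B) := hB.prod hB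
  have hBBc : MeasurableSet (B ×ˢ Bᶜ) := hB.prod hB.compl
  have hBcB : MeasurableSet (Bᶜ ×ˢ B) := hB.compl.prod hB
  have hmain := lintegral_le_of_integral_eq_zero (μ := volume.restrict (crossSet Ω)) (F := F) hF_int hF0
    (g := (B ×ˢ B).indicator fun z => ENNReal.ofReal (Λ⁻¹ * g z))
    (b := fun z => (B ×ˢ B).indicator (fun z => ENNReal.ofReal (Λ * bd z)) z +
      ((B ×ˢ Bᶜ).indicator (fun z => ENNReal.ofReal (Λ * tl z)) z +
      ((Bᶜ ×ˢ B).indicator (fun z => ENNReal.ofReal (Λ * tl z.swap)) z +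
      ((B ×ˢ B) ∩ S).indicator (fun z => ENNReal.ofReal (Λ * E z)) z))) (by
    filter_upwards [ae_restrict_of_ae A.kernel_abs] with z hz
    obtain ⟨x, y⟩ := z
    simp only at hz
    obtain ⟨hK0, hK1, hK2⟩ := hz
    have hp1 := A.p_gt x y
    have hpq : p x y ≤ q := (A.p_le x y).trans hq
    have hs := @sing_nonneg n s p x y
    have hFe : F (x, y) = |(k - u x) - (k - u y)| ^ (p x y - 2) * ((k - u x) - (k - u y)) *
        (φ x - φ y) * K x y := by
      have e1 : |(k - u x) - (k - u y)| = |u x - u y| := by rw [abs_sub_comm]; congr 1; ring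
      simp only [hF]; rw [e1]; ring
    have hgood := @good_nonneg (p x y) (k - u x) (k - u y) (η x) q (hη x)
    have hbad := @bad_nonneg (p x y) (k - u x) (k - u y) (η x) (η y) q
    have e1 : |(k - u x) - (k - u y)| = |u x - u y| := by rw [abs_sub_comm]; congr 1; ring
    -- With both points in B, the sharp inequality is used, or the crude one where the truncation
    -- may act. With one point in B only the tail remains, and with none everything vanishes.
    by_cases hx : x ∈ B <;> by_cases hy : y ∈ B
    · by_cases hzS : (x, y) ∈ S
      · have h1 := good_le_truncated_large (p := p x y) (a := k - u x) (b := k - u y) (e := η x)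
          (f := η y) (q := q) hp1 hM (hη x) (hη1 x) (hη y) (hη1 y)
        have h2 := kernel_sandwich hgood (by positivity) h1 hK0 hK1 hK2
        have h3 := ofReal_add_ofReal_neg_le (by positivity) (by positivity) h2
        rw [hFe]
        simp only [Set.indicator, Set.mem_prod, Set.mem_inter_iff, hx, hy, hzS, Set.mem_compl_iff,
          not_true_eq_false, and_true, and_false, if_true, if_false, zero_add]
        refine h3.trans ?_
        rw [e1]
        exact add_le_add le_rfl le_add_self
      · have hzS' : max (k - u x) (k - u y) ≤ M := not_lt.1 hzS
        have h1 := good_le (p := p x y) (a := k - u x) (b := k - u y) (e := η x)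
          (f := η y) (q := q) hp1 hpq (hη x) (hη1 x) (hη y) (hη1 y)
        have h2 := kernel_sandwich hgood hbad h1 hK0 hK1 hK2
        have h3 := ofReal_add_ofReal_neg_le (by positivity) (by positivity) h2
        rw [hFe]
        have ex : φ x = max (k - u x) 0 * η x ^ q := by
          simp only [hφ]; rw [min_eq_left (max_le ((le_max_left _ _).trans hzS') hM)]
        have ey : φ y = max (k - u y) 0 * η y ^ q := by
          simp only [hφ]; rw [min_eq_left (max_le ((le_max_right _ _).trans hzS') hM)]
        simp only [Set.indicator, Set.mem_prod, Set.mem_inter_iff, hx, hy, hzS, Set.mem_compl_iff,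
          not_true_eq_false, and_true, and_false, if_true, if_false, add_zero, ex, ey]
        exact h3
    · have h1 := truncated_tail_nonneg (p := p x y) (a := k - u x) (b := k - u y) (e := η x)
          (q := q) hp1 hM (hη x)
      have ht := @tailTerm_nonneg (p x y) (k - u x) (k - u y) (η x) q (hη x)
      have h2 := kernel_sandwich le_rfl ht h1 hK0 hK1 hK2
      rw [zero_div, mul_zero] at h2
      have h3 := ofReal_add_ofReal_neg_le le_rfl (by positivity) h2
      rw [hFe, hφ0 y hy, sub_zero]
      simp only [Set.indicator, Set.mem_prod, Set.mem_inter_iff, hx, hy, Set.mem_compl_iff,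
          not_true_eq_false, not_false_eq_true, and_true, and_false, false_and, if_true,
          if_false, add_zero, zero_add]
      simpa using h3
    · have h1 := truncated_tail_nonneg (p := p x y) (a := k - u y) (b := k - u x) (e := η y)
          (q := q) hp1 hM (hη y)
      have ht := @tailTerm_nonneg (p x y) (k - u y) (k - u x) (η y) q (hη y)
      have h2 := kernel_sandwich le_rfl ht h1 hK0 hK1 hK2
      rw [zero_div, mul_zero] at h2
      have h3 := ofReal_add_ofReal_neg_le le_rfl (by positivity) h2
      have hFe' : F (x, y) = |(k - u y) - (k - u x)| ^ (p x y - 2) * ((k - u y) - (k - u x)) *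
          (min (max (k - u y) 0) M * η y ^ q) * K x y := by
        rw [hFe, hφ0 x hx, abs_sub_comm (k - u x)]; ring
      have htl' : tl (Prod.swap (x, y)) = tailTerm (p x y) (k - u y) (k - u x) (η y) q /
          sing s p x y := by
        simp only [htl, Prod.swap, A.symm_p y x, A.sing_symm y x]
      rw [hFe']
      simp only [Set.indicator, Set.mem_prod, Set.mem_inter_iff, hx, hy, Set.mem_compl_iff,
          not_true_eq_false, not_false_eq_true, and_true, false_and, if_true,
          if_false, add_zero, zero_add, htl']
      simpa using h3
    · rw [hFe, hφ0 x hx, hφ0 y hy]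
      simp [Set.indicator, hx, hy])
  have hsub : ∀ T : Set (Rn n × Rn n), (T ⊆ B ×ˢ Set.univ ∪ Set.univ ×ˢ B) → T ∩ crossSet Ω = T := by
    intro T hT
    refine Set.inter_eq_left.2 fun z hz => ?_
    rw [mem_crossSet]
    rcases hT hz with h | h
    · exact Or.inl (hBΩ h.1)
    · exact Or.inr (hBΩ h.2)
  have hBB' := hsub (B ×ˢ B) (fun z hz => Or.inl ⟨hz.1, trivial⟩)
  have hBBc' := hsub (B ×ˢ Bᶜ) (fun z hz => Or.inl ⟨hz.1, trivial⟩)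
  have hBcB' := hsub (Bᶜ ×ˢ B) (fun z hz => Or.inr ⟨trivial, hz.2⟩)
  have hBBS' := hsub (B ×ˢ B ∩ S) (fun z hz => Or.inl ⟨hz.1.1, trivial⟩)
  have hΛ0 : (0 : ℝ) ≤ Λ := by linarith
  rw [lintegral_add_left' (((hbdm.const_mul Λ).ennreal_ofReal.indicator hBB).restrict),
    lintegral_add_left' (((htlm.const_mul Λ).ennreal_ofReal.indicator hBBc).restrict),
    lintegral_add_left' (((htlm'.const_mul Λ).ennreal_ofReal.indicator hBcB).restrict),
    lintegral_indicator hBB, lintegral_indicator hBB, lintegral_indicator hBBc,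
    lintegral_indicator hBcB, lintegral_indicator (hBB.inter hSm),
    Measure.restrict_restrict hBB, Measure.restrict_restrict hBBc, Measure.restrict_restrict hBcB,
    Measure.restrict_restrict (hBB.inter hSm), hBB', hBBc', hBcB', hBBS'] at hmain
  simp only [ENNReal.ofReal_mul hΛ0, ENNReal.ofReal_mul (inv_nonneg.2 hΛ0)] at hmain
  rw [lintegral_const_mul' _ _ ENNReal.ofReal_ne_top, lintegral_const_mul' _ _ ENNReal.ofReal_ne_top,
    lintegral_const_mul' _ _ ENNReal.ofReal_ne_top, lintegral_const_mul' _ _ ENNReal.ofReal_ne_top,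
    lintegral_const_mul' _ _ ENNReal.ofReal_ne_top] at hmain
  -- The two tail integrals agree after exchanging the variables; hence the factor 2.
  have hsw : ∫⁻ z in Bᶜ ×ˢ B, ENNReal.ofReal (tl z.swap) = ∫⁻ z in B ×ˢ Bᶜ, ENNReal.ofReal (tl z) := by
    have := hswap.setLIntegral_comp_preimage_emb MeasurableEquiv.prodComm.measurableEmbedding
      (fun z => ENNReal.ofReal (tl z)) (B ×ˢ Bᶜ)
    rw [← this, Set.preimage_swap_prod]
  rw [hsw] at hmain
  refine hmain.trans (le_of_eq ?_)
  rw [two_mul]; ring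

/-- This is the limit M → ∞ of `Admissible.energy_truncated`. The cutoff error may be assumed
finite, and the modular of u over B × B is finite. So the density of the truncation error is
integrable, and it is integrated over sets decreasing to the empty set. -/
theorem Admissible.energy (A : Admissible sm sM pm pM Λ s p K) (hn : 0 < n)
    {Ω : Set (Rn n)} (hΩ : MeasurableSet Ω) (hb : Bornology.IsBounded Ω)
    {u : Rn n → ℝ} (hum : Measurable u) (hu : IsWeakSolution s p K Ω u)
    {B : Set (Rn n)} (hB : MeasurableSet B) (hBΩ : B ⊆ Ω)
    {η : Rn n → ℝ} (hηm : Measurable η) (hη : ∀ x, 0 ≤ η x) (hη1 : ∀ x, η x ≤ 1)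
    {L : ℝ} (hL : 0 ≤ L) (hηL : ∀ x y, |η x - η y| ≤ L * ‖x - y‖) (hηB : ∀ x, x ∉ B → η x = 0)
    {q : ℕ} (hq : pM ≤ q) (k : ℝ) :
    ∫⁻ z in B ×ˢ B, ENNReal.ofReal
        (good (p z.1 z.2) (k - u z.1) (k - u z.2) (η z.1) q / sing s p z.1 z.2) ≤
      ENNReal.ofReal (Λ * Λ) * ((∫⁻ z in B ×ˢ B, ENNReal.ofReal
          (bad (p z.1 z.2) (k - u z.1) (k - u z.2) (η z.1) (η z.2) q / sing s p z.1 z.2)) +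
      2 * ∫⁻ z in B ×ˢ Bᶜ, ENNReal.ofReal
          (tailTerm (p z.1 z.2) (k - u z.1) (k - u z.2) (η z.1) q / sing s p z.1 z.2)) := by
  have hΛ := A.Λ_gt
  have hΛ0 : (0 : ℝ) ≤ Λ := by linarith
  set S : ℕ → Set (Rn n × Rn n) := fun M => {z | (M : ℝ) < max (k - u z.1) (k - u z.2)} with hS
  set bd : Rn n × Rn n → ℝ := fun z =>
    bad (p z.1 z.2) (k - u z.1) (k - u z.2) (η z.1) (η z.2) q / sing s p z.1 z.2 with hbd
  set tl : Rn n × Rn n → ℝ := fun z =>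
    tailTerm (p z.1 z.2) (k - u z.1) (k - u z.2) (η z.1) q / sing s p z.1 z.2 with htl
  by_cases hfin : ∫⁻ z in B ×ˢ B, ENNReal.ofReal (bd z) = ∞
  · rw [hfin, top_add, ENNReal.mul_top]
    · exact le_top
    · rw [ne_eq, ENNReal.ofReal_eq_zero, not_le]; positivity
  have hBB : MeasurableSet (B ×ˢ B) := hB.prod hB
  have hE : ∫⁻ z in B ×ˢ B, ENNReal.ofReal ((3 * |u z.1 - u z.2| ^ p z.1 z.2 +
      bad (p z.1 z.2) (k - u z.1) (k - u z.2) (η z.1) (η z.2) q) / sing s p z.1 z.2) ≠ ∞ := by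
    have hmod := (A.aem_modular hum.aemeasurable).ennreal_ofReal.const_mul (ENNReal.ofReal 3)
    have hle : ∀ z : Rn n × Rn n, ENNReal.ofReal ((3 * |u z.1 - u z.2| ^ p z.1 z.2 +
      bad (p z.1 z.2) (k - u z.1) (k - u z.2) (η z.1) (η z.2) q) / sing s p z.1 z.2) =
      ENNReal.ofReal 3 * ENNReal.ofReal (|u z.1 - u z.2| ^ p z.1 z.2 / sing s p z.1 z.2) +
        ENNReal.ofReal (bd z) := by
      intro z
      have hs := @sing_nonneg n s p z.1 z.2
      have hbad := @bad_nonneg (p z.1 z.2) (k - u z.1) (k - u z.2) (η z.1) (η z.2) q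
      rw [← ENNReal.ofReal_mul (by norm_num), ← ENNReal.ofReal_add (by positivity) (by positivity)]
      congr 1; simp only [hbd]; ring
    rw [lintegral_congr hle, lintegral_add_left' hmod.restrict,
      lintegral_const_mul' _ _ ENNReal.ofReal_ne_top]
    refine ENNReal.add_ne_top.2 ⟨ENNReal.mul_ne_top ENNReal.ofReal_ne_top ?_, hfin⟩
    refine ((lintegral_mono_set ?_).trans_lt hu.1.2.2).ne
    intro z hz; rw [mem_crossSet]; exact Or.inl (hBΩ hz.1)
  have hSm : ∀ M, MeasurableSet (S M) := fun M => by
    refine measurableSet_lt measurable_const (Measurable.max ?_ ?_)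
    · exact measurable_const.sub (hum.comp measurable_fst)
    · exact measurable_const.sub (hum.comp measurable_snd)
  have hvolB : volume B < ∞ := (hb.subset hBΩ).measure_lt_top
  have hvol : volume (B ×ˢ B) ≠ ∞ := by
    rw [Measure.volume_eq_prod, Measure.prod_prod]
    exact ENNReal.mul_ne_top hvolB.ne hvolB.ne
  have hSt : Filter.Tendsto ((volume.restrict (B ×ˢ B)) ∘ S) Filter.atTop (nhds 0) := by
    have h1 := tendsto_measure_iInter_atTop (μ := volume.restrict (B ×ˢ B)) (s := S)
      (fun M => (hSm M).nullMeasurableSet)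
      (fun M N hMN z hz => lt_of_le_of_lt (show (M : ℝ) ≤ N by exact_mod_cast hMN)
        (show (N : ℝ) < max (k - u z.1) (k - u z.2) from hz))
      ⟨0, ((measure_mono (Set.subset_univ _)).trans_lt (by simpa using hvol.lt_top)).ne⟩
    have h2 : ⋂ M, S M = ∅ := by
      refine Set.eq_empty_of_forall_notMem fun z hz => ?_
      obtain ⟨N, hN⟩ := exists_nat_gt (max (k - u z.1) (k - u z.2))
      exact absurd (Set.mem_iInter.1 hz N) (not_lt.2 hN.le)
    rwa [h2, measure_empty] at h1
  have hlim := tendsto_setLIntegral_zero hE hSt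
  simp only [Measure.restrict_restrict (hSm _)] at hlim
  have hstep : ENNReal.ofReal Λ⁻¹ * ∫⁻ z in B ×ˢ B, ENNReal.ofReal
        (good (p z.1 z.2) (k - u z.1) (k - u z.2) (η z.1) q / sing s p z.1 z.2) ≤
      ENNReal.ofReal Λ * (∫⁻ z in B ×ˢ B, ENNReal.ofReal (bd z)) +
      2 * (ENNReal.ofReal Λ * ∫⁻ z in B ×ˢ Bᶜ, ENNReal.ofReal (tl z)) + ENNReal.ofReal Λ * 0 := by
    refine ge_of_tendsto ((ENNReal.Tendsto.const_mul hlim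
      (Or.inr ENNReal.ofReal_ne_top)).const_add _) (Filter.Eventually.of_forall fun M => ?_)
    have := A.energy_truncated hn hΩ hb hum hu hB hBΩ hηm hη hη1 hL hηL hηB hq k
      (M := (M : ℝ)) (by positivity)
    rw [Set.inter_comm] at this
    exact this
  rw [mul_zero, add_zero] at hstep
  have hmul : ENNReal.ofReal Λ * ENNReal.ofReal Λ⁻¹ = 1 := by
    rw [← ENNReal.ofReal_mul hΛ0, mul_inv_cancel₀ (by linarith), ENNReal.ofReal_one]
  calc _ = ENNReal.ofReal Λ * (ENNReal.ofReal Λ⁻¹ * ∫⁻ z in B ×ˢ B, ENNReal.ofReal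
        (good (p z.1 z.2) (k - u z.1) (k - u z.2) (η z.1) q / sing s p z.1 z.2)) := by
        rw [← mul_assoc, hmul, one_mul]
    _ ≤ ENNReal.ofReal Λ * (ENNReal.ofReal Λ * (∫⁻ z in B ×ˢ B, ENNReal.ofReal (bd z)) +
      2 * (ENNReal.ofReal Λ * ∫⁻ z in B ×ˢ Bᶜ, ENNReal.ofReal (tl z))) := by gcongr
    _ = _ := by rw [ENNReal.ofReal_mul hΛ0]; ring

end Energy

/-! ### The Caccioppoli inequality on concentric balls -/

section Caccioppoli

variable {n : ℕ} {s p K : Rn n → Rn n → ℝ} {sm sM pm pM Λ : ℝ}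

/-- A Lipschitz cutoff between the balls of radii `ρ'` and `(ρ + ρ') / 2`. -/
noncomputable def cutoff (x₀ : Rn n) (ρ' ρ : ℝ) (x : Rn n) : ℝ :=
  max 0 (min 1 (((ρ + ρ') / 2 - ‖x - x₀‖) * (2 / (ρ - ρ'))))

lemma cutoff_nonneg (x₀ : Rn n) (ρ' ρ : ℝ) (x : Rn n) : 0 ≤ cutoff x₀ ρ' ρ x := le_max_left _ _

lemma cutoff_le_one (x₀ : Rn n) (ρ' ρ : ℝ) (x : Rn n) : cutoff x₀ ρ' ρ x ≤ 1 :=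
  max_le zero_le_one (min_le_left _ _)

lemma measurable_cutoff (x₀ : Rn n) (ρ' ρ : ℝ) : Measurable (cutoff x₀ ρ' ρ) := by
  unfold cutoff; fun_prop

lemma cutoff_eq_one {x₀ : Rn n} {ρ' ρ : ℝ} (h : ρ' < ρ) {x : Rn n} (hx : x ∈ Metric.ball x₀ ρ') :
    cutoff x₀ ρ' ρ x = 1 := by
  rw [Metric.mem_ball, dist_eq_norm] at hx
  have h1 : 1 ≤ ((ρ + ρ') / 2 - ‖x - x₀‖) * (2 / (ρ - ρ')) := by
    have : 0 < ρ - ρ' := by linarith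
    rw [mul_div_assoc', le_div_iff₀ this]; linarith
  unfold cutoff; rw [min_eq_left h1]; norm_num

lemma cutoff_eq_zero {x₀ : Rn n} {ρ' ρ : ℝ} (h : ρ' < ρ) {x : Rn n}
    (hx : x ∉ Metric.ball x₀ ((ρ + ρ') / 2)) : cutoff x₀ ρ' ρ x = 0 := by
  rw [Metric.mem_ball, dist_eq_norm, not_lt] at hx
  have h1 : ((ρ + ρ') / 2 - ‖x - x₀‖) * (2 / (ρ - ρ')) ≤ 0 :=
    mul_nonpos_of_nonpos_of_nonneg (by linarith) (div_nonneg (by norm_num) (by linarith))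
  unfold cutoff
  exact max_eq_left ((min_le_right _ _).trans h1)

lemma cutoff_lipschitz {x₀ : Rn n} {ρ' ρ : ℝ} (h : ρ' < ρ) (x y : Rn n) :
    |cutoff x₀ ρ' ρ x - cutoff x₀ ρ' ρ y| ≤ 2 / (ρ - ρ') * ‖x - y‖ := by
  have hc : 0 ≤ 2 / (ρ - ρ') := div_nonneg (by norm_num) (by linarith)
  unfold cutoff
  refine (abs_max_sub_max_le_max _ _ _ _).trans (max_le (by simp; positivity) ?_)
  refine (abs_min_sub_min_le_max _ _ _ _).trans (max_le (by simp; positivity) ?_)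
  rw [← sub_mul, abs_mul, abs_of_nonneg hc, mul_comm]
  gcongr
  have : (ρ + ρ') / 2 - ‖x - x₀‖ - ((ρ + ρ') / 2 - ‖y - x₀‖) = -(‖x - x₀‖ - ‖y - x₀‖) := by ring
  rw [this, abs_neg]
  refine (abs_norm_sub_norm_le _ _).trans (le_of_eq ?_)
  congr 1; abel

lemma Admissible.aem_good (A : Admissible sm sM pm pM Λ s p K) {u : Rn n → ℝ} (hum : Measurable u)
    {η : Rn n → ℝ} (hηm : Measurable η) (q : ℕ) (k : ℝ) :
    AEMeasurable (fun z : Rn n × Rn n =>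
      good (p z.1 z.2) (k - u z.1) (k - u z.2) (η z.1) q / sing s p z.1 z.2) volume := by
  have hu1 : Measurable fun z : Rn n × Rn n => u z.1 := hum.comp measurable_fst
  have hu2 : Measurable fun z : Rn n × Rn n => u z.2 := hum.comp measurable_snd
  have hη1m : Measurable fun z : Rn n × Rn n => η z.1 := hηm.comp measurable_fst
  have hS : MeasurableSet {z : Rn n × Rn n | 0 < k - u z.1 ∧ k - u z.2 ≤ 0} :=
    (measurableSet_lt measurable_const (measurable_const.sub hu1)).inter
      (measurableSet_le (measurable_const.sub hu2) measurable_const)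
  refine AEMeasurable.div ?_ A.aem_sing
  have : (fun z : Rn n × Rn n => good (p z.1 z.2) (k - u z.1) (k - u z.2) (η z.1) q) =
      {z : Rn n × Rn n | 0 < k - u z.1 ∧ k - u z.2 ≤ 0}.indicator (fun z =>
        (k - u z.1 - (k - u z.2)) ^ (p z.1 z.2 - 1) * (k - u z.1) * η z.1 ^ q) := by
    ext z; simp only [good, Set.indicator, Set.mem_ofPred_eq]
  rw [this]
  refine AEMeasurable.indicator ?_ hS
  refine AEMeasurable.mul (AEMeasurable.mul (AEMeasurable.pow (Measurable.aemeasurable ?_)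
    (A.aem_p.sub_const 1)) (Measurable.aemeasurable ?_)) (Measurable.aemeasurable ?_)
  · fun_prop
  · fun_prop
  · fun_prop

/-- The Lipschitz bound is written through t/(2r) ≤ 1, so that the variable exponent p - sp can be
lowered to κ = pm(1-sM) at no cost depending on r. The variable exponents survive only in a^p
r^{-sp}, which is what the weight Ψ of `caccioppoli` dominates. The factor t^{κ-n} is left to
`lintegral_near`. -/
lemma Admissible.cutoff_kernel_bound (A : Admissible sm sM pm pM Λ s p K) {a c ρ' ρ r t : ℝ} {q : ℕ}
    (hq1 : 1 ≤ (q : ℝ)) (ha : 0 ≤ a) (hρ : ρ' < ρ) (hr : ρ - ρ' ≤ r)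
    (x y : Rn n) (ht : t = ‖x - y‖) (ht0 : 0 < t) (htr : t ≤ 2 * r)
    (hc : 0 ≤ c) (hcL : c ≤ 2 / (ρ - ρ') * t) :
    (q * a * c) ^ p x y / sing s p x y ≤
      a ^ p x y * r ^ (-(s x y * p x y)) * ((4 * q) ^ pM * (r / (ρ - ρ')) ^ pM *
        (r ^ (-(pm * (1 - sM))) * t ^ (pm * (1 - sM) - n))) := by
  have hd : 0 < ρ - ρ' := by linarith
  have hr0 : 0 < r := by linarith
  have hp0 : 0 < p x y := by linarith [A.p_gt x y]
  have hpM := A.p_le x y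
  have hκ := A.kappa_pos
  set P := p x y
  set σ := s x y * p x y with hσ
  set κ := pm * (1 - sM)
  have hκP : κ ≤ P - σ := A.kappa_le x y
  have hσ0 : 0 < σ := A.sp_pos x y
  have hsing : sing s p x y = t ^ n * t ^ σ := by
    unfold sing; rw [← ht, Real.rpow_add ht0, Real.rpow_natCast]
  have h1 : (q * a * c) ^ P ≤ (q * a * (2 / (ρ - ρ') * t)) ^ P := by gcongr
  have h2 : (q * a * (2 / (ρ - ρ') * t)) ^ P =
      a ^ P * ((4 * q) ^ P * (r / (ρ - ρ')) ^ P * (t / (2 * r)) ^ P) := by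
    rw [← Real.mul_rpow (by positivity) (by positivity), ← Real.mul_rpow (by positivity)
      (by positivity), ← Real.mul_rpow ha (by positivity)]
    congr 1; field_simp; ring
  have h3 : ((4 : ℝ) * q) ^ P ≤ (4 * q) ^ pM :=
    Real.rpow_le_rpow_of_exponent_le (by linarith) hpM
  have h4 : (r / (ρ - ρ')) ^ P ≤ (r / (ρ - ρ')) ^ pM :=
    Real.rpow_le_rpow_of_exponent_le ((one_le_div hd).2 hr) hpM
  have h5 : (t / (2 * r)) ^ P / t ^ σ ≤ r ^ (-σ) * (r ^ (-κ) * t ^ κ) := by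
    have e1 : (t / (2 * r)) ^ P = (t / (2 * r)) ^ (P - σ) * (t / (2 * r)) ^ σ := by
      rw [← Real.rpow_add (by positivity)]; congr 1; ring
    have e2 : (t / (2 * r)) ^ σ / t ^ σ = (2 * r) ^ (-σ) := by
      rw [Real.div_rpow ht0.le (by positivity), Real.rpow_neg (by positivity)]
      field_simp
    have e3 : (t / (2 * r)) ^ (P - σ) ≤ (t / (2 * r)) ^ κ :=
      Real.rpow_le_rpow_of_exponent_ge (by positivity) ((div_le_one (by positivity)).2 htr) hκP
    have e4 : (t / (2 * r)) ^ κ ≤ (t / r) ^ κ := by gcongr; linarith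
    have e5 : (t / r) ^ κ = r ^ (-κ) * t ^ κ := by
      rw [Real.div_rpow ht0.le hr0.le, Real.rpow_neg hr0.le]; ring
    have e6 : (2 * r) ^ (-σ) ≤ r ^ (-σ) :=
      Real.rpow_le_rpow_of_nonpos hr0 (by linarith) (by linarith)
    calc _ = (t / (2 * r)) ^ (P - σ) * ((t / (2 * r)) ^ σ / t ^ σ) := by rw [e1]; ring
      _ ≤ (r ^ (-κ) * t ^ κ) * r ^ (-σ) := by
          rw [e2, ← e5]
          exact mul_le_mul (e3.trans e4) e6 (by positivity) (by positivity)
      _ = _ := by ring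
  have h6 : t ^ (κ - n) = t ^ κ / t ^ n := by rw [Real.rpow_sub ht0, Real.rpow_natCast]
  rw [hsing, h6]
  calc (q * a * c) ^ P / (t ^ n * t ^ σ)
      ≤ a ^ P * ((4 * q) ^ P * (r / (ρ - ρ')) ^ P * (t / (2 * r)) ^ P) / (t ^ n * t ^ σ) := by
        rw [← h2]; gcongr
    _ = a ^ P * ((4 * q) ^ P * (r / (ρ - ρ')) ^ P) * ((t / (2 * r)) ^ P / t ^ σ) / t ^ n := by
        field_simp
    _ ≤ a ^ P * ((4 * q) ^ pM * (r / (ρ - ρ')) ^ pM) * (r ^ (-σ) * (r ^ (-κ) * t ^ κ)) / t ^ n := by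
        gcongr
    _ = _ := by ring

/-- Caccioppoli-type inequality for the good term on concentric balls. -/
theorem caccioppoli (n : ℕ) (hn : 0 < n) (sm sM pm pM Λ : ℝ) (hsM : sM < 1) (hpm : 1 < pm)
    (hΛ : 1 < Λ) :
    ∃ C : ℝ, 0 < C ∧ ∀ (s p K : Rn n → Rn n → ℝ), Admissible sm sM pm pM Λ s p K →
      ∀ Ω : Set (Rn n), MeasurableSet Ω → Bornology.IsBounded Ω →
      ∀ u : Rn n → ℝ, Measurable u → IsWeakSolution s p K Ω u →
      ∀ (x₀ : Rn n) (ρ' ρ r k Θ : ℝ) (Ψ : Rn n → ℝ≥0∞), 0 ≤ ρ' → ρ' < ρ → ρ ≤ r →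
        Metric.ball x₀ ρ ⊆ Ω → Measurable Ψ → (r / (ρ - ρ')) ^ pM ≤ Θ →
        (∀ x ∈ Metric.ball x₀ ρ, u x < k → ∀ y ∈ Metric.ball x₀ ρ,
          ENNReal.ofReal ((k - u x) ^ p x y * r ^ (-(s x y * p x y))) ≤ Ψ x) →
        (∀ᵐ x, x ∈ Metric.ball x₀ ((ρ + ρ') / 2) → u x < k →
          ENNReal.ofReal (k - u x) * (∫⁻ y in (Metric.ball x₀ ρ)ᶜ,
            ENNReal.ofReal (max (k - u y) 0 ^ (p x y - 1) / sing s p x y)) ≤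
            ENNReal.ofReal Θ * Ψ x) →
        ∫⁻ x in Metric.ball x₀ ρ', ∫⁻ y in Metric.ball x₀ ρ,
            ENNReal.ofReal (good (p x y) (k - u x) (k - u y) 1 0 / sing s p x y) ≤
          ENNReal.ofReal (C * Θ) * ∫⁻ x in Metric.ball x₀ ρ ∩ {x | u x < k}, Ψ x := by
  have hκ : 0 < pm * (1 - sM) := mul_pos (by linarith) (by linarith)
  obtain ⟨C₁, hC₁, hnear⟩ := lintegral_near (n := n) hn hκ
  set κ := pm * (1 - sM) with hκdef
  -- The power q ≥ pM is needed for the cutoff error. The extra 1 gives q ≥ 1 even though pM > 1 is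
  -- not yet known here.
  set q : ℕ := ⌈pM⌉₊ + 1 with hqdef
  have hq : pM ≤ (q : ℝ) := (Nat.le_ceil pM).trans (by rw [hqdef]; push_cast; linarith)
  have hq1 : (1 : ℝ) ≤ q := by rw [hqdef]; push_cast; linarith [(Nat.cast_nonneg ⌈pM⌉₊ : (0 : ℝ) ≤ _)]
  set C₂ : ℝ := (4 * q) ^ pM * (C₁ * 2 ^ κ) with hC₂
  have hC₂0 : 0 < C₂ := by positivity
  refine ⟨Λ * Λ * (2 * C₂ + 2), by positivity, ?_⟩
  -- The weight Ψ stays abstract because two choices are needed: a multiple of (-u)₊^{p₂} while u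
  -- may still be unbounded, and a constant once u is bounded below.
  intro s p K A Ω hΩ hb u hum hu x₀ ρ' ρ r k Θ Ψ hρ' hρ hr hBΩ hΨ hΘ h1 h2
  set B := Metric.ball x₀ ρ with hBdef
  have hB : MeasurableSet B := Metric.isOpen_ball.measurableSet
  have hd : 0 < ρ - ρ' := by linarith
  have hr0 : 0 < r := by linarith
  have hΘ0 : 0 ≤ Θ := le_trans (by positivity) hΘ
  set η := cutoff x₀ ρ' ρ with hη
  set U : Set (Rn n) := {x | u x < k} with hU
  have hUm : MeasurableSet U := measurableSet_lt hum measurable_const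
  have henergy := A.energy hn hΩ hb hum hu hB hBΩ (measurable_cutoff x₀ ρ' ρ)
    (cutoff_nonneg x₀ ρ' ρ) (cutoff_le_one x₀ ρ' ρ) (L := 2 / (ρ - ρ')) (by positivity)
    (cutoff_lipschitz hρ) (fun x hx => cutoff_eq_zero hρ fun h => hx
      (Metric.ball_subset_ball (by linarith) h)) hq k
  set I := ∫⁻ x in B ∩ U, Ψ x with hI
  set J : ℝ≥0∞ := ∫⁻ x in B, U.indicator Ψ x with hJ
  have hIJ : J = I := by
    rw [hJ, hI, lintegral_indicator hUm, Measure.restrict_restrict hUm, Set.inter_comm]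
  -- the left-hand side
  have hL : ∫⁻ x in Metric.ball x₀ ρ', ∫⁻ y in B,
      ENNReal.ofReal (good (p x y) (k - u x) (k - u y) 1 0 / sing s p x y) ≤
      ∫⁻ z in B ×ˢ B, ENNReal.ofReal
        (good (p z.1 z.2) (k - u z.1) (k - u z.2) (η z.1) q / sing s p z.1 z.2) := by
    have hm := (A.aem_good hum (measurable_cutoff x₀ ρ' ρ) q k).ennreal_ofReal
    rw [Measure.volume_eq_prod] at hm ⊢
    rw [← Measure.prod_restrict, lintegral_prod _ (by
      rw [Measure.prod_restrict]; exact hm.restrict)]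
    calc _ = ∫⁻ x in Metric.ball x₀ ρ', ∫⁻ y in B, ENNReal.ofReal
          (good (p x y) (k - u x) (k - u y) (η x) q / sing s p x y) := by
          -- The cutoff equals 1 on the smaller ball; the arguments 1 and 0 of `good` record its
          -- absence.
          refine setLIntegral_congr_fun Metric.isOpen_ball.measurableSet fun x hx => ?_
          have : η x = 1 := cutoff_eq_one hρ hx
          simp only [this, good, one_pow, pow_zero]
      _ ≤ _ := lintegral_mono_set (Metric.ball_subset_ball hρ.le)
  -- the cutoff error
  set W : Rn n → Rn n → ℝ≥0∞ := fun x y => U.indicator Ψ x *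
    ENNReal.ofReal ((4 * q) ^ pM * Θ * (r ^ (-κ) * ‖x - y‖ ^ (κ - n))) with hW
  have hΨi : Measurable (U.indicator Ψ) := hΨ.indicator hUm
  have hWm : Measurable (Function.uncurry W) := by
    refine (hΨi.comp measurable_fst).mul (Measurable.ennreal_ofReal ?_)
    refine measurable_const.mul (measurable_const.mul (Measurable.pow ?_ measurable_const))
    fun_prop
  have hWint : ∫⁻ x in B, ∫⁻ y in B, W x y ≤ ENNReal.ofReal (C₂ * Θ) * I := by
    calc _ ≤ ∫⁻ x in B, ENNReal.ofReal (C₂ * Θ) * U.indicator Ψ x := by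
          refine setLIntegral_mono' hB fun x hx => ?_
          simp only [hW]
          rw [lintegral_const_mul _ (by
            refine Measurable.ennreal_ofReal (measurable_const.mul (measurable_const.mul
              (Measurable.pow ?_ measurable_const)))
            fun_prop), mul_comm]
          gcongr
          calc _ = ∫⁻ y in B, ENNReal.ofReal ((4 * q) ^ pM * Θ * r ^ (-κ)) *
                ENNReal.ofReal (‖x - y‖ ^ (κ - n)) := by
                refine lintegral_congr fun y => ?_
                rw [← ENNReal.ofReal_mul (by positivity)]; congr 1; ring
            _ = ENNReal.ofReal ((4 * q) ^ pM * Θ * r ^ (-κ)) *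
                ∫⁻ y in B, ENNReal.ofReal (‖x - y‖ ^ (κ - n)) :=
                lintegral_const_mul' _ _ ENNReal.ofReal_ne_top
            _ ≤ ENNReal.ofReal ((4 * q) ^ pM * Θ * r ^ (-κ)) * ENNReal.ofReal (C₁ * (2 * r) ^ κ) := by
                gcongr
                refine le_trans (lintegral_mono_set ?_) (hnear x (2 * r) (by positivity))
                intro y hy
                rw [hBdef, Metric.mem_ball] at hy hx
                rw [Metric.mem_ball]
                linarith [dist_triangle_right y x x₀]
            _ = _ := by
                rw [← ENNReal.ofReal_mul (by positivity)]; congr 1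
                rw [Real.mul_rpow (by norm_num) hr0.le, Real.rpow_neg hr0.le, hC₂]
                field_simp
      _ = _ := by rw [lintegral_const_mul' _ _ ENNReal.ofReal_ne_top, ← hJ, hIJ]
  have hHW : ∀ x ∈ B, ∀ y ∈ B, 0 < ‖x - y‖ → ENNReal.ofReal
      ((q * max (k - u x) 0 * |η x - η y|) ^ p x y / sing s p x y) ≤ W x y := by
    intro x hx y hy hxy
    simp only [hW]
    by_cases hxU : x ∈ U
    · have hxU' : u x < k := hxU
      have ha : max (k - u x) 0 = k - u x := max_eq_left (by linarith)
      rw [Set.indicator_of_mem hxU, ha]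
      have hb1 := A.cutoff_kernel_bound (a := k - u x) (c := |η x - η y|) (r := r) (q := q) hq1
        (by linarith) hρ (by linarith) x y rfl hxy (by
          rw [hBdef, Metric.mem_ball] at hx hy
          rw [← dist_eq_norm]; linarith [dist_triangle_right x y x₀]) (abs_nonneg _)
        (cutoff_lipschitz hρ x y)
      refine (ENNReal.ofReal_le_ofReal hb1).trans ?_
      rw [ENNReal.ofReal_mul (by
        have : 0 ≤ k - u x := by linarith
        positivity)]
      gcongr
      exact h1 x hx hxU' y hy
    · have hxU' : k ≤ u x := not_lt.1 hxU
      have ha : max (k - u x) 0 = 0 := max_eq_right (by linarith)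
      have hp := A.p_gt x y
      rw [ha, mul_zero, zero_mul, Real.zero_rpow (by linarith), zero_div, ENNReal.ofReal_zero]
      exact zero_le
  have hbad : ∫⁻ z in B ×ˢ B, ENNReal.ofReal
      (bad (p z.1 z.2) (k - u z.1) (k - u z.2) (η z.1) (η z.2) q / sing s p z.1 z.2) ≤
      ENNReal.ofReal (2 * C₂ * Θ) * I := by
    calc _ ≤ ∫⁻ z in B ×ˢ B, (W z.1 z.2 + W z.2 z.1) := by
          refine setLIntegral_mono' (hB.prod hB) fun z hz => ?_
          obtain ⟨x, y⟩ := z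
          have hx : x ∈ B := hz.1
          have hy : y ∈ B := hz.2
          simp only
          have hp := A.p_gt x y
          rcases (norm_nonneg (x - y)).eq_or_lt with h0 | h0
          · have : x = y := sub_eq_zero.1 (norm_eq_zero.1 h0.symm)
            subst this
            have hz : bad (p x x) (k - u x) (k - u x) (η x) (η x) q = 0 := by
              unfold bad; rw [sub_self, abs_zero, mul_zero, Real.zero_rpow (by linarith)]
            rw [hz, zero_div, ENNReal.ofReal_zero]; exact zero_le
          · have e1 := hHW x hx y hy h0
            have e2 := hHW y hy x hx (by rwa [norm_sub_rev])
            rw [A.symm_p y x, A.sing_symm y x, abs_sub_comm (η y)] at e2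
            unfold bad
            -- The weight at whichever point attains the maximum in `bad` pays for the error.
            rcases max_cases (max (k - u x) 0) (max (k - u y) 0) with h | h
            · rw [h.1]; exact e1.trans le_self_add
            · rw [h.1]; exact e2.trans le_add_self
      _ = (∫⁻ x in B, ∫⁻ y in B, W x y) + ∫⁻ x in B, ∫⁻ y in B, W x y := by
          have hm1 : Measurable fun z : Rn n × Rn n => W z.1 z.2 := hWm
          have hm2 : Measurable fun z : Rn n × Rn n => W z.2 z.1 := hWm.comp measurable_swap
          rw [lintegral_add_left hm1, Measure.volume_eq_prod, ← Measure.prod_restrict,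
            lintegral_prod _ hm1.aemeasurable, lintegral_prod_symm _ hm2.aemeasurable]
      _ ≤ ENNReal.ofReal (C₂ * Θ) * I + ENNReal.ofReal (C₂ * Θ) * I := add_le_add hWint hWint
      _ = _ := by
          rw [← add_mul, ← ENNReal.ofReal_add (by positivity) (by positivity)]; congr 2; ring
  -- the tail
  have htail : ∫⁻ z in B ×ˢ Bᶜ, ENNReal.ofReal
      (tailTerm (p z.1 z.2) (k - u z.1) (k - u z.2) (η z.1) q / sing s p z.1 z.2) ≤
      ENNReal.ofReal Θ * I := by
    have hu1 : Measurable fun z : Rn n × Rn n => u z.1 := hum.comp measurable_fst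
    have hu2 : Measurable fun z : Rn n × Rn n => u z.2 := hum.comp measurable_snd
    have hη1m : Measurable fun z : Rn n × Rn n => η z.1 :=
      (measurable_cutoff x₀ ρ' ρ).comp measurable_fst
    have htlm : AEMeasurable (fun z : Rn n × Rn n =>
        tailTerm (p z.1 z.2) (k - u z.1) (k - u z.2) (η z.1) q / sing s p z.1 z.2) volume := by
      refine AEMeasurable.div (AEMeasurable.mul (Measurable.aemeasurable ?_)
        (AEMeasurable.pow (Measurable.aemeasurable ?_) (A.aem_p.sub_const 1))) A.aem_sing
      · exact ((measurable_const.sub hu1).max measurable_const).mul (hη1m.pow_const q)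
      · fun_prop
    have htlm' := htlm.ennreal_ofReal
    rw [Measure.volume_eq_prod] at htlm' ⊢
    rw [← Measure.prod_restrict, lintegral_prod _ (by
      rw [Measure.prod_restrict]; exact htlm'.restrict)]
    calc _ ≤ ∫⁻ x in B, ENNReal.ofReal Θ * U.indicator Ψ x := by
          refine lintegral_mono_ae ?_
          filter_upwards [ae_restrict_of_ae h2] with x hx
          by_cases hxU : x ∈ U
          · rw [Set.indicator_of_mem hxU]
            have hxU' : u x < k := hxU
            by_cases hxb : x ∈ Metric.ball x₀ ((ρ + ρ') / 2)
            · refine le_trans ?_ (hx hxb hxU)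
              rw [← lintegral_const_mul' _ _ ENNReal.ofReal_ne_top]
              refine lintegral_mono fun y => ?_
              rw [← ENNReal.ofReal_mul (by linarith)]
              apply ENNReal.ofReal_le_ofReal
              unfold tailTerm
              rw [max_eq_left (by linarith : (0 : ℝ) ≤ k - u x), mul_div_assoc]
              have e1 : 0 ≤ max (k - u y) 0 ^ (p x y - 1) / sing s p x y := by
                have := @sing_nonneg n s p x y
                have : 0 ≤ max (k - u y) 0 := le_max_right _ _
                positivity
              have e2 : η x ^ q ≤ 1 := pow_le_one₀ (cutoff_nonneg _ _ _ _) (cutoff_le_one _ _ _ _)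
              gcongr
              calc (k - u x) * η x ^ q ≤ (k - u x) * 1 := by gcongr
                _ = _ := mul_one _
            · have : η x = 0 := cutoff_eq_zero hρ hxb
              have hq0 : q ≠ 0 := by rw [hqdef]; omega
              simp [tailTerm, this, hq0]
          · have hxU' : k ≤ u x := not_lt.1 hxU
            simp [tailTerm, max_eq_right (by linarith : k - u x ≤ 0)]
      _ = _ := by rw [lintegral_const_mul' _ _ ENNReal.ofReal_ne_top, ← hJ, hIJ]
  refine hL.trans (henergy.trans ?_)
  calc _ ≤ ENNReal.ofReal (Λ * Λ) * (ENNReal.ofReal (2 * C₂ * Θ) * I + 2 * (ENNReal.ofReal Θ * I)) := by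
        gcongr
    _ = _ := by
        have : (2 : ℝ≥0∞) = ENNReal.ofReal 2 := by simp
        rw [this, ← mul_assoc (ENNReal.ofReal 2), ← ENNReal.ofReal_mul (by norm_num), ← add_mul,
          ← ENNReal.ofReal_add (by positivity) (by positivity), ← mul_assoc,
          ← ENNReal.ofReal_mul (by positivity)]
        congr 2; ring

end Caccioppoli

/-- A measurable weak solution together with the structural hypotheses. -/
structure Solution {n : ℕ} (sm sM pm pM Λ : ℝ) (s p K : Rn n → Rn n → ℝ) (Ω : Set (Rn n))
    (u : Rn n → ℝ) : Prop where
  adm : Admissible sm sM pm pM Λ s p K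
  isOpen : IsOpen Ω
  bounded : Bornology.IsBounded Ω
  meas : Measurable u
  weak : IsWeakSolution s p K Ω u

/-! ### Decay of level sets and fast geometric convergence -/

section LevelSets

lemma half_volume_ball {n : ℕ} (hn : 0 < n) {τ : ℝ} (hτ : 0 ≤ τ) :
    (2⁻¹ : ℝ≥0∞) * volume (Metric.ball (0 : Rn n) τ) = ENNReal.ofReal (ballVol n * τ ^ n / 2) := by
  rw [volume_ball_ofReal hn _ hτ, div_eq_inv_mul, ENNReal.ofReal_mul (by norm_num : (0 : ℝ) ≤ 2⁻¹),
    ENNReal.ofReal_inv_of_pos (by norm_num)]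
  simp

/-- Decay of level sets: the measure of `{u ≤ k - d}` on the smaller ball is controlled by an
integral over `{u < k}` on the larger one. -/
theorem level_set_decay (n : ℕ) (hn : 0 < n) (sm sM pm pM Λ : ℝ) (hsM : sM < 1) (hpm : 1 < pm)
    (hΛ : 1 < Λ) :
    ∃ C : ℝ, 0 < C ∧ ∀ (s p K : Rn n → Rn n → ℝ) (Ω : Set (Rn n)) (u : Rn n → ℝ),
      Solution sm sM pm pM Λ s p K Ω u →
      ∀ (x₀ : Rn n) (ρ' ρ r k Θ : ℝ) (Ψ : Rn n → ℝ≥0∞), 0 ≤ ρ' → ρ' < ρ → ρ ≤ r →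
        Metric.ball x₀ ρ ⊆ Ω → Measurable Ψ → (r / (ρ - ρ')) ^ pM ≤ Θ →
        (∀ x ∈ Metric.ball x₀ ρ, u x < k → ∀ y ∈ Metric.ball x₀ ρ,
          ENNReal.ofReal ((k - u x) ^ p x y * r ^ (-(s x y * p x y))) ≤ Ψ x) →
        (∀ᵐ x, x ∈ Metric.ball x₀ ((ρ + ρ') / 2) → u x < k →
          ENNReal.ofReal (k - u x) * (∫⁻ y in (Metric.ball x₀ ρ)ᶜ,
            ENNReal.ofReal (max (k - u y) 0 ^ (p x y - 1) / sing s p x y)) ≤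
            ENNReal.ofReal Θ * Ψ x) →
        ∀ d D τ : ℝ, 0 < d → 0 ≤ D → 0 < τ → τ ≤ ρ - ρ' →
        (∀ x ∈ Metric.ball x₀ ρ, ∀ y ∈ Metric.ball x₀ ρ,
          D ≤ d ^ p x y * r ^ (-(s x y * p x y))) →
        volume (Metric.ball x₀ ρ ∩ {x | u x < k}) ≤ 2⁻¹ * volume (Metric.ball (0 : Rn n) τ) →
        volume (Metric.ball x₀ ρ' ∩ {x | u x ≤ k - d}) * ENNReal.ofReal (D * (r / τ) ^ (sm * pm)) ≤
          ENNReal.ofReal (C * Θ) * ∫⁻ x in Metric.ball x₀ ρ ∩ {x | u x < k}, Ψ x := by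
  obtain ⟨C, hC, hcac⟩ := caccioppoli n hn sm sM pm pM Λ hsM hpm hΛ
  have hv := @ballVol_pos n
  refine ⟨C * (2 / ballVol n), by positivity, ?_⟩
  intro s p K Ω u S x₀ ρ' ρ r k Θ Ψ hρ' hρ hr hBΩ hΨ hΘ h1 h2 d D τ hd hD hτ hτρ hD0 hvol
  have A := S.adm
  have hmain := hcac s p K A Ω S.isOpen.measurableSet S.bounded u S.meas S.weak x₀ ρ' ρ r k Θ Ψ
    hρ' hρ hr hBΩ hΨ hΘ h1 h2
  have hr0 : 0 < r := by linarith
  have hτr : τ ≤ r := by linarith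
  have hX : MeasurableSet (Metric.ball x₀ ρ' ∩ {x | u x ≤ k - d}) :=
    Metric.isOpen_ball.measurableSet.inter (measurableSet_le S.meas measurable_const)
  have hA : MeasurableSet (Metric.ball x₀ ρ ∩ {x | u x < k}) :=
    Metric.isOpen_ball.measurableSet.inter (measurableSet_lt S.meas measurable_const)
  -- If u(x) ≤ k-d, u(y) ≥ k and |x-y| < τ, the integrand is at least d^p τ^{-(n+sp)} = d^p r^{-sp}
  -- (r/τ)^{sp} τ^{-n}. Since r/τ ≥ 1, the exponent sp may be lowered to sm·pm.
  have hlow := measure_mul_le_lintegral x₀ hτρ hX hA Set.inter_subset_left hvol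
    (V := ENNReal.ofReal (D * (r / τ) ^ (sm * pm) / τ ^ n))
    (H := fun x y => ENNReal.ofReal (good (p x y) (k - u x) (k - u y) 1 0 / sing s p x y)) (by
    rintro x ⟨hx, hxu⟩ y hy hyA hxy
    have hxu' : u x ≤ k - d := hxu
    have hyu : k ≤ u y := not_lt.1 fun h => hyA ⟨hy, h⟩
    have hne : x ≠ y := by rintro rfl; linarith
    have ht : 0 < ‖x - y‖ := norm_pos_iff.2 (sub_ne_zero.2 hne)
    apply ENNReal.ofReal_le_ofReal
    have hp := A.p_gt x y
    have hg : d ^ p x y ≤ good (p x y) (k - u x) (k - u y) 1 0 := by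
      unfold good
      rw [if_pos ⟨by linarith, by linarith⟩, pow_zero, mul_one,
        ← rpow_sub_one_mul_self hp hd.le]
      have h3 : d ^ (p x y - 1) ≤ (k - u x - (k - u y)) ^ (p x y - 1) :=
        Real.rpow_le_rpow hd.le (by linarith) (by linarith)
      exact mul_le_mul h3 (by linarith) hd.le (Real.rpow_nonneg (by linarith) _)
    have hxB : x ∈ Metric.ball x₀ ρ := Metric.ball_subset_ball hρ.le hx
    have hsing : sing s p x y ≤ τ ^ (s x y * p x y) * τ ^ n := by
      unfold sing
      rw [← Real.rpow_natCast, ← Real.rpow_add hτ, add_comm]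
      have := A.sp_pos x y
      gcongr
    have hsp := A.sp_pos x y
    have hs0 := @sing_pos n s p x y hne
    rw [le_div_iff₀ hs0]
    calc D * (r / τ) ^ (sm * pm) / τ ^ n * sing s p x y
        ≤ (d ^ p x y * r ^ (-(s x y * p x y))) * (r / τ) ^ (s x y * p x y) / τ ^ n *
          (τ ^ (s x y * p x y) * τ ^ n) := by
          have h3 : (r / τ) ^ (sm * pm) ≤ (r / τ) ^ (s x y * p x y) :=
            Real.rpow_le_rpow_of_exponent_le ((one_le_div hτ).2 hτr) (A.sigma_le x y)
          have h4 := hD0 x hxB y hy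
          gcongr
      _ = d ^ p x y := by
          rw [Real.div_rpow hr0.le hτ.le, Real.rpow_neg hr0.le]
          field_simp
      _ ≤ _ := hg)
  have hlow' := hlow.trans hmain
  rw [half_volume_ball hn hτ.le, ← ENNReal.ofReal_mul (by positivity)] at hlow'
  have e2 : D * (r / τ) ^ (sm * pm) = (D * (r / τ) ^ (sm * pm) / τ ^ n * (ballVol n * τ ^ n / 2)) *
      (2 / ballVol n) := by field_simp
  rw [e2, ENNReal.ofReal_mul (by positivity), ← mul_assoc]
  calc _ ≤ ENNReal.ofReal (C * Θ) * (∫⁻ x in Metric.ball x₀ ρ ∩ {x | u x < k}, Ψ x) *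
        ENNReal.ofReal (2 / ballVol n) := by gcongr
    _ = _ := by
      have hΘ0 : 0 ≤ Θ := le_trans (Real.rpow_nonneg (div_nonneg hr0.le (by linarith)) _) hΘ
      rw [mul_right_comm, ← ENNReal.ofReal_mul (by positivity)]; congr 2; ring

/-- Fast geometric decay of a sequence of measures. -/
lemma fast_geometric_decay (n : ℕ) (hn : 0 < n) {σ N C : ℝ} (hσ : 0 < σ) (hN : σ ≤ N) (hC : 0 < C) :
    ∃ τ₀ : ℝ, 0 < τ₀ ∧ τ₀ ≤ 1 / 16 ∧ ∀ (r : ℝ), 0 < r → ∀ a : ℕ → ℝ≥0∞,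
      (∀ (j : ℕ) (τ : ℝ), 0 < τ → τ ≤ 2⁻¹ ^ j / 16 →
        a j ≤ ENNReal.ofReal (ballVol n * (τ * r) ^ n / 2) →
        a (j + 1) * ENNReal.ofReal (τ ^ (-σ)) ≤ ENNReal.ofReal (C * 2 ^ (j * N) * (τ * r) ^ n)) →
      a 0 ≤ ENNReal.ofReal (ballVol n * (τ₀ * r) ^ n / 2) →
      ∀ z : ℝ≥0∞, (∀ j, z ≤ a j) → z = 0 := by
  have hv := @ballVol_pos n
  -- The hypothesis will be used at step j with τ = τ₀ μ^j. As μ^σ = 2^{-N}, the gain τ^σ cancels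
  -- the growth 2^{jN} exactly. The constant c is such that the remaining C τ₀^σ is smaller than the
  -- volume ratio of consecutive balls, and N ≥ σ gives μ ≤ 1/2, which keeps τ below 2^{-j}/16.
  set μ : ℝ := 2 ^ (-(N / σ)) with hμ
  have hμ0 : 0 < μ := by positivity
  have hμ2 : μ ≤ 2⁻¹ := by
    rw [hμ, ← Real.rpow_neg_one 2]
    apply Real.rpow_le_rpow_of_exponent_le (by norm_num)
    rw [neg_le_neg_iff, one_le_div hσ]; exact hN
  have hμσ : μ ^ σ = 2 ^ (-N) := by
    rw [hμ, ← Real.rpow_mul (by norm_num)]; congr 1; field_simp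
  set c : ℝ := ballVol n * μ ^ (n + 1) / 2 / C with hc
  have hc0 : 0 < c := by positivity
  set τ₀ : ℝ := min (1 / 16) (c ^ σ⁻¹) with hτ₀
  have hτ₀0 : 0 < τ₀ := lt_min (by norm_num) (by positivity)
  have hτ₀c : τ₀ ^ σ ≤ c := by
    calc τ₀ ^ σ ≤ (c ^ σ⁻¹) ^ σ := by gcongr; exact min_le_right _ _
      _ = c := by rw [← Real.rpow_mul hc0.le, inv_mul_cancel₀ hσ.ne', Real.rpow_one]
  refine ⟨τ₀, hτ₀0, min_le_left _ _, fun r hr a ha ha0 z hz => ?_⟩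
  have hτj : ∀ j : ℕ, τ₀ * μ ^ j ≤ 2⁻¹ ^ j / 16 := fun j => by
    calc τ₀ * μ ^ j ≤ (1 / 16) * 2⁻¹ ^ j := by gcongr; exact min_le_left _ _
      _ = _ := by ring
  have key : ∀ j : ℕ, a j ≤ ENNReal.ofReal (ballVol n * (τ₀ * μ ^ j * r) ^ n / 2) := by
    intro j
    induction j with
    | zero => simpa using ha0
    | succ j ih =>
      have hτ : 0 < τ₀ * μ ^ j := by positivity
      have h1 := ha j (τ₀ * μ ^ j) hτ (hτj j) ih
      have hpos : 0 < (τ₀ * μ ^ j) ^ (-σ) := by positivity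
      have h2 : a (j + 1) ≤ ENNReal.ofReal (C * 2 ^ (j * N) * (τ₀ * μ ^ j * r) ^ n) /
          ENNReal.ofReal ((τ₀ * μ ^ j) ^ (-σ)) := by
        rw [ENNReal.le_div_iff_mul_le (Or.inl (by simpa using hpos)) (Or.inl ENNReal.ofReal_ne_top)]
        exact h1
      refine h2.trans ?_
      rw [← ENNReal.ofReal_div_of_pos hpos]
      apply ENNReal.ofReal_le_ofReal
      have e1 : (τ₀ * μ ^ j) ^ (-σ) = (τ₀ ^ σ * (2 ^ (j * N))⁻¹)⁻¹ := by
        rw [Real.rpow_neg hτ.le, Real.mul_rpow hτ₀0.le (by positivity), ← Real.rpow_natCast,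
          ← Real.rpow_mul hμ0.le, mul_comm (j : ℝ) σ, Real.rpow_mul hμ0.le, hμσ,
          ← Real.rpow_mul (by norm_num), neg_mul, Real.rpow_neg (by norm_num), mul_comm N]
      rw [e1, div_inv_eq_mul]
      have hμn : μ ^ (n + 1) ≤ μ ^ n := pow_le_pow_of_le_one hμ0.le (by linarith) (by omega)
      calc C * 2 ^ (j * N) * (τ₀ * μ ^ j * r) ^ n * (τ₀ ^ σ * (2 ^ (j * N))⁻¹)
          = C * τ₀ ^ σ * (τ₀ * μ ^ j * r) ^ n := by field_simp
        _ ≤ C * c * (τ₀ * μ ^ j * r) ^ n := by gcongr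
        _ = ballVol n * μ ^ (n + 1) / 2 * (τ₀ * μ ^ j * r) ^ n := by rw [hc]; field_simp
        _ ≤ ballVol n * μ ^ n / 2 * (τ₀ * μ ^ j * r) ^ n := by gcongr
        _ = _ := by rw [pow_succ]; ring
  have hlim : Filter.Tendsto (fun j : ℕ => ENNReal.ofReal (ballVol n * (τ₀ * μ ^ j * r) ^ n / 2))
      Filter.atTop (nhds (ENNReal.ofReal (ballVol n * (τ₀ * 0 * r) ^ n / 2))) := by
    refine ENNReal.tendsto_ofReal ?_
    have := tendsto_pow_atTop_nhds_zero_of_lt_one hμ0.le (by linarith : μ < 1)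
    exact ((((this.const_mul τ₀).mul_const r).pow n).const_mul _).div_const 2
  rw [mul_zero, zero_mul, zero_pow hn.ne', mul_zero, zero_div, ENNReal.ofReal_zero] at hlim
  exact le_antisymm (ge_of_tendsto' hlim fun j => (hz j).trans (key j)) zero_le

end LevelSets

/-! ### The weight for solutions bounded below on a ball -/

section Growth

variable {n : ℕ} {s p K : Rn n → Rn n → ℝ} {sm sM pm pM Λ : ℝ} {Ω : Set (Rn n)} {u : Rn n → ℝ}

/-- The constant in front of the weight for functions with small oscillation. -/
noncomputable def weightConst (n : ℕ) (pM C₁ : ℝ) : ℝ :=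
  C₁ * (2 ^ pM * (1 + ballVol n * 2 ^ (n + pM)) + 2)

lemma weightConst_pos (n : ℕ) (pM : ℝ) {C₁ : ℝ} (hC₁ : 0 < C₁) : 0 < weightConst n pM C₁ := by
  unfold weightConst
  have := @ballVol_pos n
  positivity

/-- The weight equal to a constant where `m ≤ u` and to `∞` elsewhere. -/
noncomputable def boundedWeight (u : Rn n → ℝ) (m c : ℝ) (x : Rn n) : ℝ≥0∞ :=
  {x | m ≤ u x}.indicator (fun _ => ENNReal.ofReal c) x + {x | u x < m}.indicator (fun _ => ⊤) x

lemma measurable_boundedWeight (hu : Measurable u) (m c : ℝ) :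
    Measurable (boundedWeight u m c) :=
  (measurable_const.indicator (measurableSet_le measurable_const hu)).add
    (measurable_const.indicator (measurableSet_lt hu measurable_const))

lemma boundedWeight_of_le {m c : ℝ} {x : Rn n} (h : m ≤ u x) :
    boundedWeight u m c x = ENNReal.ofReal c := by
  simp [boundedWeight, Set.indicator, h, not_lt.2 h]

lemma boundedWeight_of_lt {m c : ℝ} {x : Rn n} (h : u x < m) :
    boundedWeight u m c x = ⊤ := by
  simp [boundedWeight, Set.indicator, h]

lemma lintegral_boundedWeight {x₀ : Rn n} {r ρ m c : ℝ} (hρ : ρ ≤ r) (hu : Measurable u)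
    (hlow : ∀ᵐ x, x ∈ Metric.ball x₀ r → m ≤ u x) (k : ℝ) :
    ∫⁻ x in Metric.ball x₀ ρ ∩ {x | u x < k}, boundedWeight u m c x =
      ENNReal.ofReal c * volume (Metric.ball x₀ ρ ∩ {x | u x < k}) := by
  have hm : MeasurableSet (Metric.ball x₀ ρ ∩ {x | u x < k}) :=
    Metric.isOpen_ball.measurableSet.inter (measurableSet_lt hu measurable_const)
  rw [← setLIntegral_const]
  refine setLIntegral_congr_fun_ae hm ?_
  filter_upwards [hlow] with x hx hxm
  exact boundedWeight_of_le (hx (Metric.ball_subset_ball hρ hxm.1))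

/-- Where u ≥ m, one has k - u ≤ 2d. The bound is required at every point while u ≥ m holds only
almost everywhere; the value ∞ of the weight covers the exceptional null set and does not affect
integrals. -/
lemma Admissible.weight_bound (A : Admissible sm sM pm pM Λ s p K)
    {x₀ : Rn n} {r m d D C₁ k ρ' ρ : ℝ} (hd : 0 < d) (hD : 0 < D) (hC₁ : 0 < C₁)
    (hcomp : ∀ x ∈ Metric.ball x₀ r, ∀ y ∈ Metric.ball x₀ r,
      d ^ p x y * r ^ (-(s x y * p x y)) ≤ C₁ * D)
    (hk : k ≤ m + 2 * d) (hρ' : 0 ≤ ρ') (hρ : ρ' < ρ) (hρr : ρ ≤ r) :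
    ∀ x ∈ Metric.ball x₀ ρ, u x < k → ∀ y ∈ Metric.ball x₀ ρ,
      ENNReal.ofReal ((k - u x) ^ p x y * r ^ (-(s x y * p x y))) ≤
        boundedWeight u m (weightConst n pM C₁ * D) x := by
  intro x hx hxk y hy
  rcases lt_or_ge (u x) m with h | h
  · rw [boundedWeight_of_lt h]; exact le_top
  rw [boundedWeight_of_le h]
  apply ENNReal.ofReal_le_ofReal
  have hp := A.p_gt x y
  have hr : 0 ≤ r := by linarith
  have hv := @ballVol_pos n
  calc (k - u x) ^ p x y * r ^ (-(s x y * p x y))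
      ≤ (2 * d) ^ p x y * r ^ (-(s x y * p x y)) := by
        gcongr
        linarith
    _ = 2 ^ p x y * (d ^ p x y * r ^ (-(s x y * p x y))) := by
        rw [Real.mul_rpow (by norm_num) hd.le]; ring
    _ ≤ 2 ^ pM * (C₁ * D) := by
        have h1 : (2 : ℝ) ^ p x y ≤ 2 ^ pM :=
          Real.rpow_le_rpow_of_exponent_le (by norm_num) (A.p_le x y)
        exact mul_le_mul h1
          (hcomp x (Metric.ball_subset_ball hρr hx) y (Metric.ball_subset_ball hρr hy))
          (by positivity) (by positivity)
    _ ≤ weightConst n pM C₁ * D := by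
        unfold weightConst
        have : 0 ≤ C₁ * D * (2 ^ pM * (ballVol n * 2 ^ (n + pM)) + 2) := by positivity
        nlinarith

/-- Outside B_r the assumed tail bound applies because k ≤ m + 2d. In the annulus between B_ρ and
B_r almost every y has (k-u(y))₊ ≤ 2d, and |x-y| ≥ g = (ρ-ρ')/2. The integrand is then bounded
there, at a cost of (r/g)^{pM} from the exponents and (r/g)^n from the kernel. -/
lemma Solution.weight_tail (S : Solution sm sM pm pM Λ s p K Ω u) (hn : 0 < n)
    {x₀ : Rn n} {r m d D C₁ k ρ' ρ : ℝ} (hd : 0 < d) (hD : 0 < D) (hC₁ : 0 < C₁)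
    (hlow : ∀ᵐ x, x ∈ Metric.ball x₀ r → m ≤ u x)
    (hcomp : ∀ x ∈ Metric.ball x₀ r, ∀ y ∈ Metric.ball x₀ r,
      d ^ p x y * r ^ (-(s x y * p x y)) ≤ C₁ * D)
    (htail : ∀ᵐ x, x ∈ Metric.ball x₀ (r / 2) → ∫⁻ y in (Metric.ball x₀ r)ᶜ,
      ENNReal.ofReal (max (m + 2 * d - u y) 0 ^ (p x y - 1) / sing s p x y) ≤
        ENNReal.ofReal (C₁ * D / d))
    (hk : k ≤ m + 2 * d) (hρ' : 0 ≤ ρ') (hρ : ρ' < ρ) (hρr : ρ ≤ r / 2) :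
    ∀ᵐ x, x ∈ Metric.ball x₀ ((ρ + ρ') / 2) → u x < k →
      ENNReal.ofReal (k - u x) * (∫⁻ y in (Metric.ball x₀ ρ)ᶜ,
        ENNReal.ofReal (max (k - u y) 0 ^ (p x y - 1) / sing s p x y)) ≤
      ENNReal.ofReal ((r / (ρ - ρ')) ^ (n + pM)) *
        boundedWeight u m (weightConst n pM C₁ * D) x := by
  have A := S.adm
  have hv := @ballVol_pos n
  have hδ : 0 < ρ - ρ' := by linarith
  have hr : 0 < r := by linarith
  have hpM := A.pM_gt
  set Θ : ℝ := (r / (ρ - ρ')) ^ (n + pM) with hΘ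
  have hΘ1 : 1 ≤ Θ := Real.one_le_rpow ((one_le_div hδ).2 (by linarith)) (by positivity)
  set g : ℝ := (ρ - ρ') / 2 with hg
  have hg0 : 0 < g := by positivity
  clear_value g
  filter_upwards [htail] with x hx hxB hxk
  rcases lt_or_ge (u x) m with h | h
  · rw [boundedWeight_of_lt h, ENNReal.mul_top]
    · exact le_top
    · rw [ne_eq, ENNReal.ofReal_eq_zero, not_le]; linarith
  rw [boundedWeight_of_le h]
  have hxr2 : x ∈ Metric.ball x₀ (r / 2) := Metric.ball_subset_ball (by linarith) hxB
  have hxr : x ∈ Metric.ball x₀ r := Metric.ball_subset_ball (by linarith) hxB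
  have hsub : (Metric.ball x₀ ρ)ᶜ ⊆ (Metric.ball x₀ r)ᶜ ∪ (Metric.ball x₀ r \ Metric.ball x₀ ρ) := by
    intro y hy
    by_cases h : y ∈ Metric.ball x₀ r
    · exact Or.inr ⟨h, hy⟩
    · exact Or.inl h
  have hfar : ∫⁻ y in (Metric.ball x₀ r)ᶜ, ENNReal.ofReal
      (max (k - u y) 0 ^ (p x y - 1) / sing s p x y) ≤ ENNReal.ofReal (C₁ * D / d) := by
    refine le_trans (lintegral_mono fun y => ?_) (hx hxr2)
    apply ENNReal.ofReal_le_ofReal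
    have := @sing_nonneg n s p x y
    have hp := A.p_gt x y
    gcongr
  set c : ℝ := 2 ^ pM * (C₁ * D) * (r / g) ^ pM / g ^ n / (2 * d) with hc
  have hmid : ∫⁻ y in Metric.ball x₀ r \ Metric.ball x₀ ρ, ENNReal.ofReal
      (max (k - u y) 0 ^ (p x y - 1) / sing s p x y) ≤ ENNReal.ofReal (c * (ballVol n * r ^ n)) := by
    calc _ ≤ ∫⁻ y in Metric.ball x₀ r \ Metric.ball x₀ ρ, ENNReal.ofReal c := by
          refine setLIntegral_mono_ae' (Metric.isOpen_ball.measurableSet.diff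
            Metric.isOpen_ball.measurableSet) ?_
          filter_upwards [hlow] with y hy hyB
          have hym := hy hyB.1
          apply ENNReal.ofReal_le_ofReal
          have hp := A.p_gt x y
          have hxy : g ≤ ‖x - y‖ := by
            have h1 := hyB.2
            rw [Metric.mem_ball] at hxB h1
            rw [← dist_eq_norm]
            have := dist_triangle_left y x₀ x
            rw [hg]; linarith
          have hsp := A.sp_pos x y
          have hsing : g ^ n * g ^ (s x y * p x y) ≤ sing s p x y := by
            unfold sing
            rw [← Real.rpow_natCast, ← Real.rpow_add hg0]
            gcongr
          have hs0 : 0 < sing s p x y := lt_of_lt_of_le (by positivity) hsing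
          have hnum : max (k - u y) 0 ^ (p x y - 1) ≤ (2 * d) ^ (p x y - 1) := by
            apply Real.rpow_le_rpow (le_max_right _ _) (max_le (by linarith) (by linarith))
            linarith
          have hrg : 1 ≤ r / g := (one_le_div hg0).2 (by rw [hg]; linarith)
          calc _ ≤ (2 * d) ^ (p x y - 1) / (g ^ n * g ^ (s x y * p x y)) := by gcongr
            _ = (2 * d) ^ (p x y) * r ^ (-(s x y * p x y)) * (r / g) ^ (s x y * p x y) / g ^ n /
                (2 * d) := by
                rw [← rpow_sub_one_mul_self hp (by positivity : 0 ≤ 2 * d),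
                  Real.div_rpow hr.le hg0.le, Real.rpow_neg hr.le]
                field_simp
            _ = 2 ^ p x y * (d ^ p x y * r ^ (-(s x y * p x y))) * (r / g) ^ (s x y * p x y) / g ^ n /
                (2 * d) := by
                rw [Real.mul_rpow (by norm_num) hd.le]; ring
            _ ≤ 2 ^ pM * (C₁ * D) * (r / g) ^ pM / g ^ n / (2 * d) := by
                have h1 : (2 : ℝ) ^ p x y ≤ 2 ^ pM :=
                  Real.rpow_le_rpow_of_exponent_le (by norm_num) (A.p_le x y)
                have h2 : (r / g) ^ (s x y * p x y) ≤ (r / g) ^ pM :=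
                  Real.rpow_le_rpow_of_exponent_le hrg (A.sp_le x y)
                have h3 := mul_le_mul h1 (hcomp x hxr y hyB.1) (by positivity) (by positivity)
                gcongr
      _ = ENNReal.ofReal c * volume (Metric.ball x₀ r \ Metric.ball x₀ ρ) := by simp
      _ ≤ ENNReal.ofReal c * volume (Metric.ball x₀ r) := by
          gcongr; exact Set.sdiff_subset
      _ = _ := by
          rw [volume_ball_ofReal hn _ hr.le, ← ENNReal.ofReal_mul (by positivity)]
  calc _ ≤ ENNReal.ofReal (2 * d) * (ENNReal.ofReal (C₁ * D / d) +
        ENNReal.ofReal (c * (ballVol n * r ^ n))) := by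
        gcongr
        · linarith
        · exact (lintegral_mono_set hsub).trans ((lintegral_union_le _ _ _).trans
            (add_le_add hfar hmid))
    _ = ENNReal.ofReal (2 * d * (C₁ * D / d + c * (ballVol n * r ^ n))) := by
        rw [← ENNReal.ofReal_add (by positivity) (by positivity),
          ← ENNReal.ofReal_mul (by positivity)]
    _ ≤ _ := by
        rw [← ENNReal.ofReal_mul (by positivity)]
        apply ENNReal.ofReal_le_ofReal
        have e1 : 2 * d * (c * (ballVol n * r ^ n)) =
            2 ^ pM * (C₁ * D) * ballVol n * (2 ^ (n + pM) * Θ) := by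
          have e2 : (2 : ℝ) ^ (n + pM) * Θ = (r / g) ^ pM * (r / g) ^ n := by
            rw [hΘ, ← Real.mul_rpow (by norm_num) (by positivity), ← Real.rpow_natCast,
              ← Real.rpow_add (by positivity), add_comm pM]
            congr 1; rw [hg]; field_simp
          rw [e2, hc, div_pow r g n]; field_simp
        have e3 : 2 * d * (C₁ * D / d) = 2 * (C₁ * D) := by field_simp
        rw [mul_add, e1, e3]
        unfold weightConst
        have h4 : 0 ≤ C₁ * D * 2 ^ pM * Θ := by positivity
        have h5 : 2 * (C₁ * D) ≤ 2 * (C₁ * D) * Θ := by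
          have : 0 ≤ 2 * (C₁ * D) := by positivity
          nlinarith
        calc 2 * (C₁ * D) + 2 ^ pM * (C₁ * D) * ballVol n * (2 ^ (n + pM) * Θ)
            ≤ 2 * (C₁ * D) * Θ + 2 ^ pM * (C₁ * D) * ballVol n * (2 ^ (n + pM) * Θ) +
              C₁ * D * 2 ^ pM * Θ := by linarith
          _ = _ := by ring

end Growth

/-! ### Measure shrinking, the De Giorgi lemma and the growth lemma -/

section GrowthLemma

/-- The hypotheses of the growth lemma at scale `r` and height `d`: the solution is bounded below
by `m` on the ball of radius `r`, the quantity `d^p r^{-sp}` is comparable to `D` there, and the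
tail is controlled. -/
structure GrowthHyp {n : ℕ} (s p : Rn n → Rn n → ℝ) (Ω : Set (Rn n)) (u : Rn n → ℝ)
    (x₀ : Rn n) (r m d D C₁ : ℝ) : Prop where
  r_pos : 0 < r
  d_pos : 0 < d
  D_pos : 0 < D
  subset : Metric.ball x₀ r ⊆ Ω
  low : ∀ᵐ x, x ∈ Metric.ball x₀ r → m ≤ u x
  le_comp : ∀ x ∈ Metric.ball x₀ r, ∀ y ∈ Metric.ball x₀ r,
    D / C₁ ≤ d ^ p x y * r ^ (-(s x y * p x y))
  comp_le : ∀ x ∈ Metric.ball x₀ r, ∀ y ∈ Metric.ball x₀ r,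
    d ^ p x y * r ^ (-(s x y * p x y)) ≤ C₁ * D
  tail : ∀ᵐ x, x ∈ Metric.ball x₀ (r / 2) → ∫⁻ y in (Metric.ball x₀ r)ᶜ,
      ENNReal.ofReal (max (m + 2 * d - u y) 0 ^ (p x y - 1) / sing s p x y) ≤
        ENNReal.ofReal (C₁ * D / d)

lemma ennreal_le_of_mul_le {v : ℝ≥0∞} {a b : ℝ} (ha : 0 < a)
    (h : v * ENNReal.ofReal a ≤ ENNReal.ofReal b) : v ≤ ENNReal.ofReal (b / a) := by
  rw [ENNReal.ofReal_div_of_pos ha,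
    ENNReal.le_div_iff_mul_le (Or.inl (by simpa using ha)) (Or.inl ENNReal.ofReal_ne_top)]
  exact h

/-- Measure shrinking: if `u ≥ m + ω/2` on half of the ball then `{u < m + δω}` is small. -/
theorem measure_shrinking (n : ℕ) (hn : 0 < n) (sm sM pm pM Λ C₁ : ℝ) (hsM : sM < 1) (hpm : 1 < pm)
    (hΛ : 1 < Λ) (hC₁ : 0 < C₁) :
    ∃ C : ℝ, 0 < C ∧ ∀ (s p K : Rn n → Rn n → ℝ) (Ω : Set (Rn n)) (u : Rn n → ℝ),
      Solution sm sM pm pM Λ s p K Ω u →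
      ∀ (x₀ : Rn n) (r m ω δ D : ℝ), 0 < ω → 0 < δ → δ ≤ 1 / 8 →
        GrowthHyp s p Ω u x₀ r m (δ * ω) D C₁ →
        2⁻¹ * volume (Metric.ball x₀ (r / 4)) ≤
          volume (Metric.ball x₀ (r / 4) ∩ {x | m + ω / 2 ≤ u x}) →
        volume (Metric.ball x₀ (r / 4) ∩ {x | u x < m + δ * ω}) ≤
          ENNReal.ofReal (C * δ ^ (pm - 1) * r ^ n) := by
  obtain ⟨C, hC, hcac⟩ := caccioppoli n hn sm sM pm pM Λ hsM hpm hΛ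
  have hv := @ballVol_pos n
  have hw := weightConst_pos n pM hC₁
  refine ⟨C * 4 ^ (n + pM) * weightConst n pM C₁ * (2 * C₁ * 4 ^ n * 4 ^ (pm - 1)),
    by positivity, ?_⟩
  intro s p K Ω u S x₀ r m ω δ D hω hδ hδ8 G hdens
  have A := S.adm
  have hr := G.r_pos
  have hD := G.D_pos
  have hd := G.d_pos
  have hpM := A.pM_gt
  set d := δ * ω with hd'
  set k := m + 2 * d with hk
  have hΘe : r / (r / 2 - r / 4) = 4 := by field_simp; norm_num
  have hsub2 : Metric.ball x₀ (r / 2) ⊆ Metric.ball x₀ r := Metric.ball_subset_ball (by linarith)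
  have htl := S.weight_tail hn hd hD hC₁ G.low G.comp_le G.tail le_rfl
    (by positivity : 0 ≤ r / 4) (by linarith : r / 4 < r / 2) le_rfl
  rw [hΘe] at htl
  have hmain := hcac s p K A Ω S.isOpen.measurableSet S.bounded u S.meas S.weak x₀ (r / 4) (r / 2) r k
    (4 ^ (n + pM)) (boundedWeight u m (weightConst n pM C₁ * D)) (by positivity) (by linarith)
    (by linarith) (hsub2.trans G.subset) (measurable_boundedWeight S.meas _ _) (by
      rw [hΘe]
      exact Real.rpow_le_rpow_of_exponent_le (by norm_num) (by linarith [(Nat.cast_nonneg n : (0:ℝ) ≤ n)]))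
    (A.weight_bound hd hD hC₁ G.comp_le le_rfl (by positivity) (by linarith : r / 4 < r / 2)
      (by linarith)) htl
  clear hcac
  rw [lintegral_boundedWeight (r := r) (by linarith) S.meas G.low] at hmain
  set X := Metric.ball x₀ (r / 4) ∩ {x | u x < m + d} with hX
  set Y := Metric.ball x₀ (r / 4) ∩ {x | m + ω / 2 ≤ u x} with hY
  have hXm : MeasurableSet X :=
    Metric.isOpen_ball.measurableSet.inter (measurableSet_lt S.meas measurable_const)
  have hYm : MeasurableSet Y :=
    Metric.isOpen_ball.measurableSet.inter (measurableSet_le measurable_const S.meas)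
  -- For x in X and y in Y the jump is at least ω/4 = d/(4δ), while k - u(x) ≥ d because k = m + 2d.
  -- So the good term is at least d^p (4δ)^{-(p-1)}. As 4δ ≤ 1 this is at least d^p (4δ)^{-(pm-1)},
  -- the source of the small factor δ^{pm-1}.
  set V : ℝ := D / C₁ * (4 * δ) ^ (-(pm - 1)) / r ^ n with hV
  have hpt : ∀ x ∈ X, ∀ y ∈ Y, ENNReal.ofReal V ≤
      ENNReal.ofReal (good (p x y) (k - u x) (k - u y) 1 0 / sing s p x y) := by
    rintro x ⟨hx, hxu⟩ y ⟨hy, hyu⟩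
    have hxu' : u x < m + d := hxu
    have hyu' : m + ω / 2 ≤ u y := hyu
    have hωd : 8 * d ≤ ω := by rw [hd']; nlinarith
    apply ENNReal.ofReal_le_ofReal
    have hp := A.p_gt x y
    have hsp := A.sp_pos x y
    have hne : x ≠ y := by rintro rfl; linarith
    have hs0 := @sing_pos n s p x y hne
    have hg : (ω / 4) ^ (p x y - 1) * d ≤ good (p x y) (k - u x) (k - u y) 1 0 := by
      unfold good
      rw [if_pos ⟨by linarith, by linarith⟩, pow_zero, mul_one]
      have h3 : (ω / 4) ^ (p x y - 1) ≤ (k - u x - (k - u y)) ^ (p x y - 1) :=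
        Real.rpow_le_rpow (by positivity) (by linarith) (by linarith)
      exact mul_le_mul h3 (by linarith) hd.le (Real.rpow_nonneg (by linarith) _)
    have hxy : ‖x - y‖ ≤ r := by
      rw [Metric.mem_ball] at hx hy
      rw [← dist_eq_norm]; linarith [dist_triangle_right x y x₀]
    have hsing : sing s p x y ≤ r ^ n * r ^ (s x y * p x y) := by
      unfold sing
      rw [← Real.rpow_natCast, ← Real.rpow_add hr]
      gcongr
    have h4 : (4 * δ) ^ (-(pm - 1)) ≤ (4 * δ) ^ (-(p x y - 1)) := by
      apply Real.rpow_le_rpow_of_exponent_ge (by positivity) (by linarith)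
      linarith [A.p_ge x y]
    have h5 : (ω / 4) ^ (p x y - 1) * d = d ^ p x y * (4 * δ) ^ (-(p x y - 1)) := by
      have : ω / 4 = d * (4 * δ)⁻¹ := by rw [hd']; field_simp
      rw [this, Real.mul_rpow hd.le (by positivity), ← rpow_sub_one_mul_self hp hd.le,
        Real.inv_rpow (by positivity), Real.rpow_neg (by positivity)]
      ring
    have hBx : x ∈ Metric.ball x₀ r := Metric.ball_subset_ball (by linarith) hx
    have hBy : y ∈ Metric.ball x₀ r := Metric.ball_subset_ball (by linarith) hy
    rw [le_div_iff₀ hs0]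
    refine le_trans ?_ hg
    rw [h5]
    calc V * sing s p x y ≤ (d ^ p x y * r ^ (-(s x y * p x y))) * (4 * δ) ^ (-(p x y - 1)) / r ^ n *
          (r ^ n * r ^ (s x y * p x y)) := by
          have := G.le_comp x hBx y hBy
          rw [hV]
          gcongr
      _ = _ := by
          rw [Real.rpow_neg hr.le]; field_simp
  have hlow : volume X * (ENNReal.ofReal V * volume Y) ≤
      ∫⁻ x in Metric.ball x₀ (r / 4), ∫⁻ y in Metric.ball x₀ (r / 2),
        ENNReal.ofReal (good (p x y) (k - u x) (k - u y) 1 0 / sing s p x y) := by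
    calc _ = ∫⁻ x in X, ∫⁻ y in Y, ENNReal.ofReal V := by simp [mul_comm]
      _ ≤ ∫⁻ x in X, ∫⁻ y in Y, ENNReal.ofReal
          (good (p x y) (k - u x) (k - u y) 1 0 / sing s p x y) :=
          setLIntegral_mono' hXm fun x hx => setLIntegral_mono' hYm fun y hy => hpt x hx y hy
      _ ≤ ∫⁻ x in Metric.ball x₀ (r / 4), ∫⁻ y in Y, ENNReal.ofReal
          (good (p x y) (k - u x) (k - u y) 1 0 / sing s p x y) :=
          lintegral_mono_set Set.inter_subset_left
      _ ≤ _ := lintegral_mono fun x => lintegral_mono_set (Set.inter_subset_left.trans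
          (Metric.ball_subset_ball (by linarith)))
  have hb4 : 2⁻¹ * volume (Metric.ball x₀ (r / 4)) = ENNReal.ofReal (ballVol n * (r / 4) ^ n / 2) := by
    rw [← half_volume_ball hn (by positivity), Measure.addHaar_ball_center]
  have hfin : volume X * ENNReal.ofReal (V * (ballVol n * (r / 4) ^ n / 2)) ≤
      ENNReal.ofReal (C * 4 ^ (n + pM) * (weightConst n pM C₁ * D) * (ballVol n * r ^ n)) := by
    calc _ = volume X * (ENNReal.ofReal V * (2⁻¹ * volume (Metric.ball x₀ (r / 4)))) := by
          rw [hb4, ← ENNReal.ofReal_mul (by positivity)]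
      _ ≤ volume X * (ENNReal.ofReal V * volume Y) := by gcongr
      _ ≤ _ := hlow.trans hmain
      _ ≤ ENNReal.ofReal (C * 4 ^ (n + pM)) * (ENNReal.ofReal (weightConst n pM C₁ * D) *
          volume (Metric.ball x₀ r)) := by
          gcongr
          exact Set.inter_subset_left.trans hsub2
      _ = _ := by
          rw [volume_ball_ofReal hn _ hr.le, ← ENNReal.ofReal_mul (by positivity),
            ← ENNReal.ofReal_mul (by positivity)]
          congr 1; ring
  refine (ennreal_le_of_mul_le (by positivity) hfin).trans (le_of_eq ?_)
  congr 1
  rw [hV, Real.rpow_neg (by positivity), Real.mul_rpow (by norm_num) hδ.le, div_pow]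
  field_simp

/-- De Giorgi lemma: if `{u < m + d}` is small then `u ≥ m + d/2` on a smaller ball. -/
theorem deGiorgi_lemma (n : ℕ) (hn : 0 < n) (sm sM pm pM Λ C₁ : ℝ) (hsm : 0 < sm) (hsM : sM < 1)
    (hpm : 1 < pm) (hΛ : 1 < Λ) (hC₁ : 0 < C₁) :
    ∃ ν : ℝ, 0 < ν ∧ ∀ (s p K : Rn n → Rn n → ℝ) (Ω : Set (Rn n)) (u : Rn n → ℝ),
      Solution sm sM pm pM Λ s p K Ω u →
      ∀ (x₀ : Rn n) (r m d D : ℝ), GrowthHyp s p Ω u x₀ r m d D C₁ →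
        volume (Metric.ball x₀ (r / 4) ∩ {x | u x < m + d}) ≤ ENNReal.ofReal (ν * r ^ n) →
        ∀ᵐ x, x ∈ Metric.ball x₀ (r / 8) → m + d / 2 ≤ u x := by
  obtain ⟨C, hC, hlev⟩ := level_set_decay n hn sm sM pm pM Λ hsM hpm hΛ
  have hv := @ballVol_pos n
  have hw := weightConst_pos n pM hC₁
  have hσ : 0 < sm * pm := by positivity
  -- Step j costs 2^{j(n+pM)} through the gap of the radii and 2^{j pM} through the gap of the
  -- levels; the term sm·pm secures σ ≤ N. The absolute value is there because pM > 1 is known only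
  -- once a solution is given.
  set N : ℝ := n + 2 * |pM| + sm * pm with hN
  set C₂ : ℝ := C * 16 ^ (n + pM) * weightConst n pM C₁ * C₁ * 4 ^ pM * ballVol n with hC₂
  obtain ⟨τ₀, hτ₀, hτ₀16, hiter⟩ := fast_geometric_decay n hn (σ := sm * pm) (N := N) (C := C₂) hσ
    (by rw [hN]; have : (0:ℝ) ≤ n := by positivity
        linarith [abs_nonneg pM]) (by positivity)
  refine ⟨ballVol n * τ₀ ^ n / 2, by positivity, ?_⟩
  intro s p K Ω u S x₀ r m d D G h0
  have A := S.adm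
  have hr := G.r_pos
  have hD := G.D_pos
  have hd := G.d_pos
  have hpM := A.pM_gt
  set ρ : ℕ → ℝ := fun j => r / 8 + r / 8 * 2⁻¹ ^ j with hρ
  set k : ℕ → ℝ := fun j => m + d / 2 + d / 2 * 2⁻¹ ^ j with hk
  set a : ℕ → ℝ≥0∞ := fun j => volume (Metric.ball x₀ (ρ j) ∩ {x | u x < k j}) with ha
  have hhalf : ∀ j : ℕ, (2⁻¹ : ℝ) ^ j ≤ 1 := fun j => pow_le_one₀ (by norm_num) (by norm_num)
  have hhalf0 : ∀ j : ℕ, 0 < (2⁻¹ : ℝ) ^ j := fun j => by positivity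
  have hz := hiter r hr a (by
    intro j τ hτ hτj haj
    have hj0 := hhalf0 j
    have hj1 := hhalf j
    have hρd : ρ j - ρ (j + 1) = r / 16 * 2⁻¹ ^ j := by simp only [hρ]; rw [pow_succ]; ring
    have hkd : k j - k (j + 1) = d / 4 * 2⁻¹ ^ j := by simp only [hk]; rw [pow_succ]; ring
    have hρlt : ρ (j + 1) < ρ j := by
      have : 0 < r / 16 * 2⁻¹ ^ j := by positivity
      linarith
    have hρ0 : 0 ≤ ρ (j + 1) := by simp only [hρ]; positivity
    have hρr : ρ j ≤ r / 2 := by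
      simp only [hρ]
      have : r / 8 * 2⁻¹ ^ j ≤ r / 8 * 1 := by gcongr
      linarith
    have hkle : k j ≤ m + 2 * d := by
      simp only [hk]
      have : d / 2 * 2⁻¹ ^ j ≤ d / 2 * 1 := by gcongr
      linarith
    have hΘe : r / (ρ j - ρ (j + 1)) = 16 * 2 ^ j := by
      rw [hρd, inv_pow]; field_simp
    have hsub : Metric.ball x₀ (ρ j) ⊆ Metric.ball x₀ r := Metric.ball_subset_ball (by linarith)
    set Θ : ℝ := (16 * 2 ^ j) ^ (n + pM) with hΘ
    set d' : ℝ := d / 4 * 2⁻¹ ^ j with hd'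
    have hd'0 : 0 < d' := by positivity
    set D' : ℝ := D / C₁ * (2⁻¹ ^ j / 4) ^ pM with hD'
    have htl := S.weight_tail hn hd hD hC₁ G.low G.comp_le G.tail hkle hρ0 hρlt hρr
    rw [hΘe] at htl
    have h1 := hlev s p K Ω u S x₀ (ρ (j + 1)) (ρ j) r (k j) Θ
      (boundedWeight u m (weightConst n pM C₁ * D)) hρ0 hρlt (by linarith) (hsub.trans G.subset)
      (measurable_boundedWeight S.meas _ _) (by
        rw [hΘe]
        refine Real.rpow_le_rpow_of_exponent_le ?_ (by linarith [(Nat.cast_nonneg n : (0:ℝ) ≤ n)])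
        have : (1:ℝ) ≤ 2 ^ j := one_le_pow₀ (by norm_num)
        linarith)
      (A.weight_bound hd hD hC₁ G.comp_le hkle hρ0 hρlt (by linarith)) htl
      d' D' (τ * r) hd'0 (by positivity) (by positivity) (by
        rw [hρd]
        calc τ * r ≤ 2⁻¹ ^ j / 16 * r := by gcongr
          _ = _ := by ring)
      (by
        intro x hx y hy
        have h2 := G.le_comp x (hsub hx) y (hsub hy)
        have h3 : d' = d * (2⁻¹ ^ j / 4) := by rw [hd']; ring
        rw [h3, Real.mul_rpow hd.le (by positivity), hD']
        have h4 : (2⁻¹ ^ j / 4 : ℝ) ^ pM ≤ (2⁻¹ ^ j / 4) ^ p x y :=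
          Real.rpow_le_rpow_of_exponent_ge (by positivity) (by linarith) (A.p_le x y)
        calc _ ≤ (d ^ p x y * r ^ (-(s x y * p x y))) * (2⁻¹ ^ j / 4) ^ p x y := by gcongr
          _ = _ := by ring)
      (by
        rw [half_volume_ball hn (by positivity)]; exact haj)
    rw [lintegral_boundedWeight (r := r) (by linarith) S.meas G.low] at h1
    have h2 : a (j + 1) ≤ volume (Metric.ball x₀ (ρ (j + 1)) ∩ {x | u x ≤ k j - d'}) := by
      simp only [ha]
      refine measure_mono fun x hx => ⟨hx.1, ?_⟩
      have hx2 : u x < k (j + 1) := hx.2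
      show u x ≤ k j - d'
      linarith
    have hrτ : r / (τ * r) = τ⁻¹ := by field_simp
    have h3 : a (j + 1) * ENNReal.ofReal (τ ^ (-(sm * pm))) * ENNReal.ofReal D' ≤
        ENNReal.ofReal (C * Θ * (weightConst n pM C₁ * D) * (ballVol n * (τ * r) ^ n / 2)) := by
      calc _ = a (j + 1) * ENNReal.ofReal (D' * (r / (τ * r)) ^ (sm * pm)) := by
            rw [hrτ, Real.inv_rpow hτ.le, ← Real.rpow_neg hτ.le, mul_comm D',
              ENNReal.ofReal_mul (p := τ ^ (-(sm * pm))) (by positivity), mul_assoc]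
        _ ≤ _ := (mul_le_mul_left h2 _).trans h1
        _ ≤ ENNReal.ofReal (C * Θ) * (ENNReal.ofReal (weightConst n pM C₁ * D) *
            ENNReal.ofReal (ballVol n * (τ * r) ^ n / 2)) := by gcongr
        _ = _ := by
            rw [← ENNReal.ofReal_mul (by positivity), ← ENNReal.ofReal_mul (by positivity)]
            congr 1; ring
    refine (ennreal_le_of_mul_le (by positivity) h3).trans (ENNReal.ofReal_le_ofReal ?_)
    have e1 : Θ = 16 ^ (n + pM) * 2 ^ (j * (n + pM)) := by
      rw [hΘ, Real.mul_rpow (by norm_num) (by positivity), ← Real.rpow_natCast 2 j,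
        ← Real.rpow_mul (by norm_num)]
    have e2 : (2⁻¹ ^ j / 4 : ℝ) ^ pM = (4 ^ pM * 2 ^ (j * pM))⁻¹ := by
      have : (2⁻¹ ^ j / 4 : ℝ) = (4 * 2 ^ j)⁻¹ := by rw [inv_pow]; field_simp
      rw [this, Real.inv_rpow (by positivity), Real.mul_rpow (by norm_num) (by positivity),
        ← Real.rpow_natCast 2 j, ← Real.rpow_mul (by norm_num)]
    have e3 : (2 : ℝ) ^ (j * (n + pM)) * 2 ^ (j * pM) ≤ 2 ^ (j * N) := by
      rw [← Real.rpow_add (by norm_num)]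
      apply Real.rpow_le_rpow_of_exponent_le (by norm_num)
      have : (0 : ℝ) ≤ j := by positivity
      rw [hN, abs_of_pos (by linarith : 0 < pM)]
      nlinarith
    calc C * Θ * (weightConst n pM C₁ * D) * (ballVol n * (τ * r) ^ n / 2) / D'
        = C * 16 ^ (n + pM) * weightConst n pM C₁ * C₁ * 4 ^ pM * ballVol n *
          (2 ^ (j * (n + pM)) * 2 ^ (j * pM)) * (τ * r) ^ n / 2 := by
          rw [hD', e1, e2]; field_simp
      _ ≤ C * 16 ^ (n + pM) * weightConst n pM C₁ * C₁ * 4 ^ pM * ballVol n *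
          2 ^ (j * N) * (τ * r) ^ n / 1 := by gcongr; norm_num
      _ = _ := by rw [hC₂]; ring)
    (by
      have e1 : ρ 0 = r / 4 := by simp only [hρ]; ring
      have e2 : k 0 = m + d := by simp only [hk]; ring
      simp only [ha]; rw [e1, e2]
      refine h0.trans (le_of_eq ?_)
      rw [mul_pow]; congr 1; ring)
    (volume (Metric.ball x₀ (r / 8) ∩ {x | u x < m + d / 2})) (by
      intro j
      refine measure_mono fun x hx => ⟨Metric.ball_subset_ball ?_ hx.1, ?_⟩
      · simp only [hρ]; have := hhalf0 j; have : 0 < r / 8 * 2⁻¹ ^ j := by positivity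
        linarith
      · have hx2 : u x < m + d / 2 := hx.2
        show u x < k j
        simp only [hk]
        have := hhalf0 j
        have : 0 < d / 2 * 2⁻¹ ^ j := by positivity
        linarith)
  have := measure_eq_zero_iff_ae_notMem.1 hz
  filter_upwards [this] with x hx hxB
  by_contra hlt
  exact hx ⟨hxB, not_le.1 hlt⟩

/-- Growth lemma. -/
theorem growth_lemma (n : ℕ) (hn : 0 < n) (sm sM pm pM Λ C₁ : ℝ) (hsm : 0 < sm) (hsM : sM < 1)
    (hpm : 1 < pm) (hΛ : 1 < Λ) (hC₁ : 0 < C₁) :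
    ∃ δ : ℝ, 0 < δ ∧ δ ≤ 1 / 8 ∧ ∀ (s p K : Rn n → Rn n → ℝ) (Ω : Set (Rn n)) (u : Rn n → ℝ),
      Solution sm sM pm pM Λ s p K Ω u →
      ∀ (x₀ : Rn n) (r m ω D : ℝ), 0 < ω → GrowthHyp s p Ω u x₀ r m (δ * ω) D C₁ →
        2⁻¹ * volume (Metric.ball x₀ (r / 4)) ≤
          volume (Metric.ball x₀ (r / 4) ∩ {x | m + ω / 2 ≤ u x}) →
        ∀ᵐ x, x ∈ Metric.ball x₀ (r / 8) → m + δ * ω / 2 ≤ u x := by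
  obtain ⟨C, hC, hshr⟩ := measure_shrinking n hn sm sM pm pM Λ C₁ hsM hpm hΛ hC₁
  obtain ⟨ν, hν, hdg⟩ := deGiorgi_lemma n hn sm sM pm pM Λ C₁ hsm hsM hpm hΛ hC₁
  have hp1 : 0 < pm - 1 := by linarith
  -- This δ makes C δ^{pm-1} ≤ ν, the smallness asked for by `deGiorgi_lemma`. It depends on C₁ but
  -- not on D, ω or r.
  refine ⟨min (1 / 8) ((ν / C) ^ (pm - 1)⁻¹), lt_min (by norm_num) (by positivity),
    min_le_left _ _, ?_⟩
  set δ := min (1 / 8) ((ν / C) ^ (pm - 1)⁻¹) with hδ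
  have hδ0 : 0 < δ := lt_min (by norm_num) (by positivity)
  intro s p K Ω u S x₀ r m ω D hω G hdens
  refine hdg s p K Ω u S x₀ r m (δ * ω) D G ?_
  refine (hshr s p K Ω u S x₀ r m ω δ D hω hδ0 (min_le_left _ _) G hdens).trans ?_
  apply ENNReal.ofReal_le_ofReal
  have hr := G.r_pos
  have : δ ^ (pm - 1) ≤ ν / C := by
    calc δ ^ (pm - 1) ≤ ((ν / C) ^ (pm - 1)⁻¹) ^ (pm - 1) := by gcongr; exact min_le_right _ _
      _ = ν / C := by rw [← Real.rpow_mul (by positivity), inv_mul_cancel₀ hp1.ne', Real.rpow_one]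
  calc C * δ ^ (pm - 1) * r ^ n ≤ C * (ν / C) * r ^ n := by gcongr
    _ = _ := by field_simp

end GrowthLemma

/-! ### Symmetry, tails, oscillation of the exponents, and layer-cake integrability -/

section Preparation

variable {n : ℕ} {s p K : Rn n → Rn n → ℝ} {sm sM pm pM Λ : ℝ} {Ω : Set (Rn n)} {u : Rn n → ℝ}

lemma Solution.neg (S : Solution sm sM pm pM Λ s p K Ω u) :
    Solution sm sM pm pM Λ s p K Ω (fun x => -u x) := by
  refine ⟨S.adm, S.isOpen, S.bounded, S.meas.neg, ⟨S.weak.1.1.neg, S.weak.1.2.1.neg, ?_⟩, ?_⟩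
  · refine lt_of_eq_of_lt (lintegral_congr fun z => ?_) S.weak.1.2.2
    have : |-u z.1 - -u z.2| = |u z.1 - u z.2| := by rw [abs_sub_comm]; congr 1; ring
    rw [this]
  · intro φ hφ hφ0
    have h := S.weak.2 φ hφ hφ0
    rw [← neg_eq_zero, ← integral_neg]
    rw [← h]
    congr 1; ext z
    have : |-u z.1 - -u z.2| = |u z.1 - u z.2| := by rw [abs_sub_comm]; congr 1; ring
    rw [this]; ring

lemma MemTail.neg (h : MemTail s p Ω u) : MemTail s p Ω (fun x => -u x) := by
  refine ⟨h.1.neg, ?_⟩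
  simpa only [abs_neg] using h.2

/-- Tails outside balls of radius `g`, with explicit dependence on `g`. -/
lemma Solution.tail_bound (S : Solution sm sM pm pM Λ s p K Ω u) (hT : MemTail s p Ω u) :
    ∃ T : ℝ, 0 < T ∧ ∀ᵐ x, x ∈ Ω → ∀ g : ℝ, 0 < g → g ≤ 1 →
      ∫⁻ y in {y | g ≤ ‖x - y‖}, ENNReal.ofReal (|u y| ^ (p x y - 1) / sing s p x y) ≤
        ENNReal.ofReal (T * g ^ (-(n + pM))) := by
  have A := S.adm
  obtain ⟨R, hR, hΩR⟩ := S.bounded.exists_pos_norm_le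
  set E := essSup (fun x : Rn n => ∫⁻ y : Rn n,
    ENNReal.ofReal (|u y| ^ (p x y - 1) / (1 + ‖y‖) ^ ((n : ℝ) + s x y * p x y)))
    (volume.restrict Ω) with hE
  have hE' : E ≠ ∞ := hT.2.ne
  refine ⟨(2 + R) ^ (n + pM) * (E.toReal + 1), by positivity, ?_⟩
  have hae : ∀ᵐ x ∂(volume.restrict Ω), ∫⁻ y : Rn n,
      ENNReal.ofReal (|u y| ^ (p x y - 1) / (1 + ‖y‖) ^ ((n : ℝ) + s x y * p x y)) ≤ E :=
    ENNReal.ae_le_essSup _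
  rw [ae_restrict_iff' S.isOpen.measurableSet] at hae
  filter_upwards [hae] with x hx hxΩ g hg hg1
  have hxR := hΩR x hxΩ
  have hc : 0 ≤ ((2 + R) / g) ^ (n + pM) := by positivity
  have hgm : MeasurableSet {y : Rn n | g ≤ ‖x - y‖} := by
    have hf : Measurable fun y : Rn n => ‖x - y‖ := by fun_prop
    exact measurableSet_le measurable_const hf
  calc _ ≤ ∫⁻ y in {y | g ≤ ‖x - y‖}, ENNReal.ofReal (((2 + R) / g) ^ (n + pM)) *
        ENNReal.ofReal (|u y| ^ (p x y - 1) / (1 + ‖y‖) ^ ((n : ℝ) + s x y * p x y)) := by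
        refine setLIntegral_mono' hgm fun y hy => ?_
        have hy' : g ≤ ‖x - y‖ := hy
        rw [← ENNReal.ofReal_mul hc]
        apply ENNReal.ofReal_le_ofReal
        have ht : 0 < ‖x - y‖ := lt_of_lt_of_le hg hy'
        have hsp := A.sp_pos x y
        have hspM := A.sp_le x y
        have h1 : 1 + ‖y‖ ≤ (2 + R) / g * ‖x - y‖ := by
          have h2 : ‖y‖ ≤ ‖x‖ + ‖x - y‖ := by
            have := norm_sub_le x (x - y); simpa using this
          have h3 : (1 + R) ≤ (1 + R) / g * ‖x - y‖ := by
            rw [div_mul_eq_mul_div, le_div_iff₀ hg]; gcongr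
          have h4 : ‖x - y‖ ≤ 1 / g * ‖x - y‖ := by
            have : 1 ≤ 1 / g := (one_le_div hg).2 hg1
            nlinarith
          have h5 : (2 + R) / g * ‖x - y‖ = (1 + R) / g * ‖x - y‖ + 1 / g * ‖x - y‖ := by ring
          linarith
        have h2 : (1 + ‖y‖) ^ ((n : ℝ) + s x y * p x y) ≤
            ((2 + R) / g) ^ (n + pM) * sing s p x y := by
          calc _ ≤ ((2 + R) / g * ‖x - y‖) ^ ((n : ℝ) + s x y * p x y) := by gcongr
            _ = ((2 + R) / g) ^ ((n : ℝ) + s x y * p x y) * sing s p x y := by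
                rw [Real.mul_rpow (by positivity) ht.le]; rfl
            _ ≤ _ := by
                have := @sing_nonneg n s p x y
                gcongr
                rw [one_le_div hg]; linarith
        have hs0 : 0 < sing s p x y := by unfold sing; positivity
        rw [mul_div_assoc', div_le_div_iff₀ hs0 (by positivity)]
        have h3 : 0 ≤ |u y| ^ (p x y - 1) := by positivity
        calc _ ≤ |u y| ^ (p x y - 1) * (((2 + R) / g) ^ (n + pM) * sing s p x y) := by gcongr
          _ = _ := by ring
    _ ≤ ∫⁻ y, ENNReal.ofReal (((2 + R) / g) ^ (n + pM)) *
        ENNReal.ofReal (|u y| ^ (p x y - 1) / (1 + ‖y‖) ^ ((n : ℝ) + s x y * p x y)) :=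
        setLIntegral_le_lintegral _ _
    _ ≤ ENNReal.ofReal (((2 + R) / g) ^ (n + pM)) * ENNReal.ofReal (E.toReal + 1) := by
        rw [lintegral_const_mul' _ _ ENNReal.ofReal_ne_top]
        gcongr
        refine (hx hxΩ).trans ?_
        rw [ENNReal.ofReal_add ENNReal.toReal_nonneg zero_le_one, ENNReal.ofReal_toReal hE']
        exact le_self_add
    _ = _ := by
        rw [← ENNReal.ofReal_mul hc, Real.div_rpow (by positivity) hg.le, Real.rpow_neg hg.le]
        congr 1; ring

lemma le_osc {f : Rn n → Rn n → ℝ} {lo hi : ℝ} (hlo : ∀ x y, lo ≤ f x y) (hhi : ∀ x y, f x y ≤ hi)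
    {x₀ : Rn n} {r : ℝ} (hB : Metric.ball x₀ r ⊆ Ω) {x₁ x₂ y₁ y₂ : Rn n}
    (hx₁ : x₁ ∈ Metric.ball x₀ r) (hx₂ : x₂ ∈ Metric.ball x₀ r)
    (hy₁ : y₁ ∈ Metric.ball x₀ r) (hy₂ : y₂ ∈ Metric.ball x₀ r) :
    |f x₁ y₁ - f x₂ y₂| ≤ osc f Ω r := by
  refine le_csSup ⟨hi - lo, ?_⟩ ⟨x₀, hB, x₁, hx₁, x₂, hx₂, y₁, hy₁, y₂, hy₂, rfl⟩
  rintro t ⟨_, _, a, _, b, _, c, _, d, _, rfl⟩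
  rw [abs_le]
  constructor <;> linarith [hlo a c, hlo b d, hhi a c, hhi b d]

lemma osc_nonneg (f : Rn n → Rn n → ℝ) (Ω : Set (Rn n)) (r : ℝ) : 0 ≤ osc f Ω r := by
  refine Real.sSup_nonneg ?_
  rintro t ⟨_, _, a, _, b, _, c, _, d, _, rfl⟩
  exact abs_nonneg _

lemma Admissible.logHolder (A : Admissible sm sM pm pM Λ s p K) {c : ℝ} (h : LogHolder s p Ω c)
    {x₀ : Rn n} {r : ℝ} (hr : 0 < r) (hr2 : r ≤ 1 / 2) (hB : Metric.ball x₀ r ⊆ Ω)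
    {x₁ x₂ y₁ y₂ : Rn n}
    (hx₁ : x₁ ∈ Metric.ball x₀ r) (hx₂ : x₂ ∈ Metric.ball x₀ r)
    (hy₁ : y₁ ∈ Metric.ball x₀ r) (hy₂ : y₂ ∈ Metric.ball x₀ r) :
    |p x₁ y₁ - p x₂ y₂| * Real.log (1 / r) ≤ c ∧ |s x₁ y₁ - s x₂ y₂| * Real.log (1 / r) ≤ c := by
  have h1 := le_osc A.p_ge A.p_le hB hx₁ hx₂ hy₁ hy₂
  have h2 := le_osc A.s_ge A.s_le hB hx₁ hx₂ hy₁ hy₂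
  have h3 := osc_nonneg p Ω r
  have h4 := osc_nonneg s Ω r
  have h5 := h r hr hr2
  have h6 : 0 ≤ Real.log (1 / r) := Real.log_nonneg ((one_le_div hr).2 (by linarith))
  constructor
  · refine le_trans ?_ h5; gcongr; linarith
  · refine le_trans ?_ h5; gcongr; linarith

/-- Integrability from polynomial decay of the distribution function. -/
lemma lintegral_rpow_lt_top_of_decay {B : Set (Rn n)} (hB : MeasurableSet B) (hvol : volume B < ∞)
    {f : Rn n → ℝ} (hf : Measurable f) (hf0 : ∀ x, 0 ≤ f x) {h₀ C q q' : ℝ} (hh₀ : 0 < h₀)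
    (hC : 0 ≤ C) (hq : 0 < q) (hqq : q < q')
    (hdec : ∀ h, h₀ ≤ h → volume (B ∩ {x | 2 * h < f x}) ≤ ENNReal.ofReal (C * h ^ (-q'))) :
    ∫⁻ x in B, ENNReal.ofReal (f x ^ q) < ∞ := by
  -- On the layer where f is comparable to h₀ 2^i the integrand is of order 2^{iq} and the measure
  -- of order 2^{-iq'}, so θ is the ratio of a geometric series.
  set θ : ℝ := 2 ^ (q - q') with hθ
  have hθ0 : 0 < θ := by positivity
  have hθ1 : θ < 1 := Real.rpow_lt_one_of_one_lt_of_neg (by norm_num) (by linarith)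
  set S : ℕ → Set (Rn n) := fun i =>
    B ∩ {x | 2 * h₀ * 2 ^ i < f x ∧ f x ≤ 2 * h₀ * 2 ^ (i + 1)} with hS
  have hSm : ∀ i, MeasurableSet (S i) := fun i =>
    hB.inter ((measurableSet_lt measurable_const hf).inter (measurableSet_le hf measurable_const))
  have hcov : B ⊆ (B ∩ {x | f x ≤ 2 * h₀}) ∪ ⋃ i, S i := by
    intro x hx
    rcases le_or_gt (f x) (2 * h₀) with h | h
    · exact Or.inl ⟨hx, h⟩
    right
    obtain ⟨i, hi1, hi2⟩ := exists_nat_pow_near (show 1 ≤ f x / (2 * h₀) by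
      rw [one_le_div (by positivity)]; exact h.le) one_lt_two
    rw [le_div_iff₀ (by positivity)] at hi1
    rw [div_lt_iff₀ (by positivity)] at hi2
    rcases hi1.lt_or_eq with hlt | heq
    · exact Set.mem_iUnion.2 ⟨i, hx, by linarith, by linarith⟩
    · cases i with
      | zero => simp at heq; linarith
      | succ i =>
        refine Set.mem_iUnion.2 ⟨i, hx, ?_, by linarith⟩
        rw [← heq, pow_succ]
        have : (0:ℝ) < 2 ^ i := by positivity
        nlinarith
  have hshell : ∀ i, ∫⁻ x in S i, ENNReal.ofReal (f x ^ q) ≤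
      ENNReal.ofReal ((4 * h₀) ^ q * C * h₀ ^ (-q') * θ ^ i) := by
    intro i
    calc _ ≤ ∫⁻ x in S i, ENNReal.ofReal ((2 * h₀ * 2 ^ (i + 1)) ^ q) := by
          refine setLIntegral_mono' (hSm i) fun x hx => ?_
          apply ENNReal.ofReal_le_ofReal
          exact Real.rpow_le_rpow (hf0 x) hx.2.2 hq.le
      _ = ENNReal.ofReal ((2 * h₀ * 2 ^ (i + 1)) ^ q) * volume (S i) := by simp
      _ ≤ ENNReal.ofReal ((2 * h₀ * 2 ^ (i + 1)) ^ q) *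
          ENNReal.ofReal (C * (h₀ * 2 ^ i) ^ (-q')) := by
          gcongr
          refine (measure_mono ?_).trans (hdec (h₀ * 2 ^ i) ?_)
          · intro x hx
            refine ⟨hx.1, ?_⟩
            have := hx.2.1
            show 2 * (h₀ * 2 ^ i) < f x
            linarith
          · have : (1:ℝ) ≤ 2 ^ i := one_le_pow₀ (by norm_num)
            nlinarith
      _ = _ := by
          rw [← ENNReal.ofReal_mul (by positivity)]
          congr 1
          have e1 : 2 * h₀ * 2 ^ (i + 1) = 4 * h₀ * 2 ^ i := by rw [pow_succ]; ring
          have e2 : θ ^ i = ((2 : ℝ) ^ i) ^ q * (2 ^ i) ^ (-q') := by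
            rw [← Real.rpow_add (by positivity), hθ, ← Real.rpow_natCast 2 i, ← Real.rpow_mul_natCast
              (by norm_num), ← Real.rpow_mul (by norm_num)]
            congr 1; ring
          rw [e1, e2, Real.mul_rpow (by positivity) (by positivity),
            Real.mul_rpow (x := h₀) (by positivity) (by positivity)]
          ring
  calc _ ≤ ∫⁻ x in (B ∩ {x | f x ≤ 2 * h₀}) ∪ ⋃ i, S i, ENNReal.ofReal (f x ^ q) :=
        lintegral_mono_set hcov
    _ ≤ (∫⁻ x in B ∩ {x | f x ≤ 2 * h₀}, ENNReal.ofReal (f x ^ q)) +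
        ∫⁻ x in ⋃ i, S i, ENNReal.ofReal (f x ^ q) := lintegral_union_le _ _ _
    _ ≤ ENNReal.ofReal ((2 * h₀) ^ q) * volume B +
        ∑' i, ENNReal.ofReal ((4 * h₀) ^ q * C * h₀ ^ (-q') * θ ^ i) := by
        refine add_le_add ?_ ((lintegral_iUnion_le _ _).trans (ENNReal.tsum_le_tsum hshell))
        calc _ ≤ ∫⁻ x in B ∩ {x | f x ≤ 2 * h₀}, ENNReal.ofReal ((2 * h₀) ^ q) := by
              refine setLIntegral_mono' (hB.inter (measurableSet_le hf measurable_const))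
                fun x hx => ?_
              exact ENNReal.ofReal_le_ofReal (Real.rpow_le_rpow (hf0 x) hx.2 hq.le)
          _ = ENNReal.ofReal ((2 * h₀) ^ q) * volume (B ∩ {x | f x ≤ 2 * h₀}) := by simp
          _ ≤ _ := by gcongr; exact Set.inter_subset_left
    _ < ∞ := by
        rw [← ENNReal.ofReal_tsum_of_nonneg (fun i => by positivity)
          ((summable_geometric_of_lt_one hθ0.le hθ1).mul_left _)]
        exact ENNReal.add_lt_top.2 ⟨ENNReal.mul_lt_top ENNReal.ofReal_lt_top hvol,
          ENNReal.ofReal_lt_top⟩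

end Preparation

/-! ### Higher integrability from the modular, and decay at large negative levels -/

section Boundedness

variable {n : ℕ} {s p K : Rn n → Rn n → ℝ} {sm sM pm pM Λ : ℝ} {Ω : Set (Rn n)} {u : Rn n → ℝ}

lemma measure_lt_le_of_lintegral {B : Set (Rn n)} (hB : MeasurableSet B) {f : Rn n → ℝ}
    (hf : Measurable f) {q I h : ℝ} (hq : 0 < q) (hh : 0 < h)
    (hI : ∫⁻ x in B, ENNReal.ofReal (f x ^ q) ≤ ENNReal.ofReal I) :
    volume (B ∩ {x | h < f x}) ≤ ENNReal.ofReal (I * h ^ (-q)) := by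
  have hm : MeasurableSet (B ∩ {x | h < f x}) := hB.inter (measurableSet_lt measurable_const hf)
  have : volume (B ∩ {x | h < f x}) * ENNReal.ofReal (h ^ q) ≤ ENNReal.ofReal I := by
    calc _ = ∫⁻ x in B ∩ {x | h < f x}, ENNReal.ofReal (h ^ q) := by simp [mul_comm]
      _ ≤ ∫⁻ x in B ∩ {x | h < f x}, ENNReal.ofReal (f x ^ q) := by
          refine setLIntegral_mono' hm fun x hx => ENNReal.ofReal_le_ofReal ?_
          exact Real.rpow_le_rpow hh.le (le_of_lt hx.2) hq.le
      _ ≤ _ := (lintegral_mono_set Set.inter_subset_left).trans hI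
  refine (ennreal_le_of_mul_le (by positivity) this).trans (le_of_eq ?_)
  rw [Real.rpow_neg hh.le]; rfl

/-- The radius at which half a ball has exactly the measure that Chebyshev's inequality allows to {f
> h}. It dictates the choice of τ in the two integrability arguments below. -/
lemma exists_radius_eq (hn : 0 < n) {I q : ℝ} (hI : 0 < I) :
    ∃ c : ℝ, 0 < c ∧ ∀ h : ℝ, 0 < h →
      ballVol n * (c * h ^ (-(q / n))) ^ n / 2 = I * h ^ (-q) := by
  have hv := @ballVol_pos n
  have hn' : (n : ℝ) ≠ 0 := by positivity
  refine ⟨(2 * I / ballVol n) ^ ((n : ℝ)⁻¹), by positivity, fun h hh => ?_⟩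
  rw [mul_pow, ← Real.rpow_natCast, ← Real.rpow_mul (by positivity), inv_mul_cancel₀ hn',
    Real.rpow_one, ← Real.rpow_natCast (h ^ _), ← Real.rpow_mul hh.le]
  have : -(q / n) * (n : ℝ) = -q := by field_simp
  rw [this]; field_simp

lemma exists_mul_rpow_neg_le {c g e : ℝ} (hg : 0 < g) (he : 0 < e) :
    ∃ h₀ : ℝ, 1 ≤ h₀ ∧ ∀ h, h₀ ≤ h → c * h ^ (-e) ≤ g := by
  have h1 := (tendsto_rpow_neg_atTop he).const_mul c
  rw [mul_zero] at h1
  obtain ⟨h₀, h2⟩ := Filter.eventually_atTop.1 (h1.eventually (ge_mem_nhds hg))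
  exact ⟨max 1 h₀, le_max_left _ _, fun h hh => h2 h ((le_max_right _ _).trans hh)⟩

lemma Solution.lintegral_abs_lt_top (S : Solution sm sM pm pM Λ s p K Ω u) (hΩ : Ω.Nonempty) :
    ∫⁻ x in Ω, ENNReal.ofReal |u x| < ∞ := by
  have A := S.adm
  have : IsFiniteMeasure (volume.restrict Ω) := ⟨by simpa using S.bounded.measure_lt_top⟩
  -- Here Ω must be nonempty, since `sInf` of the empty set is 0.
  have hinf : pm ≤ infOn p Ω := by
    obtain ⟨x, hx⟩ := hΩ
    refine le_csInf ⟨_, (x, x), ⟨hx, hx⟩, rfl⟩ ?_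
    rintro _ ⟨z, _, rfl⟩
    exact A.p_ge _ _
  have h1 : (1 : ℝ≥0∞) ≤ ENNReal.ofReal (infOn p Ω) := by
    rw [ENNReal.one_le_ofReal]; linarith [A.pm_gt]
  have h2 := memLp_one_iff_integrable.1 (S.weak.1.2.1.mono_exponent h1)
  have h3 := h2.abs.lintegral_lt_top
  exact h3

/-- Functions in `𝕎` have locally a slightly better integrability. -/
lemma Solution.lintegral_rpow_lt_top (S : Solution sm sM pm pM Λ s p K Ω u) (hn : 0 < n)
    {x₀ : Rn n} {R p₁ p₂ ρ : ℝ} (hR1 : R ≤ 1) (hB : Metric.ball x₀ R ⊆ Ω)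
    (hp : ∀ x ∈ Metric.ball x₀ R, ∀ y ∈ Metric.ball x₀ R, p₁ ≤ p x y)
    (hp₂ : 0 < p₂) (h12 : p₂ < p₁ + sm * pm / n) (hρ : 0 ≤ ρ) (hρR : ρ < R) :
    ∫⁻ x in Metric.ball x₀ ρ, ENNReal.ofReal (|u x| ^ p₂) < ∞ := by
  have A := S.adm
  have hv := @ballVol_pos n
  have hσ := A.sigma_pos
  have hn' : (0 : ℝ) < n := by positivity
  set σ := sm * pm with hσdef
  have hum : Measurable fun x => |u x| := continuous_abs.measurable.comp S.meas
  have hΩne : Ω.Nonempty := ⟨x₀, hB (Metric.mem_ball_self (by linarith))⟩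
  have hBm : MeasurableSet (Metric.ball x₀ R) := Metric.isOpen_ball.measurableSet
  set I : ℝ := (∫⁻ x in Ω, ENNReal.ofReal |u x|).toReal + 1 with hI
  have hI0 : 0 < I := by have := @ENNReal.toReal_nonneg (∫⁻ x in Ω, ENNReal.ofReal |u x|); linarith
  have hIle : ∫⁻ x in Metric.ball x₀ R, ENNReal.ofReal (|u x| ^ (1 : ℝ)) ≤ ENNReal.ofReal I := by
    simp only [Real.rpow_one]
    refine (lintegral_mono_set hB).trans ?_
    rw [hI, ENNReal.ofReal_add ENNReal.toReal_nonneg zero_le_one,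
      ENNReal.ofReal_toReal (S.lintegral_abs_lt_top hΩne).ne]
    exact le_self_add
  obtain ⟨c, hc, hrad⟩ := exists_radius_eq (q := 1) hn hI0
  obtain ⟨h₀, hh₀, hsmall⟩ := exists_mul_rpow_neg_le (c := c) (g := R - ρ) (e := 1 / n)
    (by linarith) (by positivity)
  set E := ∫⁻ z in crossSet Ω,
    ENNReal.ofReal (|u z.1 - u z.2| ^ p z.1 z.2 / sing s p z.1 z.2) with hE
  have hEfin : E ≠ ∞ := S.weak.1.2.2.ne
  have hEle : ∫⁻ x in Metric.ball x₀ ρ, ∫⁻ y in Metric.ball x₀ R,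
      ENNReal.ofReal (|u x - u y| ^ p x y / sing s p x y) ≤ E := by
    have hm := (A.aem_modular S.meas.aemeasurable).ennreal_ofReal
    have hsub : Metric.ball x₀ ρ ×ˢ Metric.ball x₀ R ⊆ crossSet Ω := fun z hz => by
      rw [mem_crossSet]; exact Or.inr (hB hz.2)
    refine le_trans (le_of_eq ?_) (lintegral_mono_set hsub)
    rw [Measure.volume_eq_prod] at hm ⊢
    rw [← Measure.prod_restrict, lintegral_prod _ (by
      rw [Measure.prod_restrict]; exact hm.restrict)]
  refine lintegral_rpow_lt_top_of_decay Metric.isOpen_ball.measurableSet measure_ball_lt_top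
    hum (fun x => abs_nonneg _) (h₀ := h₀) (C := E.toReal * (2 / ballVol n) * c ^ σ)
    (q' := p₁ + σ / n) (by linarith) (by positivity) hp₂ h12 ?_
  -- Since u is in L¹, {|u| > h} fills at most half a ball of radius τ of order h^{-1/n}. A point
  -- with |u| > 2h differs by at least h from the points outside that set, so the finite modular
  -- bounds |{|u| > 2h}| h^{p₁} τ^{-σ}. This is decay of order h^{-(p₁+σ/n)}.
  intro h hh
  have hh0 : 0 < h := by linarith
  set τ := c * h ^ (-(1 / (n : ℝ))) with hτ
  have hτ0 : 0 < τ := by positivity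
  have hτR : τ ≤ R - ρ := hsmall h hh
  have hA : volume (Metric.ball x₀ R ∩ {x | h < |u x|}) ≤
      2⁻¹ * volume (Metric.ball (0 : Rn n) τ) := by
    rw [half_volume_ball hn hτ0.le, hrad h hh0]
    exact measure_lt_le_of_lintegral hBm hum one_pos hh0 hIle
  have hlow := measure_mul_le_lintegral x₀ hτR
    (X := Metric.ball x₀ ρ ∩ {x | 2 * h < |u x|})
    (Metric.isOpen_ball.measurableSet.inter (measurableSet_lt measurable_const hum))
    (hBm.inter (measurableSet_lt measurable_const hum)) Set.inter_subset_left hA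
    (V := ENNReal.ofReal (h ^ p₁ / (τ ^ n * τ ^ σ)))
    (H := fun x y => ENNReal.ofReal (|u x - u y| ^ p x y / sing s p x y)) (by
    rintro x ⟨hx, hxu⟩ y hy hyA hxy
    have hxu' : 2 * h < |u x| := hxu
    have hyu : |u y| ≤ h := not_lt.1 fun h' => hyA ⟨hy, h'⟩
    have hne : x ≠ y := by rintro rfl; linarith
    have ht : 0 < ‖x - y‖ := norm_pos_iff.2 (sub_ne_zero.2 hne)
    have hs0 := @sing_pos n s p x y hne
    have hdiff : h ≤ |u x - u y| := by
      have := abs_sub_abs_le_abs_sub (u x) (u y); linarith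
    apply ENNReal.ofReal_le_ofReal
    have hp1 := A.p_gt x y
    have hxB : x ∈ Metric.ball x₀ R := Metric.ball_subset_ball hρR.le hx
    have h1 : h ^ p₁ ≤ |u x - u y| ^ p x y :=
      (Real.rpow_le_rpow_of_exponent_le (by linarith) (hp x hxB y hy)).trans
        (Real.rpow_le_rpow hh0.le hdiff (by linarith))
    have h2 : sing s p x y ≤ τ ^ n * τ ^ σ := by
      unfold sing
      rw [← Real.rpow_natCast, ← Real.rpow_add hτ0]
      calc ‖x - y‖ ^ ((n : ℝ) + s x y * p x y) ≤ ‖x - y‖ ^ ((n : ℝ) + σ) := by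
            apply Real.rpow_le_rpow_of_exponent_ge ht (by linarith)
            linarith [A.sigma_le x y]
        _ ≤ _ := by gcongr
    gcongr)
  have h3 := hlow.trans hEle
  rw [half_volume_ball hn hτ0.le, ← ENNReal.ofReal_mul (by positivity),
    ← ENNReal.ofReal_toReal hEfin] at h3
  refine (ennreal_le_of_mul_le (by positivity) h3).trans (le_of_eq ?_)
  congr 1
  have e1 : τ ^ σ = c ^ σ * h ^ (-(σ / n)) := by
    rw [hτ, Real.mul_rpow hc.le (by positivity), ← Real.rpow_mul hh0.le]
    congr 2; ring
  rw [e1, neg_add, Real.rpow_add hh0, Real.rpow_neg hh0.le p₁]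
  field_simp

/-- Level set decay below large negative levels. -/
lemma level_set_decay_large (S : Solution sm sM pm pM Λ s p K Ω u) (hn : 0 < n)
    (hT : MemTail s p Ω u) {x₀ : Rn n} {R p₂ : ℝ} (hR : 0 < R) (hR1 : R ≤ 1)
    (hB : Metric.ball x₀ R ⊆ Ω)
    (hp : ∀ x ∈ Metric.ball x₀ R, ∀ y ∈ Metric.ball x₀ R, p x y ≤ p₂) :
    ∃ C : ℝ, 0 < C ∧ ∀ ρ' ρ h d D τ : ℝ, 0 ≤ ρ' → ρ' < ρ → ρ ≤ R → 1 ≤ h → 0 < d → 0 ≤ D → 0 < τ →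
      τ ≤ ρ - ρ' → (∀ x ∈ Metric.ball x₀ ρ, ∀ y ∈ Metric.ball x₀ ρ, D ≤ d ^ p x y) →
      volume (Metric.ball x₀ ρ ∩ {x | u x < -h}) ≤ 2⁻¹ * volume (Metric.ball (0 : Rn n) τ) →
      volume (Metric.ball x₀ ρ' ∩ {x | u x ≤ -h - d}) * ENNReal.ofReal (D * τ ^ (-(sm * pm))) ≤
        ENNReal.ofReal (C * (ρ - ρ') ^ (-(n + pM))) *
          ∫⁻ x in Metric.ball x₀ ρ ∩ {x | u x < -h}, ENNReal.ofReal (max (-u x) 0 ^ p₂) := by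
  have A := S.adm
  have hσ := A.sigma_pos
  have hpM := A.pM_gt
  obtain ⟨C, hC, hlev⟩ := level_set_decay n hn sm sM pm pM Λ A.sM_lt A.pm_gt A.Λ_gt
  obtain ⟨T, hT0, htail⟩ := S.tail_bound hT
  have hp₂ : 1 < p₂ :=
    (A.p_gt x₀ x₀).trans_le (hp x₀ (Metric.mem_ball_self hR) x₀ (Metric.mem_ball_self hR))
  set c : ℝ := R ^ (-pM) + T * 2 ^ (n + pM) with hc
  have hc0 : 0 < c := by positivity
  refine ⟨C * c * R ^ (-(sm * pm)), by positivity, ?_⟩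
  intro ρ' ρ h d D τ hρ' hρ hρR hh hd hD hτ hτρ hDd hvol
  have hδ : 0 < ρ - ρ' := by linarith
  have hδ1 : ρ - ρ' ≤ 1 := by linarith
  set Θ : ℝ := (ρ - ρ') ^ (-(n + pM)) with hΘ
  have hsubR : Metric.ball x₀ ρ ⊆ Metric.ball x₀ R := Metric.ball_subset_ball hρR
  -- Since h ≥ 1, the negative part is at least 1 on {u < -h}, so its p₂-th power dominates both
  -- every power p(x,y) and the first power. One weight thus serves the local term and the tail.
  have hone : ∀ x, u x < -h → 1 ≤ max (-u x) 0 := fun x hx =>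
    le_max_of_le_left (by linarith)
  have hum : Measurable fun x => max (-u x) 0 := S.meas.neg.max measurable_const
  have hΘ1 : 1 ≤ Θ := Real.one_le_rpow_of_pos_of_le_one_of_nonpos hδ hδ1 (by
    have : (0:ℝ) ≤ n := by positivity
    linarith)
  have h1 := hlev s p K Ω u S x₀ ρ' ρ R (-h) Θ
    (fun x => ENNReal.ofReal (c * max (-u x) 0 ^ p₂)) hρ' hρ hρR (hsubR.trans hB)
    ((hum.pow_const p₂).const_mul c).ennreal_ofReal (by
      calc (R / (ρ - ρ')) ^ pM ≤ (1 / (ρ - ρ')) ^ pM := by gcongr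
        _ ≤ (1 / (ρ - ρ')) ^ (n + pM) := by
            apply Real.rpow_le_rpow_of_exponent_le ((one_le_div hδ).2 hδ1)
            have : (0:ℝ) ≤ n := by positivity
            linarith
        _ = Θ := by rw [hΘ, Real.rpow_neg hδ.le, one_div, Real.inv_rpow hδ.le])
    (by
      intro x hx hxh y hy
      apply ENNReal.ofReal_le_ofReal
      have hp1 := A.p_gt x y
      have hx1 := hone x hxh
      have e1 : (-h - u x) ^ p x y ≤ max (-u x) 0 ^ p₂ := by
        calc (-h - u x) ^ p x y ≤ max (-u x) 0 ^ p x y := by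
              apply Real.rpow_le_rpow (by linarith) (le_max_of_le_left (by linarith)) (by linarith)
          _ ≤ _ := Real.rpow_le_rpow_of_exponent_le hx1 (hp x (hsubR hx) y (hsubR hy))
      have e2 : R ^ (-(s x y * p x y)) ≤ R ^ (-pM) :=
        Real.rpow_le_rpow_of_exponent_ge hR hR1 (by linarith [A.sp_le x y])
      calc _ ≤ max (-u x) 0 ^ p₂ * R ^ (-pM) := by gcongr
        _ ≤ max (-u x) 0 ^ p₂ * c := by
            gcongr; rw [hc]; have : 0 < T * 2 ^ (n + pM) := by positivity
            linarith
        _ = _ := mul_comm _ _)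
    (by
      filter_upwards [htail] with x hx hxB hxh
      have hxρ : x ∈ Metric.ball x₀ ρ := Metric.ball_subset_ball (by linarith) hxB
      have hx1 := hone x hxh
      have h2 := hx (hB (hsubR hxρ)) ((ρ - ρ') / 2) (by positivity) (by linarith)
      have h3 : ∫⁻ y in (Metric.ball x₀ ρ)ᶜ,
          ENNReal.ofReal (max (-h - u y) 0 ^ (p x y - 1) / sing s p x y) ≤
          ENNReal.ofReal (T * ((ρ - ρ') / 2) ^ (-(n + pM))) := by
        refine le_trans ?_ h2
        calc _ ≤ ∫⁻ y in (Metric.ball x₀ ρ)ᶜ,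
              ENNReal.ofReal (|u y| ^ (p x y - 1) / sing s p x y) := by
              refine lintegral_mono fun y => ENNReal.ofReal_le_ofReal ?_
              have := @sing_nonneg n s p x y
              have hp1 := A.p_gt x y
              have : 0 ≤ max (-h - u y) 0 := le_max_right _ _
              gcongr
              exact max_le (by linarith [neg_abs_le (u y)]) (abs_nonneg _)
          _ ≤ _ := by
              refine lintegral_mono_set fun y hy => ?_
              have hy' : y ∉ Metric.ball x₀ ρ := hy
              rw [Metric.mem_ball] at hy' hxB
              show (ρ - ρ') / 2 ≤ ‖x - y‖
              rw [← dist_eq_norm]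
              linarith [dist_triangle_left y x₀ x]
      calc _ ≤ ENNReal.ofReal (max (-u x) 0 ^ p₂) *
            ENNReal.ofReal (T * ((ρ - ρ') / 2) ^ (-(n + pM))) := by
            gcongr
            calc -h - u x ≤ max (-u x) 0 := le_max_of_le_left (by linarith)
              _ = max (-u x) 0 ^ (1 : ℝ) := (Real.rpow_one _).symm
              _ ≤ _ := Real.rpow_le_rpow_of_exponent_le hx1 hp₂.le
        _ = ENNReal.ofReal (T * 2 ^ (n + pM) * Θ * max (-u x) 0 ^ p₂) := by
            have : 0 ≤ max (-u x) 0 := le_max_right _ _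
            rw [← ENNReal.ofReal_mul (by positivity)]
            congr 1
            rw [hΘ, Real.div_rpow hδ.le (by norm_num), Real.rpow_neg (by norm_num : (0:ℝ) ≤ 2)]
            field_simp
        _ ≤ _ := by
            have : 0 ≤ max (-u x) 0 := le_max_right _ _
            rw [← ENNReal.ofReal_mul (by positivity)]
            apply ENNReal.ofReal_le_ofReal
            rw [← mul_assoc, mul_comm Θ c]
            gcongr
            rw [hc]; have : 0 < R ^ (-pM) := by positivity
            linarith)
    d D τ hd hD hτ hτρ (by
      intro x hx y hy
      have e1 : 1 ≤ R ^ (-(s x y * p x y)) :=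
        Real.one_le_rpow_of_pos_of_le_one_of_nonpos hR hR1 (by linarith [A.sp_pos x y])
      have e2 := hDd x hx y hy
      have e3 : 0 ≤ d ^ p x y := by positivity
      nlinarith) hvol
  have e1 : D * (R / τ) ^ (sm * pm) = D * τ ^ (-(sm * pm)) * R ^ (sm * pm) := by
    rw [Real.div_rpow hR.le hτ.le, Real.rpow_neg hτ.le]; ring
  rw [e1, ENNReal.ofReal_mul (by positivity), ← mul_assoc] at h1
  have e2 : ∫⁻ x in Metric.ball x₀ ρ ∩ {x | u x < -h}, ENNReal.ofReal (c * max (-u x) 0 ^ p₂) =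
      ENNReal.ofReal c * ∫⁻ x in Metric.ball x₀ ρ ∩ {x | u x < -h},
        ENNReal.ofReal (max (-u x) 0 ^ p₂) := by
    rw [← lintegral_const_mul' _ _ ENNReal.ofReal_ne_top]
    refine lintegral_congr fun x => ENNReal.ofReal_mul hc0.le
  rw [e2] at h1
  have e3 : ENNReal.ofReal (R ^ (sm * pm)) * ENNReal.ofReal (R ^ (-(sm * pm))) = 1 := by
    rw [← ENNReal.ofReal_mul (by positivity), ← Real.rpow_add hR, add_neg_cancel, Real.rpow_zero,
      ENNReal.ofReal_one]
  set W := ∫⁻ x in Metric.ball x₀ ρ ∩ {x | u x < -h}, ENNReal.ofReal (max (-u x) 0 ^ p₂)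
  calc _ = volume (Metric.ball x₀ ρ' ∩ {x | u x ≤ -h - d}) * ENNReal.ofReal (D * τ ^ (-(sm * pm))) *
        (ENNReal.ofReal (R ^ (sm * pm)) * ENNReal.ofReal (R ^ (-(sm * pm)))) := by rw [e3, mul_one]
    _ ≤ ENNReal.ofReal (C * Θ) * (ENNReal.ofReal c * W) * ENNReal.ofReal (R ^ (-(sm * pm))) := by
        rw [← mul_assoc]; gcongr
    _ = ENNReal.ofReal (C * Θ) * ENNReal.ofReal c * ENNReal.ofReal (R ^ (-(sm * pm))) * W := by ring
    _ = _ := by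
        rw [← ENNReal.ofReal_mul (by positivity), ← ENNReal.ofReal_mul (by positivity)]
        congr 2; ring

end Boundedness

/-! ### Bootstrap of integrability and the local lower bound -/

section LowerBound

variable {n : ℕ} {s p K : Rn n → Rn n → ℝ} {sm sM pm pM Λ : ℝ} {Ω : Set (Rn n)} {u : Rn n → ℝ}

lemma lintegral_rpow_le_of_lt {A : Set (Rn n)} (hA : MeasurableSet A) {f : Rn n → ℝ} {h q₁ q : ℝ}
    (hh : 0 < h) (hq : q₁ ≤ q) (hf : ∀ x ∈ A, h < f x) :
    ∫⁻ x in A, ENNReal.ofReal (f x ^ q₁) ≤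
      ENNReal.ofReal (h ^ (q₁ - q)) * ∫⁻ x in A, ENNReal.ofReal (f x ^ q) := by
  rw [← lintegral_const_mul' _ _ ENNReal.ofReal_ne_top]
  refine setLIntegral_mono' hA fun x hx => ?_
  rw [← ENNReal.ofReal_mul (by positivity)]
  apply ENNReal.ofReal_le_ofReal
  have hx0 : 0 < f x := hh.trans (hf x hx)
  calc f x ^ q₁ = f x ^ (q₁ - q) * f x ^ q := by
        rw [← Real.rpow_add hx0]; congr 1; ring
    _ ≤ _ := by
        exact mul_le_mul_of_nonneg_right
          (Real.rpow_le_rpow_of_nonpos hh (hf x hx).le (by linarith)) (by positivity)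

/-- Splits at height t, the higher power paying for the large values. In the De Giorgi iteration
this turns the integral of the weight into a measure; t will be a negative power of τ. -/
lemma lintegral_rpow_le_add {A : Set (Rn n)} {f : Rn n → ℝ} {t q₁ q : ℝ}
    (ht : 0 < t) (hq₁ : 0 ≤ q₁) (hq : q₁ ≤ q) (hf : ∀ x, 0 ≤ f x) :
    ∫⁻ x in A, ENNReal.ofReal (f x ^ q₁) ≤ ENNReal.ofReal (t ^ q₁) * volume A +
      ENNReal.ofReal (t ^ (q₁ - q)) * ∫⁻ x in A, ENNReal.ofReal (f x ^ q) := by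
  have h1 : ENNReal.ofReal (t ^ q₁) * volume A = ∫⁻ x in A, ENNReal.ofReal (t ^ q₁) := by simp
  rw [h1, ← lintegral_const_mul' _ _ ENNReal.ofReal_ne_top, ← lintegral_add_left measurable_const]
  refine lintegral_mono fun x => ?_
  have hx := hf x
  rw [← ENNReal.ofReal_mul (by positivity), ← ENNReal.ofReal_add (by positivity) (by positivity)]
  apply ENNReal.ofReal_le_ofReal
  rcases le_or_gt (f x) t with h | h
  · have h2 : f x ^ q₁ ≤ t ^ q₁ := Real.rpow_le_rpow hx h hq₁
    have : 0 ≤ t ^ (q₁ - q) * f x ^ q := by positivity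
    linarith
  · have h2 : f x ^ q₁ ≤ t ^ (q₁ - q) * f x ^ q := by
      have hx0 : 0 < f x := ht.trans h
      calc f x ^ q₁ = f x ^ (q₁ - q) * f x ^ q := by
            rw [← Real.rpow_add hx0]; congr 1; ring
        _ ≤ _ := by
            exact mul_le_mul_of_nonneg_right
                (Real.rpow_le_rpow_of_nonpos ht h.le (by linarith)) (by positivity)
    have : 0 ≤ t ^ q₁ := by positivity
    linarith

lemma exists_lintegral_le_ofReal {α : Type*} [MeasurableSpace α] {μ : Measure α} {f : α → ℝ≥0∞}
    (h : ∫⁻ x, f x ∂μ < ∞) : ∃ I : ℝ, 0 < I ∧ ∫⁻ x, f x ∂μ ≤ ENNReal.ofReal I := by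
  refine ⟨(∫⁻ x, f x ∂μ).toReal + 1, by positivity, ?_⟩
  rw [ENNReal.ofReal_add ENNReal.toReal_nonneg zero_le_one, ENNReal.ofReal_toReal h.ne]
  exact le_self_add

/-- One step of the bootstrap of integrability. -/
lemma Solution.lintegral_neg_part_step (S : Solution sm sM pm pM Λ s p K Ω u) (hn : 0 < n)
    (hT : MemTail s p Ω u) {x₀ : Rn n} {R p₁ p₂ q : ℝ} (hR : 0 < R) (hR1 : R ≤ 1)
    (hB : Metric.ball x₀ R ⊆ Ω)
    (hp₁ : ∀ x ∈ Metric.ball x₀ R, ∀ y ∈ Metric.ball x₀ R, p₁ ≤ p x y)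
    (hp₂ : ∀ x ∈ Metric.ball x₀ R, ∀ y ∈ Metric.ball x₀ R, p x y ≤ p₂)
    (h12 : p₂ - p₁ ≤ sm * pm / (4 * n)) (hq : p₂ ≤ q)
    (hI : ∀ ρ, 0 ≤ ρ → ρ < R →
      ∫⁻ x in Metric.ball x₀ ρ, ENNReal.ofReal (max (-u x) 0 ^ q) < ∞) {ρ : ℝ} (hρ : 0 ≤ ρ)
    (hρR : ρ < R) :
    ∫⁻ x in Metric.ball x₀ ρ, ENNReal.ofReal (max (-u x) 0 ^ (q + sm * pm / (4 * n))) < ∞ := by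
  have A := S.adm
  have hσ := A.sigma_pos
  have hn' : (0 : ℝ) < n := by positivity
  obtain ⟨C, hC, hlev⟩ := level_set_decay_large S hn hT hR hR1 hB hp₂
  have hp₂1 : 1 < p₂ := (A.p_gt x₀ x₀).trans_le
    (hp₂ x₀ (Metric.mem_ball_self hR) x₀ (Metric.mem_ball_self hR))
  have hq0 : 0 < q := by linarith
  set σ := sm * pm with hσdef
  have hum : Measurable fun x => max (-u x) 0 := S.meas.neg.max measurable_const
  set r := (ρ + R) / 2 with hr
  have hρr : ρ < r := by rw [hr]; linarith
  have hrR : r < R := by rw [hr]; linarith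
  obtain ⟨I, hI0, hIle⟩ := exists_lintegral_le_ofReal (hI r (by linarith) hrR)
  obtain ⟨c, hc, hrad⟩ := exists_radius_eq (q := q) hn hI0
  obtain ⟨h₀, hh₀, hsmall⟩ := exists_mul_rpow_neg_le (c := c) (g := r - ρ) (e := q / n)
    (by linarith) (by positivity)
  refine lintegral_rpow_lt_top_of_decay Metric.isOpen_ball.measurableSet measure_ball_lt_top
    hum (fun x => le_max_right _ _) (h₀ := h₀) (C := C * (r - ρ) ^ (-(n + pM)) * I * c ^ σ)
    (q' := q + 3 * (σ / (4 * n))) (by linarith) ?_ (by positivity) ?_ ?_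
  · have : 0 < r - ρ := by linarith
    positivity
  · have : 0 < σ / (4 * n) := by positivity
    linarith
  intro h hh
  have hh0 : 0 < h := by linarith
  have hh1 : 1 ≤ h := by linarith
  have hδ : 0 < r - ρ := by linarith
  set τ := c * h ^ (-(q / (n : ℝ))) with hτ
  have hτ0 : 0 < τ := by positivity
  have hset : {x | u x < -h} = {x | h < max (-u x) 0} := by
    ext x; simp only [Set.mem_ofPred_eq, lt_max_iff]
    constructor
    · intro h'; left; linarith
    · rintro (h' | h') <;> linarith
  have hchev := measure_lt_le_of_lintegral (Metric.isOpen_ball (x := x₀) (ε := r)).measurableSet hum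
    (by linarith : 0 < q) hh0 hIle
  have h1 := hlev ρ r h h (h ^ p₁) τ hρ hρr hrR.le hh1 hh0 (by positivity) hτ0 (hsmall h hh)
    (fun x hx y hy => Real.rpow_le_rpow_of_exponent_le hh1
      (hp₁ x (Metric.ball_subset_ball hrR.le hx) y (Metric.ball_subset_ball hrR.le hy)))
    (by rw [half_volume_ball hn hτ0.le, hrad h hh0, hset]; exact hchev)
  have hAm : MeasurableSet (Metric.ball x₀ r ∩ {x | u x < -h}) :=
    Metric.isOpen_ball.measurableSet.inter (measurableSet_lt S.meas measurable_const)
  have h2 := lintegral_rpow_le_of_lt hAm hh0 hq (f := fun x => max (-u x) 0) (by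
    rintro x ⟨_, hx⟩; rw [hset] at hx; exact hx)
  have h3 : volume (Metric.ball x₀ ρ ∩ {x | u x ≤ -h - h}) *
      ENNReal.ofReal (h ^ p₁ * τ ^ (-σ)) ≤
      ENNReal.ofReal (C * (r - ρ) ^ (-(n + pM)) * (h ^ (p₂ - q) * I)) := by
    refine h1.trans ?_
    rw [ENNReal.ofReal_mul (p := C * _) (by positivity)]
    gcongr
    refine h2.trans ?_
    rw [ENNReal.ofReal_mul (by positivity)]
    gcongr
    exact (lintegral_mono_set Set.inter_subset_left).trans hIle
  have h4 : volume (Metric.ball x₀ ρ ∩ {x | 2 * h < max (-u x) 0}) ≤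
      volume (Metric.ball x₀ ρ ∩ {x | u x ≤ -h - h}) := by
    refine measure_mono ?_
    rintro x ⟨hx, hx2⟩
    refine ⟨hx, ?_⟩
    have hx2' : 2 * h < max (-u x) 0 := hx2
    show u x ≤ -h - h
    rcases lt_max_iff.1 hx2' with h' | h' <;> linarith
  refine h4.trans ((ennreal_le_of_mul_le (by positivity) h3).trans (ENNReal.ofReal_le_ofReal ?_))
  have e1 : τ ^ (-σ) = (c ^ σ)⁻¹ * h ^ (q * σ / n) := by
    rw [hτ, Real.mul_rpow hc.le (by positivity), ← Real.rpow_mul hh0.le, Real.rpow_neg hc.le]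
    congr 2; ring
  rw [e1]
  have e2 : C * (r - ρ) ^ (-(n + pM)) * (h ^ (p₂ - q) * I) / (h ^ p₁ * ((c ^ σ)⁻¹ * h ^ (q * σ / n)))
      = C * (r - ρ) ^ (-(n + pM)) * I * c ^ σ * (h ^ (p₂ - q) * (h ^ p₁)⁻¹ * (h ^ (q * σ / n))⁻¹) := by
    field_simp
  rw [e2, ← Real.rpow_neg hh0.le, ← Real.rpow_neg hh0.le, ← Real.rpow_add hh0, ← Real.rpow_add hh0]
  have : 0 < C * (r - ρ) ^ (-(n + pM)) * I * c ^ σ := by positivity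
  refine mul_le_mul_of_nonneg_left ?_ this.le
  -- The exponent p₂ - q - p₁ - qσ/n is at most -(q + 3σ/(4n)), because p₂ - p₁ ≤ σ/(4n) and q ≥ 1.
  -- This leaves room for the power q + σ/(4n).
  apply Real.rpow_le_rpow_of_exponent_le hh1
  have e3 : σ / (4 * n) * 4 = σ / n := by field_simp
  have e4 : σ / n ≤ q * σ / n := by
    gcongr; nlinarith
  linarith

/-- The negative part of a solution is locally integrable to every power. -/
lemma Solution.lintegral_neg_part_lt_top (S : Solution sm sM pm pM Λ s p K Ω u) (hn : 0 < n)
    (hT : MemTail s p Ω u) {x₀ : Rn n} {R p₁ p₂ : ℝ} (hR : 0 < R) (hR1 : R ≤ 1)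
    (hB : Metric.ball x₀ R ⊆ Ω)
    (hp₁ : ∀ x ∈ Metric.ball x₀ R, ∀ y ∈ Metric.ball x₀ R, p₁ ≤ p x y)
    (hp₂ : ∀ x ∈ Metric.ball x₀ R, ∀ y ∈ Metric.ball x₀ R, p x y ≤ p₂)
    (h12 : p₂ - p₁ ≤ sm * pm / (4 * n)) (N : ℕ) {ρ : ℝ} (hρ : 0 ≤ ρ) (hρR : ρ < R) :
    ∫⁻ x in Metric.ball x₀ ρ,
      ENNReal.ofReal (max (-u x) 0 ^ (p₂ + N * (sm * pm / (4 * n)))) < ∞ := by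
  have A := S.adm
  have hσ := A.sigma_pos
  have hn' : (0 : ℝ) < n := by positivity
  have hp₂1 : 1 < p₂ := (A.p_gt x₀ x₀).trans_le
    (hp₂ x₀ (Metric.mem_ball_self hR) x₀ (Metric.mem_ball_self hR))
  have hpos : 0 < sm * pm / (4 * n) := by positivity
  -- Every step of the bootstrap loses some radius, so the induction treats all ρ < R at once. It
  -- starts from the higher integrability, as p₂ < p₁ + σ/n.
  induction N generalizing ρ with
  | zero =>
    have e3 : sm * pm / (4 * n) * 4 = sm * pm / n := by field_simp
    refine lt_of_le_of_lt (lintegral_mono fun x => ENNReal.ofReal_le_ofReal ?_)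
      (S.lintegral_rpow_lt_top hn hR1 hB hp₁ (by linarith : 0 < p₂) (by linarith) hρ hρR)
    simp only [Nat.cast_zero, zero_mul, add_zero]
    exact Real.rpow_le_rpow (le_max_right _ _) (max_le (neg_le_abs _) (abs_nonneg _)) (by linarith)
  | succ N ih =>
    have h1 : p₂ ≤ p₂ + N * (sm * pm / (4 * n)) := by
      have : 0 ≤ N * (sm * pm / (4 * n)) := by positivity
      linarith
    have h2 := S.lintegral_neg_part_step hn hT hR hR1 hB hp₁ hp₂ h12 h1
      (fun ρ h h' => ih h h') hρ hρR
    have e : p₂ + (N + 1 : ℕ) * (sm * pm / (4 * n)) =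
      p₂ + N * (sm * pm / (4 * n)) + sm * pm / (4 * n) := by push_cast; ring
    rw [e]; exact h2

/-- Solutions are locally bounded below. -/
lemma Solution.exists_lower_bound (S : Solution sm sM pm pM Λ s p K Ω u) (hn : 0 < n)
    (hT : MemTail s p Ω u) {x₀ : Rn n} {R p₁ p₂ : ℝ} (hR : 0 < R) (hR1 : R ≤ 1)
    (hB : Metric.ball x₀ R ⊆ Ω)
    (hp₁ : ∀ x ∈ Metric.ball x₀ R, ∀ y ∈ Metric.ball x₀ R, p₁ ≤ p x y)
    (hp₂ : ∀ x ∈ Metric.ball x₀ R, ∀ y ∈ Metric.ball x₀ R, p x y ≤ p₂)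
    (h12 : p₂ - p₁ ≤ sm * pm / (4 * n)) :
    ∃ M : ℝ, 0 < M ∧ ∀ᵐ x, x ∈ Metric.ball x₀ (R / 4) → -M ≤ u x := by
  have A := S.adm
  have hσ := A.sigma_pos
  have hpM := A.pM_gt
  have hv := @ballVol_pos n
  have hn' : (0 : ℝ) < n := by positivity
  obtain ⟨C, hC, hlev⟩ := level_set_decay_large S hn hT hR hR1 hB hp₂
  have hp₂1 : 1 < p₂ := (A.p_gt x₀ x₀).trans_le
    (hp₂ x₀ (Metric.mem_ball_self hR) x₀ (Metric.mem_ball_self hR))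
  have hum : Measurable fun x => max (-u x) 0 := S.meas.neg.max measurable_const
  -- The power q reached after N steps must satisfy n ≤ σq/(2p₂), so that τ^{σq/(2p₂)} ≤ τ^n below.
  obtain ⟨N, hN⟩ := exists_nat_ge ((2 * n * p₂ / (sm * pm)) / (sm * pm / (4 * n)))
  rw [div_le_iff₀ (by positivity)] at hN
  obtain ⟨q, hqdef⟩ : ∃ q, q = p₂ + N * (sm * pm / (4 * n)) := ⟨_, rfl⟩
  have hqp : p₂ ≤ q := by
    have : 0 ≤ N * (sm * pm / (4 * n)) := by positivity
    linarith
  have hqn : n ≤ sm * pm / (2 * p₂) * q := by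
    have h1 : 2 * n * p₂ / (sm * pm) ≤ q := by linarith
    rw [div_le_iff₀ hσ] at h1
    rw [div_mul_eq_mul_div, le_div_iff₀ (by positivity)]
    linarith
  obtain ⟨I, hI0, hIle⟩ := exists_lintegral_le_ofReal
    (S.lintegral_neg_part_lt_top hn hT hR hR1 hB hp₁ hp₂ h12 N (by positivity : 0 ≤ R / 2)
      (by linarith))
  rw [← hqdef] at hIle
  set σ := sm * pm with hσdef
  set r := R / 2 with hr
  have hr0 : 0 < r := by positivity
  obtain ⟨τ₀, hτ₀, hτ₀1, hdec⟩ := fast_geometric_decay n hn (σ := σ / 2) (N := σ / 2 + (n + 2 * pM))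
    (C := C * (r / 4) ^ (-(n + pM)) * r ^ σ * 2 ^ pM * (ballVol n / 2 + I / r ^ n))
    (by positivity) (by linarith) (by positivity)
  obtain ⟨h, hh1, hsmall⟩ := exists_mul_rpow_neg_le (c := I) (g := ballVol n * (τ₀ * r) ^ n / 2)
    (e := q) (by positivity) (by linarith)
  have hset : ∀ h : ℝ, 1 ≤ h → {x | u x < -h} = {x | h < max (-u x) 0} := by
    intro h hh
    ext x; simp only [Set.mem_ofPred_eq, lt_max_iff]
    constructor
    · intro h'; left; linarith
    · rintro (h' | h') <;> linarith
  set ρ : ℕ → ℝ := fun j => r / 2 * (1 + 2⁻¹ ^ j) with hρ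
  set k : ℕ → ℝ := fun j => h + 1 - 2⁻¹ ^ j with hk
  have hpow : ∀ j : ℕ, (0 : ℝ) < 2⁻¹ ^ j ∧ (2 : ℝ)⁻¹ ^ j ≤ 1 := fun j =>
    ⟨by positivity, pow_le_one₀ (by norm_num) (by norm_num)⟩
  have hρr : ∀ j, ρ j ≤ r := fun j => by
    have := (hpow j).2; simp only [hρ]; nlinarith
  have hgap : ∀ j, ρ j - ρ (j + 1) = r / 4 * 2⁻¹ ^ j := fun j => by
    simp only [hρ, pow_succ]; ring
  have hkstep : ∀ j, k (j + 1) = k j + 2⁻¹ ^ (j + 1) := fun j => by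
    simp only [hk, pow_succ]; ring
  have hzero := hdec r hr0 (fun j => volume (Metric.ball x₀ (ρ j) ∩ {x | u x < -k j})) ?_ ?_
    (volume (Metric.ball x₀ (R / 4) ∩ {x | u x < -(h + 1)})) ?_
  · refine ⟨h + 1, by linarith, ?_⟩
    filter_upwards [measure_eq_zero_iff_ae_notMem.1 hzero] with x hx hxB
    by_contra hcon
    exact hx ⟨hxB, not_le.1 hcon⟩
  · intro j τ hτ hτj hvol
    have hj := hpow j
    have hτ1 : τ ≤ 1 := by linarith
    have hτr : τ * r ≤ ρ j - ρ (j + 1) := by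
      rw [hgap]; nlinarith
    have hk1 : 1 ≤ k j := by simp only [hk]; linarith
    have hd := hpow (j + 1)
    have h1 := hlev (ρ (j + 1)) (ρ j) (k j) (2⁻¹ ^ (j + 1)) ((2⁻¹ ^ (j + 1)) ^ pM) (τ * r)
      (by have := (hpow (j + 1)).1; simp only [hρ]; positivity)
      (by have := hgap j; have : 0 < r / 4 * 2⁻¹ ^ j := by positivity
          linarith)
      ((hρr j).trans (by rw [hr]; linarith)) hk1 hd.1 (by positivity) (by positivity) hτr
      (fun x _ y _ => Real.rpow_le_rpow_of_exponent_ge hd.1 hd.2 (A.p_le x y))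
      (by rw [half_volume_ball hn (by positivity)]; exact hvol)
    -- With this height t^{p₂} = τ^{-σ/2} and t^{p₂-q} ≤ τ^{-σ/2} τ^n, so the integral of the weight
    -- is at most a multiple of τ^{-σ/2} (τr)^n. Half of the gain τ^{-σ} is spent here, which is why
    -- the iteration runs with σ/2.
    set t := τ ^ (-(σ / (2 * p₂))) with ht
    have ht0 : 0 < t := by positivity
    have h2 := lintegral_rpow_le_add (A := Metric.ball x₀ (ρ j) ∩ {x | u x < -k j})
      (f := fun x => max (-u x) 0) ht0 (by linarith : 0 ≤ p₂) hqp (fun x => le_max_right _ _)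
    have ht1 : t ^ p₂ = τ ^ (-(σ / 2)) := by
      rw [ht, ← Real.rpow_mul hτ.le]; congr 1; field_simp
    have ht2 : t ^ (p₂ - q) ≤ τ ^ (-(σ / 2)) * τ ^ n := by
      rw [sub_eq_add_neg, Real.rpow_add ht0, ht1]
      gcongr
      rw [ht, ← Real.rpow_mul hτ.le, ← Real.rpow_natCast]
      apply Real.rpow_le_rpow_of_exponent_ge hτ hτ1
      linarith
    have h3 : ∫⁻ x in Metric.ball x₀ (ρ j) ∩ {x | u x < -k j}, ENNReal.ofReal (max (-u x) 0 ^ p₂) ≤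
        ENNReal.ofReal (τ ^ (-(σ / 2)) * ((ballVol n / 2 + I / r ^ n) * (τ * r) ^ n)) := by
      refine h2.trans ?_
      rw [ht1]
      have e : τ ^ (-(σ / 2)) * ((ballVol n / 2 + I / r ^ n) * (τ * r) ^ n) =
          τ ^ (-(σ / 2)) * (ballVol n * (τ * r) ^ n / 2) + τ ^ (-(σ / 2)) * τ ^ n * I := by
        rw [mul_pow]; field_simp
      rw [e, ENNReal.ofReal_add (by positivity) (by positivity),
        ENNReal.ofReal_mul (by positivity), ENNReal.ofReal_mul (by positivity)]
      gcongr
      refine le_trans (lintegral_mono_set ?_) hIle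
      exact Set.inter_subset_left.trans (Metric.ball_subset_ball (hρr j))
    have h4 : volume (Metric.ball x₀ (ρ (j + 1)) ∩ {x | u x < -k (j + 1)}) *
        ENNReal.ofReal ((2⁻¹ ^ (j + 1)) ^ pM * (τ * r) ^ (-σ)) ≤
        ENNReal.ofReal (C * (ρ j - ρ (j + 1)) ^ (-(n + pM)) *
          (τ ^ (-(σ / 2)) * ((ballVol n / 2 + I / r ^ n) * (τ * r) ^ n))) := by
      have hg : 0 < ρ j - ρ (j + 1) := by rw [hgap]; positivity
      rw [ENNReal.ofReal_mul (p := C * _) (by positivity)]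
      refine le_trans ?_ (h1.trans (by gcongr))
      refine mul_le_mul' (measure_mono ?_) le_rfl
      rintro x ⟨hx, hx2⟩
      refine ⟨hx, ?_⟩
      have hx2' : u x < -k (j + 1) := hx2
      rw [hkstep] at hx2'
      show u x ≤ -k j - 2⁻¹ ^ (j + 1)
      linarith
    have h5 := ennreal_le_of_mul_le (by positivity) h4
    have hg : 0 < ρ j - ρ (j + 1) := by rw [hgap]; positivity
    refine (mul_le_mul' h5 le_rfl).trans ?_
    rw [← ENNReal.ofReal_mul (by positivity)]
    apply ENNReal.ofReal_le_ofReal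
    have e1 : (ρ j - ρ (j + 1)) ^ (-(n + pM)) = (r / 4) ^ (-(n + pM)) * 2 ^ (j * (n + pM)) := by
      rw [hgap, Real.mul_rpow (by positivity) (by positivity), ← Real.rpow_natCast,
        Real.inv_rpow (by norm_num), ← Real.rpow_neg (by norm_num), ← Real.rpow_mul (by norm_num)]
      congr 2; ring
    have e2 : ((2⁻¹ : ℝ) ^ (j + 1)) ^ pM = (2 ^ pM)⁻¹ * (2 ^ (j * pM))⁻¹ := by
      rw [← Real.rpow_natCast, Real.inv_rpow (by norm_num), ← Real.rpow_neg (by norm_num),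
        ← Real.rpow_mul (by norm_num), ← Real.rpow_neg (by norm_num), ← Real.rpow_neg (by norm_num),
        ← Real.rpow_add (by norm_num)]
      congr 1; push_cast; ring
    have e3 : (τ * r) ^ (-σ) = τ ^ (-(σ / 2)) * τ ^ (-(σ / 2)) * (r ^ σ)⁻¹ := by
      rw [Real.mul_rpow hτ.le hr0.le, ← Real.rpow_add hτ, Real.rpow_neg hr0.le]
      congr 2; ring
    have e4 : (2 : ℝ) ^ (j * (n + pM)) * 2 ^ (j * pM) ≤ 2 ^ (j * (σ / 2 + (n + 2 * pM))) := by
      rw [← Real.rpow_add (by norm_num)]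
      apply Real.rpow_le_rpow_of_exponent_le (by norm_num)
      have : 0 ≤ j * (σ / 2) := by positivity
      linarith
    rw [e1, e2, e3]
    set T := τ ^ (-(σ / 2))
    set Z := (r / 4) ^ (-((n : ℝ) + pM))
    set c₃ := ballVol n / 2 + I / r ^ n
    have hT : 0 < T := by positivity
    have hZ : 0 < Z := by positivity
    have hc₃ : 0 < c₃ := by positivity
    calc _ = C * Z * r ^ σ * 2 ^ pM * c₃ * (2 ^ (j * (n + pM)) * 2 ^ (j * pM)) * (τ * r) ^ n := by
          field_simp
      _ ≤ _ := by gcongr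
  · refine le_trans ?_ (ENNReal.ofReal_le_ofReal (hsmall h le_rfl))
    refine le_trans (measure_mono ?_) (measure_lt_le_of_lintegral
      (Metric.isOpen_ball (x := x₀) (ε := r)).measurableSet hum (by linarith : 0 < q)
      (by linarith : 0 < h) hIle)
    have e0 : k 0 = h := by simp [hk]
    rw [e0, hset h hh1]
    exact Set.inter_subset_inter_left _ (Metric.ball_subset_ball (hρr 0))
  · intro j
    refine measure_mono (Set.inter_subset_inter (Metric.ball_subset_ball ?_) ?_)
    · have := (hpow j).1; simp only [hρ, hr]; nlinarith
    · intro x hx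
      have hx' : u x < -(h + 1) := hx
      show u x < -k j
      have := (hpow j).1; simp only [hk]; linarith

end LowerBound

/-! ### Comparison of variable powers under log-Hölder continuity -/

section Comparison

/-- T^a = exp(-a log(1/T)), and log-Hölder continuity bounds exactly this product: perturbing the
exponent changes a power of the radius by a bounded factor. -/
lemma rpow_le_exp_of_abs_mul_log_le {T a c : ℝ} (hT : 0 < T) (hT1 : T ≤ 1)
    (h : |a| * Real.log (1 / T) ≤ c) : T ^ a ≤ Real.exp c := by
  rw [Real.rpow_def_of_pos hT]
  apply Real.exp_le_exp.2
  have h1 : 0 ≤ Real.log (1 / T) := Real.log_nonneg ((one_le_div hT).2 hT1)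
  have h2 : Real.log T = -Real.log (1 / T) := by rw [one_div, Real.log_inv, neg_neg]
  rw [h2]
  have := neg_abs_le a
  nlinarith

/-- The same holds for every base whose logarithm is at most log(1/T) in absolute value. This is why
the height d has to stay between r and 1/r at every scale. -/
lemma rpow_le_exp_of_mem_Icc {T d a c : ℝ} (hT : 0 < T) (hTd : T ≤ d) (hdT : d ≤ 1 / T)
    (h : |a| * Real.log (1 / T) ≤ c) : d ^ a ≤ Real.exp c := by
  have hd : 0 < d := hT.trans_le hTd
  rw [Real.rpow_def_of_pos hd]
  apply Real.exp_le_exp.2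
  have h1 : Real.log d ≤ Real.log (1 / T) := Real.log_le_log hd hdT
  have h2 : -Real.log (1 / T) ≤ Real.log d := by
    rw [one_div, Real.log_inv, neg_neg]; exact Real.log_le_log hT hTd
  have h3 : |Real.log d| ≤ Real.log (1 / T) := abs_le.2 ⟨h2, h1⟩
  calc Real.log d * a ≤ |Real.log d * a| := le_abs_self _
    _ = |a| * |Real.log d| := by rw [abs_mul, mul_comm]
    _ ≤ |a| * Real.log (1 / T) := by gcongr
    _ ≤ c := h

lemma abs_mul_sub_mul_le {s p s₀ p₀ L c P : ℝ} (hL : 0 ≤ L) (hs : 0 ≤ s) (hs1 : s ≤ 1)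
    (hp₀ : 0 ≤ p₀) (hP : p₀ ≤ P) (hp : |p - p₀| * L ≤ c) (hss : |s - s₀| * L ≤ c) :
    |s₀ * p₀ - s * p| * L ≤ (1 + P) * c := by
  have h1 : |s₀ * p₀ - s * p| ≤ |p - p₀| + P * |s - s₀| := by
    have e : s₀ * p₀ - s * p = -(s * (p - p₀)) + -(p₀ * (s - s₀)) := by ring
    rw [e]
    refine (abs_add_le _ _).trans ?_
    rw [abs_neg, abs_neg, abs_mul, abs_mul, abs_of_nonneg hs, abs_of_nonneg hp₀]
    have := abs_nonneg (p - p₀)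
    have := abs_nonneg (s - s₀)
    gcongr
    nlinarith
  have hP0 : 0 ≤ P := hp₀.trans hP
  calc _ ≤ (|p - p₀| + P * |s - s₀|) * L := by gcongr
    _ = |p - p₀| * L + P * (|s - s₀| * L) := by ring
    _ ≤ c + P * c := by gcongr
    _ = _ := by ring

/-- Under log-Hölder continuity the quantities `d^p r^{-sp}` are comparable. -/
lemma rpow_mul_rpow_le_exp_mul {s p s₀ p₀ r d c P : ℝ} (hr : 0 < r) (hr1 : r ≤ 1) (hrd : r ≤ d)
    (hdr : d ≤ 1 / r) (hs : 0 ≤ s) (hs1 : s ≤ 1) (hp₀ : 0 ≤ p₀) (hP : p₀ ≤ P)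
    (hp : |p - p₀| * Real.log (1 / r) ≤ c) (hss : |s - s₀| * Real.log (1 / r) ≤ c) :
    d ^ p * r ^ (-(s * p)) ≤ Real.exp ((2 + P) * c) * (d ^ p₀ * r ^ (-(s₀ * p₀))) := by
  have hd : 0 < d := hr.trans_le hrd
  have hL : 0 ≤ Real.log (1 / r) := Real.log_nonneg ((one_le_div hr).2 hr1)
  have h1 := rpow_le_exp_of_mem_Icc hr hrd hdr hp
  have h2 := rpow_le_exp_of_abs_mul_log_le hr hr1 (abs_mul_sub_mul_le hL hs hs1 hp₀ hP hp hss)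
  have e1 : d ^ p = d ^ (p - p₀) * d ^ p₀ := by rw [← Real.rpow_add hd]; congr 1; ring
  have e2 : r ^ (-(s * p)) = r ^ (s₀ * p₀ - s * p) * r ^ (-(s₀ * p₀)) := by
    rw [← Real.rpow_add hr]; congr 1; ring
  have e3 : Real.exp ((2 + P) * c) = Real.exp c * Real.exp ((1 + P) * c) := by
    rw [← Real.exp_add]; congr 1; ring
  rw [e1, e2, e3]
  calc _ = d ^ (p - p₀) * r ^ (s₀ * p₀ - s * p) * (d ^ p₀ * r ^ (-(s₀ * p₀))) := by ring
    _ ≤ _ := by gcongr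

/-- Pointwise bound of the tail integrand at distance `t`. -/
lemma tail_integrand_le {n : ℕ} {s p s₀ p₀ r d c P σ α ε t w : ℝ} (ht : 0 < t) (hT1 : 2 * t ≤ 1)
    (hr : 0 < r) (hrt : r ≤ 2 * t) (hα : 0 ≤ α) (hα1 : α ≤ 1) (hαP : α * P ≤ σ / 4)
    (hε : 0 ≤ ε) (hεP : ε * P ≤ σ / 4)
    (hd : 0 < d) (hrd : r ^ α ≤ d) (hdt : d ≤ 1 / (2 * t)) (hs : 0 ≤ s) (hs1 : s ≤ 1)
    (hp1 : 1 ≤ p) (hpP : p ≤ P) (hp₀ : 1 ≤ p₀) (hp₀P : p₀ ≤ P) (hσ₀ : σ ≤ s₀ * p₀)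
    (hσ : 0 ≤ σ)
    (hp : |p - p₀| * Real.log (1 / (2 * t)) ≤ c) (hss : |s - s₀| * Real.log (1 / (2 * t)) ≤ c)
    (hw : 0 ≤ w) (hwd : w ≤ 10 * d * (2 * t / r) ^ ε) :
    w ^ (p - 1) / t ^ (n + s * p) ≤
      20 ^ P * Real.exp ((2 + P) * c) * (d ^ p₀ * r ^ (-(s₀ * p₀)) / d) * r ^ (σ / 2) *
        t ^ (-(n + σ / 2)) := by
  have hT : 0 < 2 * t := by positivity
  have hL : 0 ≤ Real.log (1 / (2 * t)) := Real.log_nonneg ((one_le_div hT).2 hT1)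
  set T := 2 * t with hTdef
  -- Log-Hölder continuity is used at the scale T = 2t of the pair, not at r. In terms of X ≥ 1 the
  -- kernel gains X^{-σ}. Replacing d^p by d^{p₀} loses at most X^{σ/4}, when p < p₀, because d ≥
  -- r^α and αP ≤ σ/4; the growth of w loses another X^{σ/4}. The remaining X^{-σ/2} makes the tail
  -- integrable.
  set X := T / r with hX
  have hX1 : 1 ≤ X := (one_le_div hr).2 hrt
  have hX0 : 0 < X := by linarith
  have hrX : r = T * X⁻¹ := by rw [hX]; field_simp
  have hc0 : 0 ≤ c := le_trans (by positivity) hp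
  have hP0 : 0 ≤ P := by linarith
  have h1 : d ^ (p - p₀) ≤ Real.exp c * X ^ (σ / 4) := by
    rcases le_total p₀ p with h | h
    · have h2 : d ^ (p - p₀) ≤ Real.exp c := by
        calc d ^ (p - p₀) ≤ (1 / T) ^ (p - p₀) := Real.rpow_le_rpow hd.le hdt (by linarith)
          _ = T ^ (-(p - p₀)) := by rw [one_div, Real.inv_rpow hT.le, Real.rpow_neg hT.le]
          _ ≤ _ := rpow_le_exp_of_abs_mul_log_le hT hT1 (by rwa [abs_neg])
      have h3 : 1 ≤ X ^ (σ / 4) := Real.one_le_rpow hX1 (by positivity)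
      have := Real.exp_pos c
      nlinarith
    · have h2 : d ^ (p - p₀) ≤ (r ^ α) ^ (p - p₀) :=
        Real.rpow_le_rpow_of_nonpos (by positivity) hrd (by linarith)
      refine h2.trans ?_
      have e1 : (r ^ α) ^ (p - p₀) = T ^ (α * (p - p₀)) * X ^ (α * (p₀ - p)) := by
        rw [← Real.rpow_mul hr.le, hrX, Real.mul_rpow hT.le (by positivity),
          Real.inv_rpow hX0.le, ← Real.rpow_neg hX0.le]
        congr 2; ring
      rw [e1]
      gcongr
      · refine rpow_le_exp_of_abs_mul_log_le hT hT1 (le_trans ?_ hp)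
        rw [abs_mul, abs_of_nonneg hα]
        have := abs_nonneg (p - p₀)
        gcongr
        nlinarith
      · refine le_trans ?_ hαP
        gcongr; linarith
  have h2 : T ^ (s₀ * p₀ - s * p) ≤ Real.exp ((1 + P) * c) :=
    rpow_le_exp_of_abs_mul_log_le hT hT1
      (abs_mul_sub_mul_le hL hs hs1 (by linarith) hp₀P hp hss)
  have h3 : w ^ (p - 1) ≤ 10 ^ P * d ^ (p - 1) * X ^ (σ / 4) := by
    calc w ^ (p - 1) ≤ (10 * d * X ^ ε) ^ (p - 1) := Real.rpow_le_rpow hw hwd (by linarith)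
      _ = 10 ^ (p - 1) * d ^ (p - 1) * X ^ (ε * (p - 1)) := by
          rw [Real.mul_rpow (by positivity) (by positivity), Real.mul_rpow (by norm_num) hd.le,
            ← Real.rpow_mul hX0.le]
      _ ≤ _ := by
          have e : ε * (p - 1) ≤ σ / 4 := by
            refine le_trans ?_ hεP
            gcongr; linarith
          gcongr
          · norm_num
          · linarith
  have e1 : d ^ (p - 1) = d ^ (p - p₀) * (d ^ p₀ / d) := by
    rw [← Real.rpow_sub_one hd.ne', ← Real.rpow_add hd]; congr 1; ring
  have e2 : t ^ (-(n + s * p)) ≤ 2 ^ P * t ^ (-(n : ℝ)) * (T ^ (s₀ * p₀ - s * p) *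
      (r ^ (-(s₀ * p₀)) * X ^ (-σ))) := by
    have e3 : t = 2⁻¹ * T := by rw [hTdef]; ring
    have e4 : t ^ (-(s * p)) = 2 ^ (s * p) * T ^ (-(s * p)) := by
      rw [e3, Real.mul_rpow (by norm_num) hT.le, Real.inv_rpow (by norm_num),
        Real.rpow_neg (by norm_num), inv_inv]
    have e5 : T ^ (-(s * p)) = T ^ (s₀ * p₀ - s * p) * (r ^ (-(s₀ * p₀)) * X ^ (-(s₀ * p₀))) := by
      have : T = r * X := by rw [hX]; field_simp
      rw [← Real.mul_rpow hr.le hX0.le, ← this, ← Real.rpow_add hT]; congr 1; ring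
    rw [neg_add, Real.rpow_add ht, e4, e5]
    calc _ = 2 ^ (s * p) * t ^ (-(n : ℝ)) * (T ^ (s₀ * p₀ - s * p) *
          (r ^ (-(s₀ * p₀)) * X ^ (-(s₀ * p₀)))) := by ring
      _ ≤ _ := by
          gcongr
          · norm_num
          · nlinarith
  have hXh : X ^ (-(σ / 2)) ≤ r ^ (σ / 2) * t ^ (-(σ / 2)) := by
    have : X ^ (-(σ / 2)) ≤ (t / r) ^ (-(σ / 2)) := by
      apply Real.rpow_le_rpow_of_nonpos (by positivity) _ (by linarith)
      rw [hX]; gcongr; rw [hTdef]; linarith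
    refine this.trans (le_of_eq ?_)
    rw [Real.div_rpow ht.le hr.le, Real.rpow_neg hr.le (σ / 2)]
    field_simp
  have eX : X ^ (σ / 4) * X ^ (σ / 4) * X ^ (-σ) = X ^ (-(σ / 2)) := by
    rw [← Real.rpow_add hX0, ← Real.rpow_add hX0]; congr 1; ring
  have eE : Real.exp ((2 + P) * c) = Real.exp c * Real.exp ((1 + P) * c) := by
    rw [← Real.exp_add]; congr 1; ring
  have e20 : (20 : ℝ) ^ P = 10 ^ P * 2 ^ P := by
    rw [← Real.mul_rpow (by norm_num) (by norm_num)]; norm_num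
  rw [div_eq_mul_inv, ← Real.rpow_neg ht.le]
  calc _ ≤ (10 ^ P * (Real.exp c * X ^ (σ / 4) * (d ^ p₀ / d)) * X ^ (σ / 4)) *
        (2 ^ P * t ^ (-(n : ℝ)) * (Real.exp ((1 + P) * c) * (r ^ (-(s₀ * p₀)) * X ^ (-σ)))) := by
        refine mul_le_mul (h3.trans ?_) (e2.trans ?_) (by positivity) (by positivity)
        · rw [e1]; gcongr
        · gcongr
    _ = 20 ^ P * Real.exp ((2 + P) * c) * (d ^ p₀ * r ^ (-(s₀ * p₀)) / d) *
        (X ^ (σ / 4) * X ^ (σ / 4) * X ^ (-σ)) * t ^ (-(n : ℝ)) := by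
        rw [e20, eE]; ring
    _ ≤ 20 ^ P * Real.exp ((2 + P) * c) * (d ^ p₀ * r ^ (-(s₀ * p₀)) / d) *
        (r ^ (σ / 2) * t ^ (-(σ / 2))) * t ^ (-(n : ℝ)) := by
        rw [eX]; gcongr
    _ = _ := by
        rw [neg_add, Real.rpow_add ht]; ring

end Comparison

/-! ### Local boundedness -/

section LocalBound

variable {n : ℕ} {s p K : Rn n → Rn n → ℝ} {sm sM pm pM Λ : ℝ} {Ω : Set (Rn n)} {u : Rn n → ℝ}

lemma exists_radius_log_ge (r₀ L : ℝ) (hr₀ : 0 < r₀) :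
    ∃ R, 0 < R ∧ R ≤ r₀ ∧ L ≤ Real.log (1 / R) := by
  refine ⟨min r₀ (Real.exp (-L)), by positivity, min_le_left _ _, ?_⟩
  rw [one_div, Real.log_inv]
  have h := Real.log_le_log (by positivity) (min_le_right r₀ (Real.exp (-L)))
  rw [Real.log_exp] at h
  linarith

/-- Solutions are locally bounded. -/
lemma Solution.exists_abs_bound (S : Solution sm sM pm pM Λ s p K Ω u) (hn : 0 < n)
    (hT : MemTail s p Ω u) {c : ℝ} (hLH : LogHolder s p Ω c) {x₀ : Rn n}
    (hx₀ : x₀ ∈ Ω) :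
    ∃ ρ M : ℝ, 0 < ρ ∧ 0 < M ∧ Metric.ball x₀ ρ ⊆ Ω ∧
      ∀ᵐ x, x ∈ Metric.ball x₀ ρ → |u x| ≤ M := by
  have A := S.adm
  have hσ := A.sigma_pos
  have hn' : (0 : ℝ) < n := by positivity
  obtain ⟨r₀, hr₀, hB₀⟩ := Metric.isOpen_iff.1 S.isOpen x₀ hx₀
  -- The bounds p₂ and p₁ of p on B_R will be p(x₀,x₀) ± e, and 2e = sm·pm/(4n) is the oscillation
  -- allowed in the bootstrap. Only smallness of the oscillation is used here, not its logarithmic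
  -- rate.
  set e := sm * pm / (8 * n) with he
  have he0 : 0 < e := by positivity
  obtain ⟨R, hR, hRle, hRL⟩ := exists_radius_log_ge (min r₀ (1 / 2)) (c / e) (by positivity)
  have hB : Metric.ball x₀ R ⊆ Ω :=
    (Metric.ball_subset_ball (hRle.trans (min_le_left _ _))).trans hB₀
  have hR2 : R ≤ 1 / 2 := hRle.trans (min_le_right _ _)
  have hxx := Metric.mem_ball_self (x := x₀) hR
  have hdev : ∀ x ∈ Metric.ball x₀ R, ∀ y ∈ Metric.ball x₀ R, |p x y - p x₀ x₀| ≤ e := by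
    intro x hx y hy
    have h1 := (A.logHolder hLH hR hR2 hB hx hxx hy hxx).1
    have h2 : 0 < Real.log (1 / R) := Real.log_pos (by rw [lt_div_iff₀ hR]; linarith)
    rw [div_le_iff₀ he0] at hRL
    by_contra hcon
    have := mul_lt_mul_of_pos_right (not_le.1 hcon) h2
    linarith
  have hp₁ : ∀ x ∈ Metric.ball x₀ R, ∀ y ∈ Metric.ball x₀ R, p x₀ x₀ - e ≤ p x y :=
    fun x hx y hy => by linarith [(abs_le.1 (hdev x hx y hy)).1]
  have hp₂ : ∀ x ∈ Metric.ball x₀ R, ∀ y ∈ Metric.ball x₀ R, p x y ≤ p x₀ x₀ + e :=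
    fun x hx y hy => by linarith [(abs_le.1 (hdev x hx y hy)).2]
  have h12 : p x₀ x₀ + e - (p x₀ x₀ - e) ≤ sm * pm / (4 * n) := by
    have : sm * pm / (4 * n) = 2 * e := by rw [he]; field_simp; ring
    linarith
  obtain ⟨M₁, hM₁, hlow⟩ := S.exists_lower_bound hn hT hR (by linarith) hB hp₁ hp₂ h12
  obtain ⟨M₂, hM₂, hup⟩ := S.neg.exists_lower_bound hn hT.neg hR (by linarith) hB hp₁ hp₂ h12
  refine ⟨R / 4, max M₁ M₂, by positivity, by positivity,
    (Metric.ball_subset_ball (by linarith)).trans hB, ?_⟩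
  filter_upwards [hlow, hup] with x h1 h2 hx
  have h3 := h1 hx
  have h4 := h2 hx
  rw [abs_le]
  constructor
  · linarith [le_max_left M₁ M₂]
  · linarith [le_max_right M₁ M₂]

end LocalBound

/-! ### Exponents, oscillation bounds across scales, and the deficit in the tail -/

section Oscillation

variable {n : ℕ} {s p K : Rn n → Rn n → ℝ} {sm sM pm pM Λ : ℝ} {Ω : Set (Rn n)} {u : Rn n → ℝ}

/-- Conditions on the Hölder exponent `α`, given the gain `δ` of one oscillation step. -/
structure ExponentCond (P σ δ α ε : ℝ) : Prop where
  δ_pos : 0 < δ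
  δ_le : δ ≤ 1 / 8
  α_pos : 0 < α
  α_lt : α < 1
  α_mul : α * P ≤ σ / 4
  ε_nonneg : 0 ≤ ε
  ε_le : ε ≤ 1
  ε_mul : ε * P ≤ σ / 4
  growth : ∀ j : ℕ, ((8 : ℝ) ^ α) ^ j - 1 ≤ δ * (8 ^ ε) ^ j
  step : 1 - δ / 2 ≤ 8 ^ (-α)

/-- With α = ηε and η = δ/16, Bernoulli's inequality Y^η ≤ 1 + η(Y-1) at Y = 8^{εj} gives the growth
condition. At j = 1 it gives 8^α ≤ 1 + δ/2, and (1-δ/2)(1+δ/2) ≤ 1 gives the step condition. -/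
lemma exists_exponentCond {P σ δ : ℝ} (hP : 1 ≤ P) (hσ : 0 < σ) (hσP : σ ≤ P) (hδ : 0 < δ)
    (hδ1 : δ ≤ 1 / 8) : ∃ α ε : ℝ, ExponentCond P σ δ α ε := by
  set ε := σ / (4 * P) with hε
  have hε0 : 0 < ε := by positivity
  have hε1 : ε ≤ 1 := by rw [hε, div_le_one (by positivity)]; linarith
  have hεP : ε * P = σ / 4 := by rw [hε]; field_simp
  set η := δ / 16 with hη
  have hη0 : 0 < η := by positivity
  have hpow : ∀ j : ℕ, ((8 : ℝ) ^ (η * ε)) ^ j - 1 ≤ η * ((8 ^ ε) ^ j - 1) := by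
    intro j
    have h1 : (1 : ℝ) ≤ (8 ^ ε) ^ j := one_le_pow₀ (Real.one_le_rpow (by norm_num) hε0.le)
    have h2 := rpow_one_add_le_one_add_mul_self (s := ((8 : ℝ) ^ ε) ^ j - 1) (by linarith)
      hη0.le (by linarith : η ≤ 1)
    have h3 : ((8 : ℝ) ^ (η * ε)) ^ j = (1 + (((8 : ℝ) ^ ε) ^ j - 1)) ^ η := by
      rw [add_sub_cancel, ← Real.rpow_natCast, ← Real.rpow_natCast, ← Real.rpow_mul (by positivity),
        ← Real.rpow_mul (by positivity), ← Real.rpow_mul (by positivity)]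
      congr 1; ring
    rw [h3]; linarith
  refine ⟨η * ε, ε, hδ, hδ1, by positivity, by nlinarith, by nlinarith, hε0.le, hε1, hεP.le,
    fun j => ?_, ?_⟩
  · have h1 : (1 : ℝ) ≤ (8 ^ ε) ^ j := one_le_pow₀ (Real.one_le_rpow (by norm_num) hε0.le)
    have := hpow j
    nlinarith
  · have h1 := hpow 1
    rw [pow_one, pow_one] at h1
    have h2 : (8 : ℝ) ^ ε ≤ 8 := by
      calc (8 : ℝ) ^ ε ≤ 8 ^ (1 : ℝ) := Real.rpow_le_rpow_of_exponent_le (by norm_num) hε1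
        _ = 8 := Real.rpow_one _
    have h3 : (8 : ℝ) ^ (η * ε) ≤ 1 + δ / 2 := by nlinarith
    have h4 : (0 : ℝ) < 8 ^ (η * ε) := by positivity
    rw [Real.rpow_neg (by norm_num), ← one_div, le_div_iff₀ h4]
    nlinarith

/-- Bounds for `u` on the balls of radii `ρ 8⁻ⁱ`, `i ≤ k`, with oscillation `W θⁱ`. -/
structure OscBound (u : Rn n → ℝ) (x₀ : Rn n) (R ρ W θ : ℝ) (k : ℕ) (m : ℝ) : Prop where
  lo : -(W / 2) ≤ m
  hi : m + W * θ ^ k ≤ W / 2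
  base : ∀ᵐ y, y ∈ Metric.ball x₀ R → |u y| ≤ W / 2
  bounds : ∀ᵐ y, ∀ i ≤ k, y ∈ Metric.ball x₀ (ρ * 8⁻¹ ^ i) →
    m + W * θ ^ k - W * θ ^ i ≤ u y ∧ u y ≤ m + W * θ ^ i

/-- The interval at scale i extends that at scale k, namely [m, m+Wθ^k], equally on both sides, so
reflection preserves the structure and exchanges the roles of the two ends. -/
lemma OscBound.neg {x₀ : Rn n} {R ρ W θ m : ℝ} {k : ℕ} (h : OscBound u x₀ R ρ W θ k m) :
    OscBound (fun x => -u x) x₀ R ρ W θ k (-(m + W * θ ^ k)) := by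
  refine ⟨by linarith [h.hi], by linarith [h.lo], ?_, ?_⟩
  · simpa only [abs_neg] using h.base
  · filter_upwards [h.bounds] with y hy i hi hyi
    have := hy i hi hyi
    constructor <;> linarith

/-- The index i is that of the smallest ball of the family containing y; lying outside the next one
gives |y-x₀| ≥ ρ 8^{-(i+1)}, whence the factor 8. Index 0 also serves points outside all the balls,
where only the base bound will be available. -/
lemma exists_shell_index {x₀ y : Rn n} {ρ : ℝ} (k : ℕ)
    (hy : y ∉ Metric.ball x₀ (ρ * 8⁻¹ ^ k)) :
    ∃ i ≤ k, (i = 0 ∨ y ∈ Metric.ball x₀ (ρ * 8⁻¹ ^ i)) ∧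
      8 ^ (k - i) * (ρ * 8⁻¹ ^ k) ≤ 8 * dist y x₀ := by
  induction k with
  | zero =>
    refine ⟨0, le_rfl, Or.inl rfl, ?_⟩
    have h1 := hy
    rw [Metric.mem_ball, not_lt] at h1
    have : 0 ≤ dist y x₀ := dist_nonneg
    simp at h1 ⊢
    linarith
  | succ k ih =>
    by_cases h : y ∈ Metric.ball x₀ (ρ * 8⁻¹ ^ k)
    · refine ⟨k, by omega, Or.inr h, ?_⟩
      have h1 := hy
      rw [Metric.mem_ball, not_lt] at h1
      have e : k + 1 - k = 1 := by omega
      rw [e, pow_one]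
      linarith
    · obtain ⟨i, hi, h1, h2⟩ := ih h
      refine ⟨i, by omega, h1, ?_⟩
      have e : k + 1 - i = (k - i) + 1 := by omega
      rw [e, pow_succ, pow_succ]
      refine le_trans (le_of_eq ?_) h2
      ring

/-- On shell i the deficit is at most 2d + Wθ^i - Wθ^k, and Wθ^i - Wθ^k = Wθ^k((8^α)^{k-i} - 1) ≤
δWθ^k (8^ε)^{k-i} ≤ 8d (T/r)^ε; hence 10 = 2 + 8. The factor δ on the right is the point: in units
of d the bound does not depend on δ. -/
lemma OscBound.deficit_le {P σ δ α ε : ℝ} (E : ExponentCond P σ δ α ε) {x₀ : Rn n}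
    {R ρ W m : ℝ} {k : ℕ} (hρ : 0 < ρ) (hW : 0 < W)
    (h : OscBound u x₀ R ρ W (8 ^ (-α)) k m) :
    ∀ᵐ y, y ∈ Metric.ball x₀ R → y ∉ Metric.ball x₀ (ρ * 8⁻¹ ^ k) →
      ∀ T, dist y x₀ ≤ T → ρ * 8⁻¹ ^ k ≤ T →
      max (m + 2 * (δ * (W * (8 ^ (-α)) ^ k)) - u y) 0 ≤
        10 * (δ * (W * (8 ^ (-α)) ^ k)) * (T / (ρ * 8⁻¹ ^ k)) ^ ε := by
  set θ : ℝ := 8 ^ (-α) with hθ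
  have hθ0 : 0 < θ := by positivity
  have hδ := E.δ_pos
  filter_upwards [h.base, h.bounds] with y hb hy hyR hyk T hT hrT
  obtain ⟨i, hik, hi, hdist⟩ := exists_shell_index k hyk
  set r := ρ * 8⁻¹ ^ k with hr
  have hr0 : 0 < r := by positivity
  have hlow : m + W * θ ^ k - W * θ ^ i ≤ u y := by
    rcases hi with rfl | hi
    · have h1 := (abs_le.1 (hb hyR)).1
      have h2 := h.hi
      rw [pow_zero]; linarith
    · exact (hy i hik hi).1
  set d := δ * (W * θ ^ k) with hd
  have hd0 : 0 < d := by positivity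
  set X := T / r with hX
  have hX1 : 1 ≤ X := (one_le_div hr0).2 hrT
  have hXε : 1 ≤ X ^ ε := Real.one_le_rpow hX1 E.ε_nonneg
  have hθi : W * θ ^ i = W * θ ^ k * (8 ^ α) ^ (k - i) := by
    have e1 : θ ^ k = θ ^ i * θ ^ (k - i) := by rw [← pow_add]; congr 1; omega
    have e2 : θ ^ (k - i) * ((8 : ℝ) ^ α) ^ (k - i) = 1 := by
      rw [← mul_pow, hθ, ← Real.rpow_add (by norm_num), neg_add_cancel, Real.rpow_zero, one_pow]
    rw [e1]
    calc _ = W * θ ^ i * 1 := by ring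
      _ = _ := by rw [← e2]; ring
  have hg := E.growth (k - i)
  have h8 : ((8 : ℝ) ^ ε) ^ (k - i) ≤ 8 * X ^ ε := by
    have e1 : ((8 : ℝ) ^ ε) ^ (k - i) = (8 ^ (k - i)) ^ ε := by
      rw [← Real.rpow_natCast, ← Real.rpow_natCast, ← Real.rpow_mul (by norm_num),
        ← Real.rpow_mul (by norm_num), mul_comm]
    have e2 : (8 : ℝ) ^ (k - i) ≤ 8 * X := by
      rw [hX, mul_div_assoc', le_div_iff₀ hr0]; linarith
    have h88 : (8 : ℝ) ^ ε ≤ 8 := by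
      calc (8 : ℝ) ^ ε ≤ 8 ^ (1 : ℝ) := Real.rpow_le_rpow_of_exponent_le (by norm_num) E.ε_le
        _ = 8 := Real.rpow_one _
    rw [e1]
    calc _ ≤ (8 * X) ^ ε := Real.rpow_le_rpow (by positivity) e2 E.ε_nonneg
      _ = 8 ^ ε * X ^ ε := Real.mul_rpow (by norm_num) (by linarith)
      _ ≤ _ := by gcongr
  have hWk : 0 < W * θ ^ k := by positivity
  have h9 : W * θ ^ i - W * θ ^ k ≤ d * (8 * X ^ ε) := by
    rw [hθi]
    calc _ = W * θ ^ k * ((8 ^ α) ^ (k - i) - 1) := by ring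
      _ ≤ W * θ ^ k * (δ * (8 * X ^ ε)) := by
          gcongr; exact hg.trans (by gcongr)
      _ = _ := by rw [hd]; ring
  refine max_le ?_ (by positivity)
  nlinarith

/-- The contribution of the exterior of a fixed ball to the tails. -/
lemma Solution.exterior_tail (S : Solution sm sM pm pM Λ s p K Ω u) (hn : 0 < n)
    (hT : MemTail s p Ω u) {R W : ℝ} (hR : 0 < R) (hR1 : R ≤ 1) (hW : 1 ≤ W) :
    ∃ T₁ : ℝ, ∀ (x₀ : Rn n) (k : ℝ), k ≤ W → ∀ᵐ x, x ∈ Ω → x ∈ Metric.ball x₀ (R / 2) →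
      ∫⁻ y in (Metric.ball x₀ R)ᶜ,
        ENNReal.ofReal (max (k - u y) 0 ^ (p x y - 1) / sing s p x y) ≤ ENNReal.ofReal T₁ := by
  have A := S.adm
  have hσ := A.sigma_pos
  obtain ⟨T, hT0, htail⟩ := S.tail_bound hT
  obtain ⟨C, hC, hfar⟩ := lintegral_far hn hσ
  set g := R / 2 with hg
  have hg0 : 0 < g := by positivity
  have hg1 : g ≤ 1 := by linarith
  refine ⟨2 ^ pM * (T * g ^ (-(n + pM))) +
    2 ^ pM * W ^ pM * g ^ (-pM) * (C * g ^ (-(sm * pm))), fun x₀ k hk => ?_⟩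
  filter_upwards [htail] with x hx hxΩ hxB
  have hsub : (Metric.ball x₀ R)ᶜ ⊆ {y | g ≤ ‖x - y‖} := by
    intro y hy
    have hy' : y ∉ Metric.ball x₀ R := hy
    rw [Metric.mem_ball] at hy' hxB
    show g ≤ ‖x - y‖
    rw [← dist_eq_norm]
    linarith [dist_triangle_left y x₀ x]
  have hgm : MeasurableSet {y : Rn n | g ≤ ‖x - y‖} := by
    have hf : Measurable fun y : Rn n => ‖x - y‖ := by fun_prop
    exact measurableSet_le measurable_const hf
  have hm : Measurable fun y : Rn n => ENNReal.ofReal (2 ^ pM * W ^ pM * g ^ (-pM)) *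
      ENNReal.ofReal (‖x - y‖ ^ (-(n + sm * pm))) := by fun_prop
  calc _ ≤ ∫⁻ y in {y | g ≤ ‖x - y‖},
        ENNReal.ofReal (max (k - u y) 0 ^ (p x y - 1) / sing s p x y) := lintegral_mono_set hsub
    _ ≤ ∫⁻ y in {y | g ≤ ‖x - y‖},
        (ENNReal.ofReal (2 ^ pM) * ENNReal.ofReal (|u y| ^ (p x y - 1) / sing s p x y) +
        ENNReal.ofReal (2 ^ pM * W ^ pM * g ^ (-pM)) *
          ENNReal.ofReal (‖x - y‖ ^ (-(n + sm * pm)))) := by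
        refine setLIntegral_mono' hgm fun y hy => ?_
        have hy' : g ≤ ‖x - y‖ := hy
        have ht : 0 < ‖x - y‖ := lt_of_lt_of_le hg0 hy'
        have hp1 := A.p_gt x y
        have hs0 : 0 < sing s p x y := by unfold sing; positivity
        rw [← ENNReal.ofReal_mul (by positivity), ← ENNReal.ofReal_mul (by positivity),
          ← ENNReal.ofReal_add (by positivity) (by positivity)]
        apply ENNReal.ofReal_le_ofReal
        have h1 : max (k - u y) 0 ^ (p x y - 1) ≤ 2 ^ pM * (|u y| ^ (p x y - 1) + W ^ pM) := by
          calc _ ≤ (|u y| + W) ^ (p x y - 1) := by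
                apply Real.rpow_le_rpow (le_max_right _ _) _ (by linarith)
                refine max_le ?_ (by positivity)
                linarith [neg_abs_le (u y)]
            _ ≤ 2 ^ pM * (|u y| ^ (p x y - 1) + W ^ (p x y - 1)) :=
                rpow_add_le_mul (abs_nonneg _) (by linarith) (by linarith) (by
                  linarith [A.p_le x y])
            _ ≤ _ := by
                gcongr
                linarith [A.p_le x y]
        have h2 : (sing s p x y)⁻¹ ≤ g ^ (-pM) * ‖x - y‖ ^ (-(n + sm * pm)) := by
          unfold sing
          rw [← Real.rpow_neg ht.le]
          have e : -((n : ℝ) + s x y * p x y) = -(s x y * p x y - sm * pm) + -(n + sm * pm) := by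
            ring
          rw [e, Real.rpow_add ht]
          gcongr
          have h3 := A.sigma_le x y
          have h4 := A.sp_le x y
          calc _ ≤ g ^ (-(s x y * p x y - sm * pm)) :=
                Real.rpow_le_rpow_of_nonpos hg0 hy' (by linarith)
            _ ≤ _ := Real.rpow_le_rpow_of_exponent_ge hg0 hg1 (by linarith)
        calc _ ≤ 2 ^ pM * (|u y| ^ (p x y - 1) + W ^ pM) / sing s p x y := by gcongr
          _ = 2 ^ pM * (|u y| ^ (p x y - 1) / sing s p x y) +
              2 ^ pM * W ^ pM * (sing s p x y)⁻¹ := by ring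
          _ ≤ 2 ^ pM * (|u y| ^ (p x y - 1) / sing s p x y) +
              2 ^ pM * W ^ pM * (g ^ (-pM) * ‖x - y‖ ^ (-(n + sm * pm))) := by gcongr
          _ = _ := by ring
    _ ≤ ENNReal.ofReal (2 ^ pM) * ENNReal.ofReal (T * g ^ (-(n + pM))) +
        ENNReal.ofReal (2 ^ pM * W ^ pM * g ^ (-pM)) * ENNReal.ofReal (C * g ^ (-(sm * pm))) := by
        rw [lintegral_add_right _ hm, lintegral_const_mul' _ _ ENNReal.ofReal_ne_top,
          lintegral_const_mul' _ _ ENNReal.ofReal_ne_top]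
        gcongr
        · exact hx hxΩ g hg0 hg1
        · exact hfar x g hg0
    _ = _ := by
        rw [← ENNReal.ofReal_mul (by positivity), ← ENNReal.ofReal_mul (by positivity),
          ← ENNReal.ofReal_add (by positivity) (by positivity)]

end Oscillation

/-! ### Verification of the growth hypotheses at every scale -/

section OscillationStep

variable {n : ℕ} {s p K : Rn n → Rn n → ℝ} {sm sM pm pM Λ : ℝ} {Ω : Set (Rn n)} {u : Rn n → ℝ}

/-- The scales on which the oscillation decay runs. -/
structure ScaleCond (Ω : Set (Rn n)) (x₀ : Rn n) (σ δ R ρ W T₁ : ℝ) : Prop where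
  ρ_pos : 0 < ρ
  ρ_le : ρ ≤ R
  R_le : 3 * R ≤ 1 / 2
  R_mul : 3 * R ≤ 1 / W
  W_pos : 0 < W
  δW : 1 ≤ δ * W
  subset : Metric.ball x₀ (3 * R) ⊆ Ω
  T₁_le : T₁ ≤ ρ ^ (-(3 * σ / 4))

/-- The exterior tails of `v` are at most `T₁`. -/
def ExteriorTail (s p : Rn n → Rn n → ℝ) (x₀ : Rn n) (R W T₁ : ℝ) (v : Rn n → ℝ) : Prop :=
  ∀ k : ℝ, k ≤ W → ∀ᵐ x, x ∈ Metric.ball x₀ (R / 2) → ∫⁻ y in (Metric.ball x₀ R)ᶜ,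
    ENNReal.ofReal (max (k - v y) 0 ^ (p x y - 1) / sing s p x y) ≤ ENNReal.ofReal T₁

-- The constant C₁ is quantified before δ, α and ε, because δ will come from `growth_lemma` for this
-- C₁, and α and ε from δ. This is possible because `OscBound.deficit_le` measures the deficit in
-- units of d. The number D is d^p r^{-sp} with exponents taken at the centre.
set_option maxHeartbeats 1000000 in
lemma exists_growthHyp (n : ℕ) (hn : 0 < n) (sm pm pM c : ℝ) (hσ : 0 < sm * pm) :
    ∃ C₁ : ℝ, 0 < C₁ ∧ ∀ (sM Λ δ α ε : ℝ), ExponentCond pM (sm * pm) δ α ε →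
      ∀ (s p K : Rn n → Rn n → ℝ) (Ω : Set (Rn n)) (u : Rn n → ℝ),
      Admissible sm sM pm pM Λ s p K → LogHolder s p Ω c →
      ∀ (x₀ : Rn n) (R ρ W T₁ : ℝ), ScaleCond Ω x₀ (sm * pm) δ R ρ W T₁ →
      ExteriorTail s p x₀ R W T₁ u →
      ∀ (k : ℕ) (m : ℝ), OscBound u x₀ R ρ W (8 ^ (-α)) k m →
      ∃ D, GrowthHyp s p Ω u x₀ (ρ * 8⁻¹ ^ k) m (δ * (W * (8 ^ (-α)) ^ k)) D C₁ := by
  obtain ⟨Cf, hCf, hfar⟩ := lintegral_far (n := n) hn (σ := sm * pm / 2) (by positivity)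
  set E₀ := Real.exp ((2 + pM) * c) with hE₀
  have hE₀0 : 0 < E₀ := Real.exp_pos _
  set Ct := 20 ^ pM * E₀ * (Cf * 2 ^ (sm * pm / 2)) with hCt
  have hCt0 : 0 < Ct := by positivity
  -- E₀ pays for comparing exponents inside B_r, Ct for the tail over B_R minus B_r, and 1 for the
  -- exterior of B_R.
  refine ⟨E₀ + Ct + 1, by positivity, ?_⟩
  intro sM Λ δ α ε E s p K Ω u A hLH x₀ R ρ W T₁ Sc hext k m hO
  set σ := sm * pm with hσdef
  set θ : ℝ := 8 ^ (-α) with hθ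
  have hθ0 : 0 < θ := by positivity
  have hα := E.α_pos
  have hα1 := E.α_lt
  have hθ1 : θ ≤ 1 := Real.rpow_le_one_of_one_le_of_nonpos (by norm_num) (by linarith)
  have hρ := Sc.ρ_pos
  have hR : 0 < R := hρ.trans_le Sc.ρ_le
  have hR2 := Sc.R_le
  have hW := Sc.W_pos
  have hδ := E.δ_pos
  have hδ8 := E.δ_le
  have h8k : (8⁻¹ : ℝ) ^ k ≤ 1 := pow_le_one₀ (by norm_num) (by norm_num)
  set r := ρ * 8⁻¹ ^ k with hr
  have hr0 : 0 < r := by positivity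
  have hrρ : r ≤ ρ := by rw [hr]; nlinarith
  have hrR : r ≤ R := hrρ.trans Sc.ρ_le
  have hr1 : r ≤ 1 := by linarith
  have hθk : θ ^ k ≤ 1 := pow_le_one₀ hθ0.le hθ1
  set d := δ * (W * θ ^ k) with hd
  have hd0 : 0 < d := by positivity
  -- Since ρ ≤ 1 and δW ≥ 1, the height d = δWθ^k is at least r^α. With d ≤ W ≤ 1/(3R) this puts d
  -- in the range in which powers can be compared, at scale r and at all scales up to 3R.
  have hrα : r ^ α ≤ d := by
    have e1 : ((8⁻¹ : ℝ) ^ k) ^ α = θ ^ k := by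
      rw [hθ, ← Real.rpow_natCast, ← Real.rpow_mul (by norm_num), ← Real.rpow_natCast,
        ← Real.rpow_mul (by norm_num), Real.inv_rpow (by norm_num), ← Real.rpow_neg (by norm_num)]
      congr 1; ring
    calc r ^ α ≤ (8⁻¹ ^ k) ^ α := by
          apply Real.rpow_le_rpow hr0.le _ hα.le
          rw [hr]
          have hρ1 : ρ ≤ 1 := by linarith [Sc.ρ_le]
          exact mul_le_of_le_one_left (by positivity) hρ1
      _ = θ ^ k := e1
      _ ≤ δ * W * θ ^ k := le_mul_of_one_le_left (by positivity) Sc.δW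
      _ = d := by rw [hd]; ring
  have hrd : r ≤ d := by
    refine le_trans ?_ hrα
    calc r = r ^ (1 : ℝ) := (Real.rpow_one r).symm
      _ ≤ r ^ α := Real.rpow_le_rpow_of_exponent_ge hr0 hr1 hα1.le
  have hdW : d ≤ W := by
    rw [hd]
    have : W * θ ^ k ≤ W := by nlinarith
    have : 0 < W * θ ^ k := by positivity
    nlinarith
  have hWT : ∀ T, 0 < T → T ≤ 3 * R → W ≤ 1 / T := by
    intro T hT hT3
    rw [le_div_iff₀ hT]
    have := (le_div_iff₀ hW).1 (hT3.trans Sc.R_mul)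
    linarith
  have hdr : d ≤ 1 / r := hdW.trans (hWT r hr0 (by linarith))
  have hsubr : Metric.ball x₀ r ⊆ Ω := (Metric.ball_subset_ball (by linarith)).trans Sc.subset
  have hxx := Metric.mem_ball_self (x := x₀) hr0
  set p₀ := p x₀ x₀ with hp₀
  set s₀ := s x₀ x₀ with hs₀
  have hp₀1 : 1 < p₀ := A.p_gt _ _
  have hp₀P : p₀ ≤ pM := A.p_le _ _
  have hs₀0 : 0 ≤ s₀ := A.sm_pos.le.trans (A.s_ge _ _)
  have hs₀1 : s₀ ≤ 1 := (A.s_le _ _).trans A.sM_lt.le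
  have hσ₀ : σ ≤ s₀ * p₀ := A.sigma_le _ _
  set D := d ^ p₀ * r ^ (-(s₀ * p₀)) with hD
  have hD0 : 0 < D := by positivity
  have hDd : 0 < D / d := by positivity
  refine ⟨D, hr0, hd0, hD0, hsubr, ?_, ?_, ?_, ?_⟩
  · filter_upwards [hO.bounds] with y hy hyr
    have := (hy k le_rfl hyr).1
    linarith
  · intro x hx y hy
    have hl := A.logHolder hLH hr0 (by linarith) hsubr hxx hx hxx hy
    have h1 := rpow_mul_rpow_le_exp_mul hr0 hr1 hrd hdr hs₀0 hs₀1 (by linarith [A.p_gt x y])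
      (A.p_le x y) hl.1 hl.2
    have h2 : 0 < d ^ p x y * r ^ (-(s x y * p x y)) := by positivity
    rw [div_le_iff₀ (by positivity)]
    refine h1.trans ?_
    rw [mul_comm]
    gcongr
    linarith
  · intro x hx y hy
    have hl := A.logHolder hLH hr0 (by linarith) hsubr hx hxx hy hxx
    have h1 := rpow_mul_rpow_le_exp_mul hr0 hr1 hrd hdr (A.sm_pos.le.trans (A.s_ge x y))
      ((A.s_le x y).trans A.sM_lt.le) (by linarith) hp₀P hl.1 hl.2
    refine h1.trans ?_
    gcongr
    linarith
  · have hkW : m + 2 * d ≤ W := by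
      have h1 := hO.hi
      have h2 : d ≤ 1 / 8 * (W * θ ^ k) := by rw [hd]; gcongr
      have : 0 < W * θ ^ k := by positivity
      linarith
    -- D/d = d^{p₀-1} r^{-s₀p₀} ≥ r^{σ/4} r^{-σ}, by d ≥ r^α. The single condition T₁ ≤ ρ^{-3σ/4}
    -- therefore absorbs the exterior tail at every scale.
    have hTD : T₁ ≤ D / d := by
      refine Sc.T₁_le.trans ?_
      have e1 : D / d = d ^ (p₀ - 1) * r ^ (-(s₀ * p₀)) := by
        rw [hD, Real.rpow_sub_one hd0.ne']; ring
      rw [e1]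
      calc ρ ^ (-(3 * σ / 4)) ≤ r ^ (-(3 * σ / 4)) :=
            Real.rpow_le_rpow_of_nonpos hr0 hrρ (by linarith)
        _ = r ^ (σ / 4) * r ^ (-σ) := by rw [← Real.rpow_add hr0]; congr 1; ring
        _ ≤ d ^ (p₀ - 1) * r ^ (-(s₀ * p₀)) := by
            refine mul_le_mul ?_ ?_ (by positivity) (by positivity)
            · calc r ^ (σ / 4) ≤ r ^ (α * (p₀ - 1)) := by
                    apply Real.rpow_le_rpow_of_exponent_ge hr0 hr1
                    have := E.α_mul
                    nlinarith
                _ = (r ^ α) ^ (p₀ - 1) := Real.rpow_mul hr0.le _ _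
                _ ≤ _ := Real.rpow_le_rpow (by positivity) hrα (by linarith)
            · exact Real.rpow_le_rpow_of_exponent_ge hr0 hr1 (by linarith)
    have hdef := hO.deficit_le E hρ hW
    filter_upwards [hext _ hkW] with x hx hxB
    have hxr : dist x x₀ < r / 2 := hxB
    set B : Set (Rn n) := Metric.ball x₀ R \ Metric.ball x₀ r with hB
    have hBm : MeasurableSet B :=
      Metric.isOpen_ball.measurableSet.diff Metric.isOpen_ball.measurableSet
    have hcov : (Metric.ball x₀ r)ᶜ ⊆ B ∪ (Metric.ball x₀ R)ᶜ := by
      intro y hy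
      by_cases h : y ∈ Metric.ball x₀ R
      · exact Or.inl ⟨h, hy⟩
      · exact Or.inr h
    have hnear : ∫⁻ y in B,
        ENNReal.ofReal (max (m + 2 * d - u y) 0 ^ (p x y - 1) / sing s p x y) ≤
        ENNReal.ofReal (Ct * (D / d)) := by
      calc _ ≤ ∫⁻ y in B, ENNReal.ofReal (20 ^ pM * E₀ * (D / d) * r ^ (σ / 2)) *
            ENNReal.ofReal (‖x - y‖ ^ (-(n + σ / 2))) := by
            refine setLIntegral_mono_ae' hBm ?_
            filter_upwards [hdef] with y hy hyB
            have hyR : dist y x₀ < R := hyB.1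
            have hyr : r ≤ dist y x₀ := not_lt.1 hyB.2
            have htr1 := dist_triangle_left y x₀ x
            have htr2 := dist_triangle x x₀ y
            rw [dist_comm x₀ y] at htr2
            rw [← ENNReal.ofReal_mul (by positivity)]
            apply ENNReal.ofReal_le_ofReal
            have edist : ‖x - y‖ = dist x y := (dist_eq_norm x y).symm
            have ht : 0 < ‖x - y‖ := by rw [edist]; linarith
            have hyt : dist y x₀ < 2 * ‖x - y‖ := by rw [edist]; linarith
            have hT3 : 2 * ‖x - y‖ ≤ 3 * R := by rw [edist]; linarith
            have hT0 : 0 < 2 * ‖x - y‖ := by linarith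
            have hsubT : Metric.ball x₀ (2 * ‖x - y‖) ⊆ Ω :=
              (Metric.ball_subset_ball hT3).trans Sc.subset
            have hxT := Metric.mem_ball_self (x := x₀) hT0
            have hl := A.logHolder hLH hT0 (by linarith) hsubT
              (show x ∈ Metric.ball x₀ (2 * ‖x - y‖) by
                rw [Metric.mem_ball]; linarith) hxT (show y ∈ Metric.ball x₀ (2 * ‖x - y‖) from hyt)
              hxT
            exact tail_integrand_le ht (by linarith) hr0 (by linarith) hα.le hα1.le E.α_mul
              E.ε_nonneg E.ε_mul hd0 hrα (hdW.trans (hWT _ hT0 hT3))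
              (A.sm_pos.le.trans (A.s_ge x y)) ((A.s_le x y).trans A.sM_lt.le) (A.p_gt x y).le
              (A.p_le x y) hp₀1.le hp₀P hσ₀ hσ.le hl.1 hl.2 (le_max_right _ _)
              (hy hyB.1 hyB.2 _ hyt.le (by linarith))
        _ ≤ ENNReal.ofReal (20 ^ pM * E₀ * (D / d) * r ^ (σ / 2)) *
            ENNReal.ofReal (Cf * (r / 2) ^ (-(σ / 2))) := by
            rw [lintegral_const_mul' _ _ ENNReal.ofReal_ne_top]
            gcongr
            refine (lintegral_mono_set ?_).trans (hfar x (r / 2) (by positivity))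
            intro y hyB
            have hyr : r ≤ dist y x₀ := not_lt.1 hyB.2
            have htr1 := dist_triangle_left y x₀ x
            show r / 2 ≤ ‖x - y‖
            rw [← dist_eq_norm]; linarith
        _ = _ := by
            rw [← ENNReal.ofReal_mul (by positivity)]
            congr 1
            rw [Real.div_rpow hr0.le (by norm_num), Real.rpow_neg hr0.le,
              Real.rpow_neg (by norm_num : (0 : ℝ) ≤ 2), hCt]
            field_simp
    refine (lintegral_mono_set hcov).trans ((lintegral_union_le _ _ _).trans ?_)
    calc _ ≤ ENNReal.ofReal (Ct * (D / d)) + ENNReal.ofReal (D / d) := by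
          refine add_le_add hnear ((hx (Metric.ball_subset_ball (by linarith) hxB)).trans ?_)
          exact ENNReal.ofReal_le_ofReal hTD
      _ ≤ _ := by
          rw [← ENNReal.ofReal_add (by positivity) (by positivity)]
          apply ENNReal.ofReal_le_ofReal
          have h1 : 0 < E₀ * (D / d) := by positivity
          have h2 : (E₀ + Ct + 1) * D / d = E₀ * (D / d) + Ct * (D / d) + D / d := by ring
          linarith

end OscillationStep

/-! ### Geometric decay of the oscillation -/

section OscillationDecay

variable {n : ℕ} {s p K : Rn n → Rn n → ℝ} {sm sM pm pM Λ : ℝ} {Ω : Set (Rn n)} {u : Rn n → ℝ}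

/-- The lower end may rise by (1-θ)Wθ^k ≤ (δ/2)Wθ^k while the upper end stays fixed. The lower
bounds at the older scales are then unchanged, and their upper bounds are only relaxed. -/
lemma OscBound.step_lower {x₀ : Rn n} {R ρ W θ δ m : ℝ} {k : ℕ} (h : OscBound u x₀ R ρ W θ k m)
    (hρ : 0 < ρ) (hW : 0 < W) (hθ0 : 0 < θ) (hθ1 : θ ≤ 1) (hθ : 1 - δ / 2 ≤ θ)
    (hg : ∀ᵐ x, x ∈ Metric.ball x₀ (ρ * 8⁻¹ ^ k / 8) → m + δ * (W * θ ^ k) / 2 ≤ u x) :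
    OscBound u x₀ R ρ W θ (k + 1) (m + W * θ ^ k - W * θ ^ (k + 1)) := by
  have hWk : 0 < W * θ ^ k := by positivity
  have hstep : W * θ ^ (k + 1) = W * θ ^ k * θ := by rw [pow_succ]; ring
  have hle : W * θ ^ (k + 1) ≤ W * θ ^ k := by rw [hstep]; nlinarith
  refine ⟨by linarith [h.lo], by linarith [h.hi], h.base, ?_⟩
  filter_upwards [h.bounds, hg] with y hy hgy i hi hyi
  rcases Nat.lt_or_ge k i with hki | hki
  · have e : i = k + 1 := by omega
    subst e
    have er : ρ * (8⁻¹ : ℝ) ^ (k + 1) = ρ * 8⁻¹ ^ k / 8 := by rw [pow_succ]; ring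
    rw [er] at hyi
    have h1 := hgy hyi
    have hr : 0 < ρ * (8⁻¹ : ℝ) ^ k := by positivity
    have h2 := (hy k le_rfl (Metric.ball_subset_ball (by linarith) hyi)).2
    constructor
    · nlinarith
    · linarith
  · have h1 := hy i hki hyi
    constructor <;> linarith [h1.1, h1.2]

lemma half_le_of_not_half_le {B S : Set (Rn n)} (hS : MeasurableSet S)
    (h : ¬ 2⁻¹ * volume B ≤ volume (B ∩ S)) : 2⁻¹ * volume B ≤ volume (B \ S) := by
  by_contra hcon
  have h1 := ENNReal.add_lt_add (not_le.1 h) (not_le.1 hcon)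
  rw [measure_inter_add_sdiff B hS, ← add_mul, ENNReal.inv_two_add_inv_two, one_mul] at h1
  exact lt_irrefl _ h1

/-- Geometric decay of the oscillation on shrinking balls. -/
theorem exists_osc_decay (n : ℕ) (hn : 0 < n) (sm sM pm pM Λ c : ℝ) (hsm : 0 < sm) (hsM : sM < 1)
    (hpm : 1 < pm) (hΛ : 1 < Λ) :
    ∃ α δ : ℝ, 0 < α ∧ α < 1 ∧ 0 < δ ∧
      ∀ (s p K : Rn n → Rn n → ℝ) (Ω : Set (Rn n)) (u : Rn n → ℝ),
      Solution sm sM pm pM Λ s p K Ω u → LogHolder s p Ω c →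
      ∀ (x₀ : Rn n) (R ρ W T₁ : ℝ), ScaleCond Ω x₀ (sm * pm) δ R ρ W T₁ →
      ExteriorTail s p x₀ R W T₁ u → ExteriorTail s p x₀ R W T₁ (fun x => -u x) →
      (∀ᵐ y, y ∈ Metric.ball x₀ R → |u y| ≤ W / 2) →
      ∀ k : ℕ, ∃ m, OscBound u x₀ R ρ W (8 ^ (-α)) k m := by
  -- If the constants violate these inequalities no solution exists and any exponent serves.
  by_cases hdata : 1 ≤ pM ∧ sm * pm ≤ pM
  swap
  · refine ⟨1 / 2, 1, by norm_num, by norm_num, one_pos, fun s p K Ω u S => ?_⟩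
    exact absurd ⟨S.adm.pM_gt.le, (S.adm.sigma_le 0 0).trans (S.adm.sp_le 0 0)⟩ hdata
  have hσ : 0 < sm * pm := by positivity
  obtain ⟨C₁, hC₁, hhyp⟩ := exists_growthHyp n hn sm pm pM c hσ
  obtain ⟨δ, hδ, hδ8, hgrow⟩ := growth_lemma n hn sm sM pm pM Λ C₁ hsm hsM hpm hΛ hC₁
  obtain ⟨α, ε, E⟩ := exists_exponentCond hdata.1 hσ hdata.2 hδ hδ8
  refine ⟨α, δ, E.α_pos, E.α_lt, hδ, ?_⟩
  intro s p K Ω u S hLH x₀ R ρ W T₁ Sc hext hext' hbase k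
  have hθ0 : (0 : ℝ) < 8 ^ (-α) := by positivity
  have hθ1 : (8 : ℝ) ^ (-α) ≤ 1 :=
    Real.rpow_le_one_of_one_le_of_nonpos (by norm_num) (by linarith [E.α_pos])
  have hW := Sc.W_pos
  have hρ := Sc.ρ_pos
  induction k with
  | zero =>
    refine ⟨-(W / 2), le_rfl, by rw [pow_zero]; linarith, hbase, ?_⟩
    filter_upwards [hbase] with y hy i hi hyi
    have e : i = 0 := by omega
    subst e
    rw [pow_zero, mul_one] at hyi
    have h1 := abs_le.1 (hy (Metric.ball_subset_ball Sc.ρ_le hyi))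
    rw [pow_zero]
    constructor <;> linarith [h1.1, h1.2]
  | succ k ih =>
    obtain ⟨m, hm⟩ := ih
    set θ : ℝ := 8 ^ (-α) with hθ
    set r := ρ * (8⁻¹ : ℝ) ^ k with hr
    have hω : 0 < W * θ ^ k := by positivity
    -- Either u is above the midpoint of its range on half of B_{r/4}, or -u is above its own
    -- midpoint there.
    by_cases hhalf : 2⁻¹ * volume (Metric.ball x₀ (r / 4)) ≤
        volume (Metric.ball x₀ (r / 4) ∩ {x | m + W * θ ^ k / 2 ≤ u x})
    · obtain ⟨D, hD⟩ := hhyp sM Λ δ α ε E s p K Ω u S.adm hLH x₀ R ρ W T₁ Sc hext k m hm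
      exact ⟨_, hm.step_lower hρ hW hθ0 hθ1 E.step (hgrow s p K Ω u S x₀ r m _ D hω hD hhalf)⟩
    · obtain ⟨D, hD⟩ := hhyp sM Λ δ α ε E s p K Ω _ S.adm hLH x₀ R ρ W T₁ Sc hext' k _ hm.neg
      have hhalf' : 2⁻¹ * volume (Metric.ball x₀ (r / 4)) ≤ volume (Metric.ball x₀ (r / 4) ∩
          {x | -(m + W * θ ^ k) + W * θ ^ k / 2 ≤ -u x}) := by
        refine (half_le_of_not_half_le (measurableSet_le measurable_const S.meas)
          hhalf).trans (measure_mono ?_)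
        rintro x ⟨hx, hx2⟩
        refine ⟨hx, ?_⟩
        have hx3 : u x < m + W * θ ^ k / 2 := not_le.1 hx2
        show -(m + W * θ ^ k) + W * θ ^ k / 2 ≤ -u x
        linarith
      have h1 := hm.neg.step_lower hρ hW hθ0 hθ1 E.step
        (hgrow s p K Ω _ S.neg x₀ r _ _ D hω hD hhalf')
      have h2 := h1.neg
      simp only [neg_neg] at h2
      exact ⟨_, h2⟩

/-- Uniform decay of the oscillation near each point of `Ω`. -/
theorem exists_local_osc_decay (n : ℕ) (hn : 0 < n) (sm sM pm pM Λ c : ℝ) (hsm : 0 < sm)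
    (hsM : sM < 1) (hpm : 1 < pm) (hΛ : 1 < Λ) :
    ∃ α : ℝ, 0 < α ∧ α < 1 ∧
      ∀ (s p K : Rn n → Rn n → ℝ) (Ω : Set (Rn n)) (u : Rn n → ℝ),
      Solution sm sM pm pM Λ s p K Ω u → LogHolder s p Ω c → MemTail s p Ω u →
      ∀ z ∈ Ω, ∃ R ρ W : ℝ, 0 < R ∧ 0 < ρ ∧ 0 < W ∧ ∀ x₀ ∈ Metric.ball z R, ∀ k : ℕ, ∃ m : ℝ,
        ∀ᵐ y, y ∈ Metric.ball x₀ (ρ * 8⁻¹ ^ k) → |u y - m| ≤ W * (8 ^ (-α)) ^ k := by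
  obtain ⟨α, δ, hα, hα1, hδ, hosc⟩ := exists_osc_decay n hn sm sM pm pM Λ c hsm hsM hpm hΛ
  refine ⟨α, hα, hα1, ?_⟩
  intro s p K Ω u S hLH hT z hz
  have hσ := S.adm.sigma_pos
  obtain ⟨ρ₀, M, hρ₀, hM, hB, hbd⟩ := S.exists_abs_bound hn hT hLH hz
  -- This gives W/2 ≥ M for the base bound and δW ≥ 1 for the lower bound on d. The radius R is
  -- chosen after W, with 3RW ≤ 1.
  set W := 2 * M + 1 / δ + 1 with hW
  have hδ' : 0 < 1 / δ := by positivity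
  have hW1 : 1 ≤ W := by rw [hW]; linarith
  have hW0 : 0 < W := by linarith
  set R := min (ρ₀ / 4) (min (1 / 6) (1 / (3 * W))) with hR
  have hR0 : 0 < R := by positivity
  have hR1 : R ≤ ρ₀ / 4 := min_le_left _ _
  have hR2 : R ≤ 1 / 6 := (min_le_right _ _).trans (min_le_left _ _)
  have hR3 : R ≤ 1 / (3 * W) := (min_le_right _ _).trans (min_le_right _ _)
  obtain ⟨Ta, hTa⟩ := S.exterior_tail hn hT hR0 (by linarith) hW1
  obtain ⟨Tb, hTb⟩ := S.neg.exterior_tail hn hT.neg hR0 (by linarith) hW1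
  -- The exterior tail bounds depend on R and W but not on ρ, so ρ can be taken small afterwards.
  -- They are also uniform in the centre x₀.
  obtain ⟨h₀, hh₀, hsmall⟩ := exists_mul_rpow_neg_le (c := max Ta Tb) (g := 1)
    (e := 3 * (sm * pm) / 4) one_pos (by positivity)
  set ρ := min R (1 / h₀) with hρ
  have hρ0 : 0 < ρ := by positivity
  have hTρ : max Ta Tb ≤ ρ ^ (-(3 * (sm * pm) / 4)) := by
    have h1 : h₀ ≤ 1 / ρ := by
      rw [le_div_iff₀ hρ0]
      have := min_le_right R (1 / h₀)
      rw [← hρ, le_div_iff₀ (by linarith)] at this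
      linarith
    have h2 := hsmall _ h1
    rw [one_div, Real.inv_rpow hρ0.le] at h2
    rwa [← div_eq_mul_inv, div_le_one (by positivity)] at h2
  refine ⟨R, ρ, W, hR0, hρ0, hW0, fun x₀ hx₀ k => ?_⟩
  have hx₀' : dist x₀ z < R := hx₀
  have hsub : Metric.ball x₀ (3 * R) ⊆ Metric.ball z ρ₀ :=
    Metric.ball_subset_ball' (by linarith)
  have Sc : ScaleCond Ω x₀ (sm * pm) δ R ρ W (max Ta Tb) := by
    refine ⟨hρ0, min_le_left _ _, by linarith, ?_, hW0, ?_, hsub.trans hB, hTρ⟩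
    · rw [le_div_iff₀ (by positivity)] at hR3 ⊢; linarith
    · rw [hW]
      have : δ * (1 / δ) = 1 := by field_simp
      nlinarith
  have hsubR : Metric.ball x₀ (R / 2) ⊆ Ω :=
    (Metric.ball_subset_ball (by linarith)).trans (hsub.trans hB)
  obtain ⟨m, hm⟩ := hosc s p K Ω u S hLH x₀ R ρ W _ Sc
    (fun k hk => by
      filter_upwards [hTa x₀ k hk] with x hx hxB
      exact (hx (hsubR hxB) hxB).trans (ENNReal.ofReal_le_ofReal (le_max_left _ _)))
    (fun k hk => by
      filter_upwards [hTb x₀ k hk] with x hx hxB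
      exact (hx (hsubR hxB) hxB).trans (ENNReal.ofReal_le_ofReal (le_max_right _ _)))
    (by
      filter_upwards [hbd] with y hy hyR
      refine (hy (hsub (Metric.ball_subset_ball (by linarith) hyR))).trans ?_
      rw [hW]; linarith) k
  refine ⟨m, ?_⟩
  filter_upwards [hm.bounds] with y hy hyk
  have h1 := hy k le_rfl hyk
  have : 0 < W * ((8 : ℝ) ^ (-α)) ^ k := by positivity
  rw [abs_le]
  constructor <;> linarith [h1.1, h1.2]

end OscillationDecay

/-! ### From decay of oscillation to a Hölder continuous representative -/

section Regularity

open Filter Topology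

variable {n : ℕ} {s p K : Rn n → Rn n → ℝ} {Ω : Set (Rn n)} {u : Rn n → ℝ}

/-- Decay of the oscillation on balls gives Hölder continuity off a null set. -/
lemma exists_holder_off_null {z : Rn n} {R ρ W α : ℝ} (hα : 0 < α) (hR : 0 < R) (hρ : 0 < ρ)
    (hW : 0 < W) (h : ∀ x₀ ∈ Metric.ball z R, ∀ k : ℕ, ∃ m : ℝ,
      ∀ᵐ y, y ∈ Metric.ball x₀ (ρ * 8⁻¹ ^ k) → |u y - m| ≤ W * (8 ^ (-α)) ^ k) :
    ∃ r C : ℝ, 0 < r ∧ 0 ≤ C ∧ ∃ G : Set (Rn n), (∀ᵐ x, x ∈ G) ∧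
      ∀ x ∈ Metric.ball z r ∩ G, ∀ y ∈ Metric.ball z r ∩ G, |u x - u y| ≤ C * dist x y ^ α := by
  choose! m hm using h
  -- The null set in the hypothesis depends on the centre and on k. Restricting to countably many
  -- centres leaves a single null set.
  set D := TopologicalSpace.denseSeq (Rn n) with hD
  have hae : ∀ᵐ y, ∀ i k : ℕ, D i ∈ Metric.ball z R → y ∈ Metric.ball (D i) (ρ * 8⁻¹ ^ k) →
      |u y - m (D i) k| ≤ W * (8 ^ (-α)) ^ k := by
    rw [ae_all_iff]; intro i
    rw [ae_all_iff]; intro k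
    by_cases hi : D i ∈ Metric.ball z R
    · filter_upwards [hm _ hi k] with y hy _ using hy
    · exact Eventually.of_forall fun y h => absurd h hi
  refine ⟨min R (ρ / 4), 2 * W * 8 ^ α * (2 / ρ) ^ α, by positivity, by positivity, _, hae, ?_⟩
  rintro x ⟨hx, hxG⟩ y ⟨hy, hyG⟩
  rcases eq_or_ne x y with rfl | hne
  · simp only [sub_self, abs_zero]; positivity
  have ht : 0 < dist x y := dist_pos.2 hne
  have hxz : dist x z < min R (ρ / 4) := hx
  have hyz : dist y z < min R (ρ / 4) := hy
  have htρ : 2 * dist x y / ρ ≤ 1 := by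
    rw [div_le_one hρ]
    linarith [dist_triangle_right x y z, min_le_right R (ρ / 4)]
  -- The radius ρ 8^{-k} is at least 2|x-y| and less than 16|x-y|. A dense centre within half that
  -- radius of x has both points in its ball.
  obtain ⟨k, hk1, hk2⟩ := exists_nat_pow_near_of_lt_one (y := (8⁻¹ : ℝ))
    (by positivity : 0 < 2 * dist x y / ρ) htρ (by norm_num) (by norm_num)
  rw [div_le_iff₀ hρ] at hk2
  have hrk : 0 < ρ * (8⁻¹ : ℝ) ^ k / 2 := by positivity
  obtain ⟨i, hi⟩ := (TopologicalSpace.denseRange_denseSeq (Rn n)).exists_mem_open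
    (Metric.isOpen_ball.inter Metric.isOpen_ball :
      IsOpen (Metric.ball x (ρ * 8⁻¹ ^ k / 2) ∩ Metric.ball z R))
    ⟨x, Metric.mem_ball_self hrk, hxz.trans_le (min_le_left _ _)⟩
  have hix : dist (D i) x < ρ * 8⁻¹ ^ k / 2 := hi.1
  have h1 := hxG i k hi.2 (by rw [Metric.mem_ball, dist_comm]; linarith)
  have h2 := hyG i k hi.2 (by
    rw [Metric.mem_ball, dist_comm]
    linarith [dist_triangle (D i) x y])
  have h3 : |u x - u y| ≤ 2 * (W * (8 ^ (-α)) ^ k) := by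
    rw [abs_le] at h1 h2 ⊢
    constructor <;> linarith [h1.1, h1.2, h2.1, h2.2]
  refine h3.trans ?_
  have h4 : ((8 : ℝ) ^ (-α)) ^ k ≤ 8 ^ α * ((2 / ρ) ^ α * dist x y ^ α) := by
    have e1 : ((8 : ℝ) ^ (-α)) ^ k = 8 ^ α * (8⁻¹ ^ (k + 1)) ^ α := by
      rw [← Real.rpow_natCast, ← Real.rpow_natCast, ← Real.rpow_mul (by norm_num),
        ← Real.rpow_mul (by norm_num), Real.inv_rpow (by norm_num), ← Real.rpow_neg (by norm_num),
        ← Real.rpow_add (by norm_num)]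
      congr 1; push_cast; ring
    rw [e1, ← Real.mul_rpow (by positivity) ht.le]
    gcongr
    refine hk1.le.trans (le_of_eq ?_)
    ring
  calc _ ≤ 2 * (W * (8 ^ α * ((2 / ρ) ^ α * dist x y ^ α))) := by gcongr
    _ = _ := by ring

/-- Local Hölder continuity off null sets, with one null set for all points of `Ω`. -/
lemma exists_common_full_set {α : ℝ} (h : ∀ z ∈ Ω, ∃ r C : ℝ, 0 < r ∧ 0 ≤ C ∧
      ∃ G : Set (Rn n), (∀ᵐ x, x ∈ G) ∧
      ∀ x ∈ Metric.ball z r ∩ G, ∀ y ∈ Metric.ball z r ∩ G, |u x - u y| ≤ C * dist x y ^ α) :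
    ∃ G : Set (Rn n), (∀ᵐ x, x ∈ G) ∧ ∀ z ∈ Ω, ∃ r C : ℝ, 0 < r ∧ 0 ≤ C ∧
      ∀ x ∈ Metric.ball z r ∩ G, ∀ y ∈ Metric.ball z r ∩ G, |u x - u y| ≤ C * dist x y ^ α := by
  choose! r C hr hC G hG hu using h
  obtain ⟨t, ht, htc, hcov⟩ := TopologicalSpace.countable_cover_nhdsWithin
    (f := fun z => Metric.ball z (r z)) (s := Ω)
    (fun z hz => mem_nhdsWithin_of_mem_nhds (Metric.ball_mem_nhds z (hr z hz)))
  refine ⟨⋂ z ∈ t, G z, ?_, fun z hz => ?_⟩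
  · simp only [Set.mem_iInter]
    exact (ae_ball_iff htc).2 fun z hz => hG z (ht hz)
  · obtain ⟨w, hw, hzw⟩ := Set.mem_iUnion₂.1 (hcov hz)
    obtain ⟨e, he, hsub⟩ := Metric.isOpen_iff.1 Metric.isOpen_ball z hzw
    refine ⟨e, C w, he, hC w (ht hw), ?_⟩
    rintro x ⟨hx, hxG⟩ y ⟨hy, hyG⟩
    exact hu w (ht hw) x ⟨hsub hx, Set.mem_iInter₂.1 hxG w hw⟩ y
      ⟨hsub hy, Set.mem_iInter₂.1 hyG w hw⟩

lemma exists_tendsto_of_holder {α r C : ℝ} (hα : 0 < α) {G : Set (Rn n)} {z : Rn n} (hr : 0 < r)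
    (hC : 0 ≤ C) (hz : z ∈ closure G) (h : ∀ x ∈ Metric.ball z r ∩ G, ∀ y ∈ Metric.ball z r ∩ G,
      |u x - u y| ≤ C * dist x y ^ α) :
    ∃ l : ℝ, Tendsto u (𝓝[G] z) (𝓝 l) := by
  have : NeBot (𝓝[G] z) := mem_closure_iff_nhdsWithin_neBot.1 hz
  have hcauchy : Cauchy (map u (𝓝[G] z)) := by
    rw [Metric.cauchy_iff]
    refine ⟨this.map u, fun ε hε => ?_⟩
    have hc : Continuous fun η : ℝ => C * (2 * η) ^ α :=
      continuous_const.mul ((continuous_const.mul continuous_id).rpow_const fun _ => Or.inr hα.le)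
    have h0 : C * (2 * 0) ^ α < ε := by
      rw [mul_zero, Real.zero_rpow hα.ne', mul_zero]; exact hε
    obtain ⟨e, he, hsmall⟩ := Metric.eventually_nhds_iff.1 ((hc.tendsto 0).eventually_lt_const h0)
    set η := min (e / 2) r with hη
    have hη0 : 0 < η := by positivity
    refine ⟨u '' (Metric.ball z η ∩ G), image_mem_map (inter_mem
      (mem_nhdsWithin_of_mem_nhds (Metric.ball_mem_nhds z hη0)) self_mem_nhdsWithin), ?_⟩
    rintro _ ⟨x, hx, rfl⟩ _ ⟨y, hy, rfl⟩
    have hxz : dist x z < η := hx.1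
    have hyz : dist y z < η := hy.1
    have hsub : Metric.ball z η ⊆ Metric.ball z r := Metric.ball_subset_ball (min_le_right _ _)
    rw [Real.dist_eq]
    calc |u x - u y| ≤ C * dist x y ^ α := h x ⟨hsub hx.1, hx.2⟩ y ⟨hsub hy.1, hy.2⟩
      _ ≤ C * (2 * η) ^ α := by
          gcongr; linarith [dist_triangle_right x y z]
      _ < ε := hsmall (by
          rw [Real.dist_eq, sub_zero, abs_of_pos hη0]; linarith [min_le_left (e / 2) r])
  obtain ⟨l, hl⟩ := cauchy_iff_exists_le_nhds.1 hcauchy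
  exact ⟨l, hl⟩

/-- A function that is locally Hölder continuous on a set of full measure has a locally Hölder
continuous representative. -/
lemma exists_representative {α : ℝ} (hα : 0 < α) (hΩ : IsOpen Ω) {G : Set (Rn n)}
    (hG : ∀ᵐ x, x ∈ G) (h : ∀ z ∈ Ω, ∃ r C : ℝ, 0 < r ∧ 0 ≤ C ∧
      ∀ x ∈ Metric.ball z r ∩ G, ∀ y ∈ Metric.ball z r ∩ G, |u x - u y| ≤ C * dist x y ^ α) :
    ∃ v : Rn n → ℝ, (∀ x ∈ Ω, x ∈ G → u x = v x) ∧ ∀ z ∈ Ω, ∃ r C : ℝ, 0 < r ∧ 0 ≤ C ∧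
      ∀ x ∈ Metric.ball z r, ∀ y ∈ Metric.ball z r, |v x - v y| ≤ C * dist x y ^ α := by
  -- A set of full measure is dense, so u extends from G by limits, and the Hölder estimate passes
  -- to the limit in both variables.
  have hdense : Dense G := Measure.dense_of_ae hG
  have hlim : ∀ z ∈ Ω, Tendsto u (𝓝[G] z) (𝓝 (extendFrom G u z)) := fun z hz => by
    obtain ⟨r, C, hr, hC, hu⟩ := h z hz
    exact tendsto_extendFrom (exists_tendsto_of_holder hα hr hC (hdense z) hu)
  refine ⟨extendFrom G u, fun x hx hxG => ?_, fun z hz => ?_⟩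
  · have h1 : Tendsto u (pure x) (𝓝 (extendFrom G u x)) :=
      (hlim x hx).mono_left (pure_le_nhdsWithin hxG)
    exact tendsto_nhds_unique (tendsto_pure_nhds u x) h1
  · obtain ⟨r, C, hr, hC, hu⟩ := h z hz
    obtain ⟨e, he, hsub⟩ := Metric.isOpen_iff.1 hΩ z hz
    refine ⟨min r e, C, by positivity, hC, fun x hx y hy => ?_⟩
    have hxr := Metric.ball_subset_ball (min_le_left r e) hx
    have hyr := Metric.ball_subset_ball (min_le_left r e) hy
    have hx1 := hlim x (hsub (Metric.ball_subset_ball (min_le_right r e) hx))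
    have hy1 := hlim y (hsub (Metric.ball_subset_ball (min_le_right r e) hy))
    have : NeBot (𝓝[G] x) := mem_closure_iff_nhdsWithin_neBot.1 (hdense x)
    have : NeBot (𝓝[G] y) := mem_closure_iff_nhdsWithin_neBot.1 (hdense y)
    have t1 : Tendsto (fun w : Rn n × Rn n => |u w.1 - u w.2|) (𝓝[G] x ×ˢ 𝓝[G] y)
        (𝓝 |extendFrom G u x - extendFrom G u y|) :=
      ((hx1.comp tendsto_fst).sub (hy1.comp tendsto_snd)).abs
    have t2 : Tendsto (fun w : Rn n × Rn n => C * dist w.1 w.2 ^ α) (𝓝[G] x ×ˢ 𝓝[G] y)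
        (𝓝 (C * dist x y ^ α)) := by
      have hc : Continuous fun w : Rn n × Rn n => C * dist w.1 w.2 ^ α :=
        continuous_const.mul (continuous_dist.rpow_const fun _ => Or.inr hα.le)
      refine (hc.tendsto (x, y)).mono_left ?_
      rw [nhds_prod_eq]
      exact Filter.prod_mono nhdsWithin_le_nhds nhdsWithin_le_nhds
    refine le_of_tendsto_of_tendsto t1 t2 ?_
    have m1 : Metric.ball z r ∩ G ∈ 𝓝[G] x :=
      inter_mem (mem_nhdsWithin_of_mem_nhds (Metric.isOpen_ball.mem_nhds hxr)) self_mem_nhdsWithin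
    have m2 : Metric.ball z r ∩ G ∈ 𝓝[G] y :=
      inter_mem (mem_nhdsWithin_of_mem_nhds (Metric.isOpen_ball.mem_nhds hyr)) self_mem_nhdsWithin
    filter_upwards [prod_mem_prod m1 m2] with w hw
    exact hu _ hw.1 _ hw.2

lemma holderOnWith_of_abs_le {v : Rn n → ℝ} {Q : Set (Rn n)} {C : ℝ} {α : ℝ≥0}
    (h : ∀ x ∈ Q, ∀ y ∈ Q, |v x - v y| ≤ C * dist x y ^ (α : ℝ)) :
    HolderOnWith C.toNNReal α v Q := by
  intro x hx y hy
  have h1 := h x hx y hy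
  rw [edist_dist, edist_dist, ENNReal.ofReal_rpow_of_nonneg dist_nonneg α.coe_nonneg,
    Real.dist_eq]
  calc ENNReal.ofReal |v x - v y| ≤ ENNReal.ofReal (C * dist x y ^ (α : ℝ)) :=
        ENNReal.ofReal_le_ofReal h1
    _ ≤ _ := by
        rw [ENNReal.ofReal_mul' (by positivity)]; rfl

/-- Local Hölder continuity is uniform on compact sets. -/
lemma exists_holderOnWith_of_isCompact {v : Rn n → ℝ} {α : ℝ≥0} {Q : Set (Rn n)}
    (hQ : IsCompact Q) (h : ∀ z ∈ Q, ∃ r C : ℝ, 0 < r ∧ 0 ≤ C ∧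
      ∀ x ∈ Metric.ball z r, ∀ y ∈ Metric.ball z r, |v x - v y| ≤ C * dist x y ^ (α : ℝ)) :
    ∃ C : ℝ≥0, HolderOnWith C α v Q := by
  -- This property is stable under finite unions: y ranges over the whole space, so close pairs in
  -- different pieces are covered. Pairs at distance at least δ are handled by the bound B.
  have key : ∃ δ C B : ℝ, 0 < δ ∧ 0 ≤ C ∧ 0 ≤ B ∧ ∀ x ∈ Q, |v x| ≤ B ∧
      ∀ y, dist x y < δ → |v x - v y| ≤ C * dist x y ^ (α : ℝ) := by
    refine hQ.induction_on (p := fun S => ∃ δ C B : ℝ, 0 < δ ∧ 0 ≤ C ∧ 0 ≤ B ∧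
      ∀ x ∈ S, |v x| ≤ B ∧ ∀ y, dist x y < δ → |v x - v y| ≤ C * dist x y ^ (α : ℝ)) ?_ ?_ ?_ ?_
    · exact ⟨1, 0, 0, one_pos, le_rfl, le_rfl, by simp⟩
    · rintro S T hST ⟨δ, C, B, h1, h2, h3, h4⟩
      exact ⟨δ, C, B, h1, h2, h3, fun x hx => h4 x (hST hx)⟩
    · rintro S T ⟨δ, C, B, h1, h2, h3, h4⟩ ⟨δ', C', B', h1', h2', h3', h4'⟩
      refine ⟨min δ δ', max C C', max B B', lt_min h1 h1', le_max_of_le_left h2,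
        le_max_of_le_left h3, ?_⟩
      rintro x (hx | hx)
      · refine ⟨(h4 x hx).1.trans (le_max_left _ _), fun y hy => ?_⟩
        refine ((h4 x hx).2 y (hy.trans_le (min_le_left _ _))).trans ?_
        gcongr; exact le_max_left _ _
      · refine ⟨(h4' x hx).1.trans (le_max_right _ _), fun y hy => ?_⟩
        refine ((h4' x hx).2 y (hy.trans_le (min_le_right _ _))).trans ?_
        gcongr; exact le_max_right _ _
    · intro z hz
      obtain ⟨r, C, hr, hC, hv⟩ := h z hz
      refine ⟨Metric.ball z (r / 2),
        mem_nhdsWithin_of_mem_nhds (Metric.ball_mem_nhds z (by positivity)),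
        r / 2, C, |v z| + C * r ^ (α : ℝ), by positivity, hC, by positivity, fun x hx => ?_⟩
      have hxz : dist x z < r / 2 := hx
      have hxr : x ∈ Metric.ball z r := Metric.ball_subset_ball (by linarith) hx
      refine ⟨?_, fun y hy => hv x hxr y ?_⟩
      · have h1 := hv x hxr z (Metric.mem_ball_self hr)
        have h2 : C * dist x z ^ (α : ℝ) ≤ C * r ^ (α : ℝ) := by
          gcongr; linarith
        have h3 := abs_sub_abs_le_abs_sub (v x) (v z)
        linarith
      · rw [Metric.mem_ball]
        linarith [dist_triangle_left y z x]
  obtain ⟨δ, C, B, hδ, hC, hB, hv⟩ := key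
  refine ⟨_, holderOnWith_of_abs_le (C := C + 2 * B / δ ^ (α : ℝ)) fun x hx y hy => ?_⟩
  rcases lt_or_ge (dist x y) δ with hd | hd
  · refine ((hv x hx).2 y hd).trans ?_
    gcongr
    have : 0 ≤ 2 * B / δ ^ (α : ℝ) := by positivity
    linarith
  · have h1 : |v x - v y| ≤ 2 * B := by
      have := abs_sub (v x) (v y)
      linarith [(hv x hx).1, (hv y hy).1]
    refine h1.trans ?_
    have h2 : δ ^ (α : ℝ) ≤ dist x y ^ (α : ℝ) :=
      Real.rpow_le_rpow hδ.le hd α.coe_nonneg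
    have h3 : 2 * B ≤ 2 * B / δ ^ (α : ℝ) * dist x y ^ (α : ℝ) := by
      rw [div_mul_eq_mul_div, le_div_iff₀ (by positivity)]
      gcongr
    have h4 : 0 ≤ C * dist x y ^ (α : ℝ) := by positivity
    linarith

lemma ae_prod_eq {v : Rn n → ℝ} (h : u =ᵐ[volume] v) :
    ∀ᵐ z : Rn n × Rn n, u z.1 = v z.1 ∧ u z.2 = v z.2 := by
  rw [Measure.volume_eq_prod]
  filter_upwards [Measure.quasiMeasurePreserving_fst.ae h,
    Measure.quasiMeasurePreserving_snd.ae h] with z h1 h2 using ⟨h1, h2⟩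

lemma IsWeakSolution.congr {v : Rn n → ℝ} (hu : IsWeakSolution s p K Ω u) (h : u =ᵐ[volume] v) :
    IsWeakSolution s p K Ω v := by
  have h2 := ae_prod_eq h
  refine ⟨⟨hu.1.1.congr h, hu.1.2.1.ae_eq (ae_restrict_of_ae h), ?_⟩, fun φ hφ hφ0 => ?_⟩
  · refine lt_of_eq_of_lt (lintegral_congr_ae (ae_restrict_of_ae ?_)) hu.1.2.2
    filter_upwards [h2] with z hz
    rw [hz.1, hz.2]
  · rw [← hu.2 φ hφ hφ0]
    refine integral_congr_ae (ae_restrict_of_ae ?_)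
    filter_upwards [h2] with z hz
    rw [hz.1, hz.2]

lemma MemTail.congr {v : Rn n → ℝ} (hu : MemTail s p Ω u) (h : u =ᵐ[volume] v) :
    MemTail s p Ω v := by
  refine ⟨hu.1.congr h, lt_of_eq_of_lt ?_ hu.2⟩
  congr 1
  ext x
  refine lintegral_congr_ae ?_
  filter_upwards [h] with y hy
  rw [hy]

end Regularity

end NonlocalVar

/-! ### The main theorem -/

theorem theorem1p2 (n : ℕ) (hn : 2 ≤ n)
    (sm sM pm pM Λ cLH : ℝ)
    (hsm : 0 < sm) (hsM : sM < 1) (hpm : 1 < pm) (hΛ : 1 < Λ) (hcLH : 0 < cLH) :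
    ∃ α : ℝ≥0, 0 < α ∧ α < 1 ∧
      ∀ (Ω : Set (NonlocalVar.Rn n)) (s p K : NonlocalVar.Rn n → NonlocalVar.Rn n → ℝ)
        (u : NonlocalVar.Rn n → ℝ),
        IsOpen Ω → Bornology.IsBounded Ω →
        AEMeasurable (Function.uncurry s) volume →
        AEMeasurable (Function.uncurry p) volume →
        AEMeasurable (Function.uncurry K) volume →
        NonlocalVar.IsSymm s → NonlocalVar.IsSymm p → NonlocalVar.IsSymm K →
        NonlocalVar.HasBounds s sm sM → NonlocalVar.HasBounds p pm pM →
        NonlocalVar.KernelBound s p K Λ →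
        NonlocalVar.LogHolder s p Ω cLH →
        NonlocalVar.IsWeakSolution s p K Ω u →
        NonlocalVar.MemTail s p Ω u →
        NonlocalVar.MemHolderLoc α Ω u := by
  have hn0 : 0 < n := by omega
  obtain ⟨α, hα, hα1, hosc⟩ :=
    NonlocalVar.exists_local_osc_decay n hn0 sm sM pm pM Λ cLH hsm hsM hpm hΛ
  refine ⟨⟨α, hα.le⟩, hα, hα1, ?_⟩
  intro Ω s p K u hΩ hbdd hs hp hK hss hps hKs hsb hpb hKb hLH hweak htail
  -- The preceding theory needs a genuinely measurable function. All hypotheses on u are insensitive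
  -- to null sets, so they pass to v.
  set v := hweak.1.1.mk u with hv
  have huv : u =ᵐ[volume] v := hweak.1.1.ae_eq_mk
  have S : NonlocalVar.Solution sm sM pm pM Λ s p K Ω v :=
    ⟨⟨hsm, hsM, hpm, hΛ, fun x y => hsb.1.1 ⟨(x, y), rfl⟩, fun x y => hsb.2.1 ⟨(x, y), rfl⟩,
      fun x y => hpb.1.1 ⟨(x, y), rfl⟩, fun x y => hpb.2.1 ⟨(x, y), rfl⟩, hs, hp, hK, hss, hps, hKs,
      hKb⟩, hΩ, hbdd, hweak.1.1.measurable_mk, hweak.congr huv⟩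
  obtain ⟨G, hG, hGu⟩ := NonlocalVar.exists_common_full_set (u := v) (Ω := Ω) fun z hz => by
    obtain ⟨R, ρ, W, hR, hρ, hW, h⟩ := hosc s p K Ω v S hLH (htail.congr huv) z hz
    exact NonlocalVar.exists_holder_off_null hα hR hρ hW h
  obtain ⟨w, hw, hwl⟩ := NonlocalVar.exists_representative hα hΩ hG hGu
  refine ⟨w, ?_, fun Q hQ hQΩ =>
    NonlocalVar.exists_holderOnWith_of_isCompact hQ fun z hz => hwl z (hQΩ hz)⟩
  rw [ae_restrict_iff' hΩ.measurableSet]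
  filter_upwards [huv, hG] with x hx hxG hxΩ
  rw [hx, hw x hxΩ hxG]
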